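/- All logarithms are to base $2$. Let $n\ge 2$ range over the even integers. For a function $w\colon[n/2]\times[n/2]\to\mathbb Z$ and a bipartite graph $G$ with parts $\{u_1,\dots,u_{n/2}\}$ and $\{v_1,\dots,v_{n/2}\}$, let $w(i,j)$ be the weight of the edge $(u_i,v_j)$; $w$ is \emph{isolating} for $G$ if either $G$ has no perfect matching or exactly one perfect matching of $G$ has minimum weight. A function on bit strings is in quasi-$\mathsf{NC}^k$ if it is computed by a uniform family of Boolean circuits $(C_n)_n$ of fan-in two, of size $2^{\log^{O(1)} n}$ and depth $O(\log^k n)$, where $n$ is the number of input bits; uniform means that a Turing machine answers local queries about $C_n$ (the type of a gate, its predecessors, and the gates that are the outputs; $n$ and the names of gates are given in binary) in poly-logarithmic time, that is, in time polynomial in the length of the query. \textbf{Lemma.} There are constants $c,K$ and a function in quasi-$\mathsf{NC}^1$ which, for every even $n\ge2$, on input $1^n$ outputs a list of at most $K\,n^{6\log n}$ non-negative integer weight functions on $[n/2]\times[n/2]$, each weight being written in binary with exactly $c\lfloor\log n\rfloor^2=O(\log^2 n)$ bits (leading zeros allowed), such that for every bipartite graph $G$ on $n$ nodes with parts $\{u_1,\dots,u_{n/2}\}$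 and $\{v_1,\dots,v_{n/2}\}$ at least one function of the list is isolating for $G$. -/

import Mathlib

/-! ### Boolean circuits -/

/-- A gate of a Boolean circuit of fan-in at most two, with `n` input bits and gates named by
`Fin s`. The arguments of type `Fin s` are the gates feeding into the gate. -/
inductive Gate (n s : ℕ) : Type
  | const (v : Bool)
  | input (i : Fin n)
  | neg (a : Fin s)
  | conj (a b : Fin s)
  | disj (a b : Fin s)

/-- The gates feeding into a gate. -/
def Gate.preds {n s : ℕ} : Gate n s → Set (Fin s)
  | .const _ => ∅
  | .input _ => ∅
  | .neg a => {a}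
  | .conj a b => {a, b}
  | .disj a b => {a, b}

/-- An (acyclic) Boolean circuit of fan-in two with `n` input bits and `q` output bits. -/
structure Circuit (n q : ℕ) where
  size : ℕ
  gate : Fin size → Gate n size
  output : Fin q → Fin size
  acyclic : WellFounded fun h g => h ∈ (gate g).preds

/-- `C.Value x g v`: on input `x`, gate `g` of `C` has value `v`. -/
inductive Circuit.Value {n q : ℕ} (C : Circuit n q) (x : Fin n → Bool) :
    Fin C.size → Bool → Prop
  | const (g : Fin C.size) (v : Bool) : C.gate g = .const v → Circuit.Value C x g v
  | input (g : Fin C.size) (i : Fin n) : C.gate g = .input i → Circuit.Value C x g (x i)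
  | neg (g a : Fin C.size) (u : Bool) : C.gate g = .neg a → Circuit.Value C x a u →
      Circuit.Value C x g (!u)
  | conj (g a b : Fin C.size) (u v : Bool) : C.gate g = .conj a b →
      Circuit.Value C x a u → Circuit.Value C x b v → Circuit.Value C x g (u && v)
  | disj (g a b : Fin C.size) (u v : Bool) : C.gate g = .disj a b →
      Circuit.Value C x a u → Circuit.Value C x b v → Circuit.Value C x g (u || v)

/-- On input `x` the circuit outputs `y`. -/
def Circuit.Outputs {n q : ℕ} (C : Circuit n q) (x : Fin n → Bool) (y : Fin q → Bool) : Prop :=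
  ∀ p, C.Value x (C.output p) (y p)

/-- The circuit has depth at most `d`: the gates can be put on levels `0, …, d` such that every
gate lies strictly above the gates feeding into it. -/
def Circuit.DepthLE {n q : ℕ} (C : Circuit n q) (d : ℕ) : Prop :=
  ∃ level : Fin C.size → ℕ,
    (∀ g, ∀ h ∈ (C.gate g).preds, level h < level g) ∧ ∀ g, level g ≤ d

/-! ### Uniformity: the direct connection language -/

/-- The kinds of local queries about a circuit. -/
inductive QueryKind : Type
  | const (v : Bool)
  | input
  | neg
  | conjLeft
  | conjRight
  | disjLeft
  | disjRight
  | output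

/-- The answers to the local queries about a circuit. The query `(t, a, b)` asks for `t = const v`
whether `a` is the name of a constant gate of value `v` (`b` plays no role), for `t = input` whether
`a` is an input gate reading the `b`-th input bit, for `t = neg, conjLeft, …` whether `a` is a gate
of that type whose only (resp. left, right) predecessor is `b`, and for `t = output` whether the
`a`-th output is the gate `b`. -/
def Circuit.Connection {n q : ℕ} (C : Circuit n q) : QueryKind → ℕ → ℕ → Prop
  | .const v, a, _ => ∃ g : Fin C.size, g.val = a ∧ C.gate g = .const v
  | .input, a, b => ∃ (g : Fin C.size) (i : Fin n), g.val = a ∧ i.val = b ∧ C.gate g = .input i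
  | .neg, a, b => ∃ g h : Fin C.size, g.val = a ∧ h.val = b ∧ C.gate g = .neg h
  | .conjLeft, a, b => ∃ g h k : Fin C.size, g.val = a ∧ h.val = b ∧ C.gate g = .conj h k
  | .conjRight, a, b => ∃ g h k : Fin C.size, g.val = a ∧ h.val = b ∧ C.gate g = .conj k h
  | .disjLeft, a, b => ∃ g h k : Fin C.size, g.val = a ∧ h.val = b ∧ C.gate g = .disj h k
  | .disjRight, a, b => ∃ g h k : Fin C.size, g.val = a ∧ h.val = b ∧ C.gate g = .disj k h
  | .output, a, b => ∃ p : Fin q, p.val = a ∧ (C.output p).val = b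

/-- A local query about the `n`-th circuit of a family. -/
structure Query : Type where
  kind : QueryKind
  n : ℕ
  a : ℕ
  b : ℕ

/-- The alphabet in which queries are written. -/
inductive QuerySymbol : Type
  | kind (t : QueryKind)
  | bit (v : Bool)
  | comma

/-- A query as a string; `n`, `a` and `b` are written in binary. -/
def Query.encode (r : Query) : List QuerySymbol :=
  .kind r.kind :: (Nat.bits r.n).map .bit ++ .comma :: (Nat.bits r.a).map .bit ++
    .comma :: (Nat.bits r.b).map .bit

open Classical in
/-- The family of circuits is uniform: a Turing machine answers every local query in time polynomial
in the length of the query. As `n` is written in binary, and as the names of the gates of a circuit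
of quasi-polynomial size have poly-logarithmically many bits, this is poly-logarithmic time. -/
def UniformCircuits {q : ℕ → ℕ} (C : ∀ n, Circuit n (q n)) : Prop :=
  Nonempty (Turing.TM2ComputableInPolyTime Query.encode Computability.encodeBool
    fun r : Query => decide ((C r.n).Connection r.kind r.a r.b))

/-! ### The class quasi-NC^k -/

/-- The function `F` on bit strings is in quasi-NC^k: it is computed by a uniform family of circuits
of fan-in two, of quasi-polynomial size `2 ^ (log n) ^ O(1)` (outputs included) and of depth
`O((log n) ^ k)`, where `n` is the number of input bits. -/
def InQuasiNC (k : ℕ) (F : List Bool → List Bool) : Prop :=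
  ∃ (q : ℕ → ℕ) (C : ∀ n, Circuit n (q n)),
    UniformCircuits C ∧
    (∃ c : ℕ, ∀ n, 2 ≤ n → (C n).size + q n ≤ 2 ^ (c * Nat.log 2 n ^ c)) ∧
    (∃ c : ℕ, ∀ n, 2 ≤ n → (C n).DepthLE (c * Nat.log 2 n ^ k)) ∧
    ∀ n (x : Fin n → Bool), ∃ y : Fin (q n) → Bool,
      (C n).Outputs x y ∧ F (List.ofFn x) = List.ofFn y

/-! ### Weight functions and isolation -/

/-- The family `W` of `N` weight functions on `[m] × [m]` written as a bit string: the values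
`W r i j` in lexicographic order of `(r, i, j)`, each as a block of exactly `b` bits, least
significant bit first. -/
def encodeWeights {N m : ℕ} (b : ℕ) (W : Fin N → Fin m → Fin m → ℕ) : List Bool :=
  (List.ofFn fun r => (List.ofFn fun i => (List.ofFn fun j =>
    List.ofFn fun l : Fin b => (W r i j).testBit l).flatten).flatten).flatten

open Classical in
/-- The weight of a set of edges of a bipartite graph with parts `[m]` and `[m]`, where the edge
between the `i`-th left vertex and the `j`-th right vertex has weight `w i j`. -/
noncomputable def matchingWeight {m : ℕ} {G : SimpleGraph (Fin m ⊕ Fin m)}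
    (w : Fin m → Fin m → ℤ) (M : G.Subgraph) : ℤ :=
  ∑ i, ∑ j, if M.Adj (Sum.inl i) (Sum.inr j) then w i j else 0

/-- `w` is isolating for `G`: the perfect matching of minimum weight in `G` is unique, if `G` has a
perfect matching. -/
def IsIsolating {m : ℕ} (G : SimpleGraph (Fin m ⊕ Fin m)) (w : Fin m → Fin m → ℤ) : Prop :=
  (∃ M : G.Subgraph, M.IsPerfectMatching) →
    ∃! M : G.Subgraph, M.IsPerfectMatching ∧
      ∀ M' : G.Subgraph, M'.IsPerfectMatching → matchingWeight w M ≤ matchingWeight w M'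

/-! The list depends on `n` alone, so two constant gates suffice: every output is wired to one of
them and the depth is `0`. What remains is (a) a list that isolates, and (b) a Turing machine that
computes the bit at position `a` of the list in time polynomial in the lengths of `n` and `a`.

(a) Let `L` be the rounded-down logarithm of `n` and `m = n / 2 < 2 ^ L`; the edge `(i, j)` has
number `e = i * m + j`. The weights `2 ^ e` are nonzero on every nonzero vector with entries `-1`,
`0`, `1`, but they are too long; they are replaced by residues modulo numbers up to `2 ^ (6 * L)`,
in `L` rounds that refine each other lexicographically. In each round the graph shrinks to the union
of its minimum-weight perfect matchings. By Birkhoff's theorem every circulation on this union has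
weight zero (`circulation_eq_zero`), so a closed walk on which the weight is nonzero cannot survive.

If all closed walks with `2 ^ k` steps have zero vector, then those with twice as many steps have at
most `m ^ 4` vectors, each determined by four vertices (`NoShort.exists_finset`). The product of the
nonzero values of `2 ^ e` on the simple ones among them is at most `2 ^ m ^ 6`, too small to be
divisible by all numbers up to `2 ^ (6 * L)`; so some modulus keeps all of them nonzero
(`exists_modulus`), and the length free of nonzero closed walks doubles. After `L` rounds it exceeds
`m`, and two different perfect matchings would give a nonzero closed walk with at most `m` steps
(`NoShort.unique`). The `L` moduli are the digits of one number below `2 ^ (6 * L ^ 2)`, which is at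
most `n ^ (6 * log n)`.

(b) A bit of a weight is a bit of `2 ^ e` modulo one digit of that number, so fast exponentiation
finds it (`testBit_roundWeight`). The computation is written in a small language over registers of
`W` bits with loops of `W` rounds. Its programs run in polynomial time by construction:
`runs_compile` compiles them to machines with stacks. It then remains to verify the arithmetic, for
registers of 12 bits per symbol of the query (`query_spec`). -/

open Turing StateTransition

/-! ### Programs on binary registers -/

namespace BitProg

/-- Programs over registers that hold `W`-bit numbers, with a carry flag and a queue of input
symbols. `adder z x y neg c` sets `z` to `x + y + c`, with `y` complemented if `neg` holds (and
`0` in the place of a missing `y`), and the flag to the carry; `loop d p` repeats `p` exactly `W`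
times. -/
inductive Prog (R : Type) : Type
  | skip
  | adder (z x : R) (y : Option R) (neg c : Bool)
  | read
  | seq (p q : Prog R)
  | ite (t : Bool → Option QuerySymbol → Bool) (p q : Prog R)
  | loop (d : Fin 2) (p : Prog R)

/-- The memory on which programs operate. -/
structure Mem (R : Type) (W : ℕ) where
  regs : R → BitVec W
  flag : Bool
  sym : Option QuerySymbol
  aux : List QuerySymbol

variable {R : Type} [DecidableEq R] {W : ℕ}

/-- The second operand of an adder, `0` if there is none. -/
def Mem.get (s : Mem R W) (y : Option R) : BitVec W := y.elim 0 s.regs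

/-- The second summand of an adder. -/
def addend (neg : Bool) (y : BitVec W) : BitVec W := if neg then ~~~y else y

/-- The effect of an adder. -/
def Mem.adder (s : Mem R W) (z x : R) (y : Option R) (neg c : Bool) : Mem R W :=
  { s with
    regs := Function.update s.regs z
      (s.regs x + addend neg (s.get y) + BitVec.setWidth W (BitVec.ofBool c))
    flag := BitVec.carry W (s.regs x) (addend neg (s.get y)) c }

/-- The effect of reading an input symbol. -/
def Mem.read (s : Mem R W) : Mem R W := { s with sym := s.aux.head?, aux := s.aux.tail }

/-- The semantics of programs. -/
def eval : Prog R → Mem R W → Mem R W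
  | .skip, s => s
  | .adder z x y neg c, s => s.adder z x y neg c
  | .read, s => s.read
  | .seq p q, s => eval q (eval p s)
  | .ite t p q, s => if t s.flag s.sym then eval p s else eval q s
  | .loop _ p, s => (eval p)^[W] s

/-- Inner loops of a program have smaller index than the loops around them. -/
def Nested : Prog R → ℕ → Prop
  | .skip, _ => True
  | .adder .., _ => True
  | .read, _ => True
  | .seq p q, d => Nested p d ∧ Nested q d
  | .ite _ p q, d => Nested p d ∧ Nested q d
  | .loop e p, d => e.val < d ∧ Nested p e.val

/-- A bound for the number of steps of the Turing machine of a program. -/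
noncomputable def cost : Prog R → Polynomial ℕ
  | .skip => 1
  | .adder .. => 2 * Polynomial.X + 3
  | .read => 1
  | .seq p q => cost p + cost q
  | .ite _ p q => 1 + cost p + cost q
  | .loop _ p => Polynomial.X * (cost p + 3) + 2

/-! ### Compilation to Turing machines with several stacks -/

/-- The stacks of the Turing machines. -/
inductive Stack : Type
  | input
  | output
  | main
  | shadow
  | aux
  -- A loop of index `d` counts by moving marks from `tally d false` to `tally d true`, and at its
  -- end moves them all back.
  | tally (d : Fin 2) (b : Bool)
  deriving DecidableEq, Fintype

/-- The alphabets of the stacks. -/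
abbrev Alph (R : Type) : Stack → Type
  | .input => QuerySymbol
  | .output => Bool
  -- One symbol holds the bits of equal significance of all registers, the least significant column
  -- on top, so that an adder needs a single pass.
  | .main => R → Bool
  | .shadow => R → Bool
  | .aux => QuerySymbol
  | .tally _ _ => Unit

/-- The internal states of the Turing machines. -/
structure Ctl (R : Type) where
  flag : Bool
  sym : Option QuerySymbol
  cur : Option (R → Bool)

/-- The labels of the code of a program. -/
inductive Lab : Prog R → Type
  | skip : Lab .skip
  | adder {z x : R} {y : Option R} {neg c : Bool} (i : Fin 3) : Lab (.adder z x y neg c)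
  | read : Lab .read
  | seqLeft {p q : Prog R} (l : Lab p) : Lab (.seq p q)
  | seqRight {p q : Prog R} (l : Lab q) : Lab (.seq p q)
  | test {t : Bool → Option QuerySymbol → Bool} {p q : Prog R} : Lab (.ite t p q)
  | iteLeft {t : Bool → Option QuerySymbol → Bool} {p q : Prog R} (l : Lab p) : Lab (.ite t p q)
  | iteRight {t : Bool → Option QuerySymbol → Bool} {p q : Prog R} (l : Lab q) : Lab (.ite t p q)
  | head {d : Fin 2} {p : Prog R} (b : Bool) : Lab (.loop d p)
  | body {d : Fin 2} {p : Prog R} (l : Lab p) : Lab (.loop d p)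

omit [DecidableEq R] in
theorem finite_lab : ∀ p : Prog R, Finite (Lab p)
  | .skip => Finite.of_surjective (fun _ : Unit => Lab.skip) fun | .skip => ⟨(), rfl⟩
  | .adder .. => Finite.of_surjective Lab.adder fun | .adder i => ⟨i, rfl⟩
  | .read => Finite.of_surjective (fun _ : Unit => Lab.read) fun | .read => ⟨(), rfl⟩
  | .seq p q =>
    have := finite_lab p
    have := finite_lab q
    Finite.of_surjective (Sum.elim Lab.seqLeft Lab.seqRight) fun
      | .seqLeft l => ⟨.inl l, rfl⟩
      | .seqRight l => ⟨.inr l, rfl⟩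
  | .ite _ p q =>
    have := finite_lab p
    have := finite_lab q
    Finite.of_surjective (Sum.elim (fun _ : Unit => Lab.test) (Sum.elim Lab.iteLeft Lab.iteRight))
      fun
      | .test => ⟨.inl (), rfl⟩
      | .iteLeft l => ⟨.inr (.inl l), rfl⟩
      | .iteRight l => ⟨.inr (.inr l), rfl⟩
  | .loop _ p =>
    have := finite_lab p
    Finite.of_surjective (Sum.elim Lab.head Lab.body) fun
      | .head b => ⟨.inl b, rfl⟩
      | .body l => ⟨.inr l, rfl⟩

/-- The label at which the code of a program starts. -/
def entry : ∀ p : Prog R, Lab p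
  | .skip => .skip
  | .adder .. => .adder 0
  | .read => .read
  | .seq p _ => .seqLeft (entry p)
  | .ite _ _ _ => .test
  | .loop _ _ => .head false

/-- A full adder on one column. -/
def fullAdder (z x : R) (y : Option R) (neg c : Bool) (f : R → Bool) : Bool × (R → Bool) :=
  (Bool.atLeastTwo (f x) (neg ^^ y.elim false f) c, Function.update f z (f x ^^ ((neg ^^ y.elim false f) ^^ c)))

/-- Statements of the Turing machines. -/
abbrev Code (R Λ : Type) := TM2.Stmt (Alph R) Λ (Ctl R)

open TM2.Stmt

/-- The code of a program. -/
def code {Λ : Type} : ∀ p : Prog R, (Lab p → Λ) → Λ → Lab p → Code R Λ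
  | .skip, _, exit, _ => goto fun _ => exit
  | .adder _ _ _ _ c, emb, _, .adder 0 =>
      load (fun v => { v with flag := c }) <| goto fun _ => emb (.adder 1)
  -- The forward pass moves the columns to the shadow stack while adding, with the carry in the
  -- flag; the pass at label 2 restores their order.
  | .adder z x y neg _, emb, _, .adder 1 => pop .main (fun v o => { v with cur := o }) <|
      branch (fun v => v.cur.isSome)
        (push .shadow
          (fun v => (fullAdder z x y neg v.flag (v.cur.getD fun _ => false)).2) <|
          load (fun v => { v with
            flag := (fullAdder z x y neg v.flag (v.cur.getD fun _ => false)).1 }) <|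
          goto fun _ => emb (.adder 1))
        (goto fun _ => emb (.adder 2))
  | .adder _ _ _ _ _, emb, exit, .adder 2 => pop .shadow (fun v o => { v with cur := o }) <|
      branch (fun v => v.cur.isSome)
        (push .main (fun v => v.cur.getD fun _ => false) <| goto fun _ => emb (.adder 2))
        (goto fun _ => exit)
  | .read, _, exit, _ => pop .aux (fun v o => { v with sym := o }) <| goto fun _ => exit
  | .seq p q, emb, _, .seqLeft l =>
      code p (fun l => emb (.seqLeft l)) (emb (.seqRight (entry q))) l
  | .seq _ q, emb, exit, .seqRight l => code q (fun l => emb (.seqRight l)) exit l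
  | .ite t p q, emb, _, .test => branch (fun v => t v.flag v.sym)
      (goto fun _ => emb (.iteLeft (entry p))) (goto fun _ => emb (.iteRight (entry q)))
  | .ite _ p _, emb, exit, .iteLeft l => code p (fun l => emb (.iteLeft l)) exit l
  | .ite _ _ q, emb, exit, .iteRight l => code q (fun l => emb (.iteRight l)) exit l
  | .loop d p, emb, _, .head false =>
      pop (.tally d false) (fun v o => { v with cur := o.map fun _ _ => false }) <|
      branch (fun v => v.cur.isSome)
        (load (fun v => { v with cur := none }) <| push (.tally d true) (fun _ => ()) <|
          goto fun _ => emb (.body (entry p)))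
        (goto fun _ => emb (.head true))
  | .loop d _, emb, exit, .head true =>
      pop (.tally d true) (fun v o => { v with cur := o.map fun _ _ => false }) <|
      branch (fun v => v.cur.isSome)
        (load (fun v => { v with cur := none }) <| push (.tally d false) (fun _ => ()) <|
          goto fun _ => emb (.head true))
        (goto fun _ => exit)
  | .loop _ p, emb, _, .body l => code p (fun l => emb (.body l)) (emb (.head false)) l

/-- The contents of all the stacks. -/
def contents (inp : List QuerySymbol) (out : List Bool) (mn sh : List (R → Bool))
    (aux : List QuerySymbol) (T : Fin 2 → Bool → List Unit) : ∀ k, List (Alph R k)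
  | .input => inp
  | .output => out
  | .main => mn
  | .shadow => sh
  | .aux => aux
  | .tally d b => T d b

section contents

variable (inp inp' : List QuerySymbol) (out out' : List Bool) (mn sh mn' : List (R → Bool))
  (aux aux' : List QuerySymbol) (T : Fin 2 → Bool → List Unit)

omit [DecidableEq R]

@[simp] theorem contents_input : contents inp out mn sh aux T .input = inp := rfl
@[simp] theorem contents_output : contents inp out mn sh aux T .output = out := rfl
@[simp] theorem contents_main : contents inp out mn sh aux T .main = mn := rfl
@[simp] theorem contents_shadow : contents inp out mn sh aux T .shadow = sh := rfl
@[simp] theorem contents_aux : contents inp out mn sh aux T .aux = aux := rfl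
@[simp] theorem contents_tally (d b) : contents inp out mn sh aux T (.tally d b) = T d b := rfl

@[simp] theorem update_contents_input :
    Function.update (contents inp out mn sh aux T) .input inp' = contents inp' out mn sh aux T := by
  funext k; cases k <;> rfl

@[simp] theorem update_contents_output :
    Function.update (contents inp out mn sh aux T) .output out' = contents inp out' mn sh aux T := by
  funext k; cases k <;> rfl

@[simp] theorem update_contents_main :
    Function.update (contents inp out mn sh aux T) .main mn' = contents inp out mn' sh aux T := by
  funext k; cases k <;> rfl

@[simp] theorem update_contents_shadow :
    Function.update (contents inp out mn sh aux T) .shadow mn' = contents inp out mn mn' aux T := by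
  funext k; cases k <;> rfl

@[simp] theorem update_contents_aux :
    Function.update (contents inp out mn sh aux T) .aux aux' = contents inp out mn sh aux' T := by
  funext k; cases k <;> rfl

@[simp] theorem update_contents_tally (d b) (x : List Unit) :
    Function.update (contents inp out mn sh aux T) (.tally d b) x =
      contents inp out mn sh aux (Function.update T d (Function.update (T d) b x)) := by
  funext k
  cases k with
  | tally e b' =>
    by_cases h : e = d
    · subst h
      by_cases h' : b' = b
      · subst h'; simp
      · simp [h', Function.update_of_ne]
    · simp [h, Function.update_of_ne]
  | _ => rfl

end contents

/-! ### Runs of machines with a bound on the time -/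

section Runs

variable {Λ : Type}

/-- The configurations of the Turing machines. -/
abbrev Conf (R Λ : Type) := TM2.Cfg (Alph R) Λ (Ctl R)

/-- The machine `M` gets from the first to the second configuration in at most `t` steps. -/
def Runs (M : Λ → Code R Λ) (t : ℕ) (c c' : Conf R Λ) : Prop :=
  Nonempty (EvalsToInTime (TM2.step M) c (some c') t)

omit [DecidableEq R] in
theorem Runs.trans {M : Λ → Code R Λ} {t₁ t₂ : ℕ} {a b c : Conf R Λ} (h₁ : Runs M t₁ a b)
    (h₂ : Runs M t₂ b c) : Runs M (t₁ + t₂) a c := by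
  obtain ⟨h₁⟩ := h₁
  obtain ⟨h₂⟩ := h₂
  rw [add_comm]
  exact ⟨EvalsToInTime.trans _ _ _ _ _ _ h₁ h₂⟩

omit [DecidableEq R] in
theorem Runs.mono {M : Λ → Code R Λ} {t₁ t₂ : ℕ} {a b : Conf R Λ} (h₁ : Runs M t₁ a b)
    (h : t₁ ≤ t₂) : Runs M t₂ a b := by
  obtain ⟨h₁⟩ := h₁
  exact ⟨⟨h₁.toEvalsTo, h₁.steps_le_m.trans h⟩⟩

omit [DecidableEq R] in
theorem Runs.one {M : Λ → Code R Λ} {l : Λ} {v : Ctl R} {S : ∀ k, List (Alph R k)}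
    {c : Conf R Λ} (h : TM2.stepAux (M l) v S = c) : Runs M 1 ⟨some l, v, S⟩ c :=
  ⟨⟨⟨1, by subst h; rfl⟩, le_rfl⟩⟩

end Runs

/-- The `i`-th bits of all the registers. -/
def column (g : R → BitVec W) (i : ℕ) : R → Bool := fun r => (g r).getLsbD i

/-- The contents of the registers as a list of columns. -/
def tape (g : R → BitVec W) : List (R → Bool) := (List.range W).map (column g)

omit [DecidableEq R] in
theorem getLsbD_addend {neg : Bool} {y : BitVec W} {i : ℕ} (hi : i < W) :
    (addend neg y).getLsbD i = (neg ^^ y.getLsbD i) := by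
  cases neg <;> simp [addend, hi]

omit [DecidableEq R] in
theorem elim_column (s : Mem R W) (y : Option R) (i : ℕ) :
    y.elim false (column s.regs i) = (s.get y).getLsbD i := by
  cases y <;> simp [Mem.get, column]

/-- Ties the machine's column-wise addition to `BitVec` addition: before column `i` the flag is the
carry into bit `i`. -/
theorem fullAdder_column (s : Mem R W) (z x : R) (y : Option R) (neg c : Bool) {i : ℕ}
    (hi : i < W) :
    fullAdder z x y neg (BitVec.carry i (s.regs x) (addend neg (s.get y)) c) (column s.regs i) =
      (BitVec.carry (i + 1) (s.regs x) (addend neg (s.get y)) c,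
        column (s.adder z x y neg c).regs i) := by
  refine Prod.ext ?_ ?_
  · simp [fullAdder, elim_column, column, BitVec.carry_succ, getLsbD_addend hi]
  · funext r
    by_cases h : r = z
    · subst h
      simp only [fullAdder, elim_column, column, Mem.adder, Function.update_self]
      rw [BitVec.getLsbD_add_add_bool hi, getLsbD_addend hi]
    · simp [fullAdder, column, Mem.adder, Function.update_of_ne h]

/-- The configuration of the Turing machine for a memory, at a label. -/
def conf {Λ : Type} (l : Λ) (s : Mem R W) (T : Fin 2 → Bool → List Unit) : Conf R Λ :=
  ⟨some l, ⟨s.flag, s.sym, none⟩, contents [] [] (tape s.regs) [] s.aux T⟩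

/-! ### Correctness and running time of the compiled code -/

section compile

variable {Λ : Type} {M : Λ → Code R Λ}

/-- Induction on the number `n` of columns still to come. The first `i` columns lie, updated and
reversed, on the shadow stack; the others still have their old contents, so `z` may coincide with a
summand. -/
theorem runs_adder_forward (z x : R) (y : Option R) (neg c : Bool) (emb : Lab (.adder z x y neg c) → Λ) (exit : Λ)
    (hM : ∀ l, M (emb l) = code (.adder z x y neg c) emb exit l) (s : Mem R W)
    (T : Fin 2 → Bool → List Unit) :
    ∀ (n i : ℕ) (cur : Option (R → Bool)), i + n = W → Runs M (n + 1)
      ⟨some (emb (.adder 1)), ⟨BitVec.carry i (s.regs x) (addend neg (s.get y)) c, s.sym, cur⟩,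
        contents [] [] ((List.range' i n).map (column s.regs))
          (((List.range i).map (column (s.adder z x y neg c).regs)).reverse) s.aux T⟩
      ⟨some (emb (.adder 2)), ⟨(s.adder z x y neg c).flag, s.sym, none⟩,
        contents [] [] [] (tape (s.adder z x y neg c).regs).reverse s.aux T⟩ := by
  intro n
  induction n with
  | zero =>
    rintro i cur rfl
    refine Runs.one ?_
    rw [hM]
    simp [code, tape, Mem.adder]
  | succ n ih =>
    rintro i cur hi
    rw [add_comm (n + 1) 1]
    refine Runs.trans (Runs.one ?_)
      (ih (i + 1) (some (column s.regs i)) (by omega))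
    rw [hM]
    simp [code, List.range'_succ, List.range_succ, fullAdder_column s z x y neg c (i := i) (by omega)]

omit [DecidableEq R] in
theorem runs_backward (b : Λ) (exit : Λ) (hM : M b =
      pop .shadow (fun v o => { v with cur := o })
        (branch (fun v => v.cur.isSome)
          (push .main (fun v => v.cur.getD fun _ => false) <| goto fun _ => b)
          (goto fun _ => exit))) (f : Bool) (sym : Option QuerySymbol)
    (aux : List QuerySymbol) (T : Fin 2 → Bool → List Unit) :
    ∀ (sh mn : List (R → Bool)) (cur : Option (R → Bool)), Runs M (sh.length + 1)
      ⟨some b, ⟨f, sym, cur⟩, contents [] [] mn sh aux T⟩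
      ⟨some exit, ⟨f, sym, none⟩, contents [] [] (sh.reverse ++ mn) [] aux T⟩ := by
  intro sh
  induction sh with
  | nil =>
    intro mn cur
    refine Runs.one ?_
    rw [hM]
    simp
  | cons a sh ih =>
    intro mn cur
    rw [List.length_cons, add_comm (sh.length + 1) 1]
    refine Runs.trans (Runs.one ?_) (by simpa using ih (a :: mn) (some a))
    rw [hM]
    simp

theorem runs_adder (z x : R) (y : Option R) (neg c : Bool) (emb : Lab (.adder z x y neg c) → Λ) (exit : Λ)
    (hM : ∀ l, M (emb l) = code (.adder z x y neg c) emb exit l) (s : Mem R W)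
    (T : Fin 2 → Bool → List Unit) :
    Runs M (2 * W + 3) (conf (emb (.adder 0)) s T) (conf exit (s.adder z x y neg c) T) := by
  have h0 : Runs M 1 (conf (emb (.adder 0)) s T)
      ⟨some (emb (.adder 1)), ⟨BitVec.carry 0 (s.regs x) (addend neg (s.get y)) c, s.sym, none⟩,
        contents [] [] (tape s.regs) [] s.aux T⟩ := by
    refine Runs.one ?_
    rw [hM]
    simp [code]
  have h1 := runs_adder_forward z x y neg c emb exit hM s T W 0 none (by omega)
  have h2 := runs_backward (M := M) (emb (.adder 2)) exit (hM (.adder 2)) (s.adder z x y neg c).flag s.sym s.aux T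
    (tape (s.adder z x y neg c).regs).reverse [] none
  simp only [← List.range_eq_range'] at h1
  refine ((h0.trans h1).trans ?_).mono (t₁ := 1 + (W + 1) + (W + 1)) (by omega)
  simpa [tape, conf, Mem.adder] using h2

omit [DecidableEq R] in
-- Refills the tally after a loop, so that the same loop can be entered again.
theorem runs_rewind (b exit : Λ) (d : Fin 2) (hM : M b =
      pop (.tally d true) (fun v o => { v with cur := o.map fun _ _ => false })
        (branch (fun v => v.cur.isSome)
          (load (fun v => { v with cur := none }) <| push (.tally d false) (fun _ => ()) <|
            goto fun _ => b)
          (goto fun _ => exit))) (s : Mem R W) (T : Fin 2 → Bool → List Unit) :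
    ∀ n k : ℕ, Runs M (n + 1)
      (conf b s (Function.update T d
        (fun b => List.replicate (if b then n else k) ())))
      (conf exit s (Function.update T d
        (fun b => List.replicate (if b then 0 else k + n) ()))) := by
  intro n
  induction n with
  | zero =>
    intro k
    refine Runs.one ?_
    rw [hM]
    simp only [TM2.stepAux, contents_tally, update_contents_tally, Function.update_self]
    simp only [if_true, List.replicate_zero, List.head?_nil, Option.map_none, Option.isSome_none,
      cond_false, List.tail_nil, conf, add_zero, Function.update_idem]
    congr 3
    funext b
    cases b <;> rfl
  | succ n ih =>
    intro k
    rw [add_comm (n + 1) 1]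
    have h := ih (k + 1)
    rw [show k + 1 + n = k + (n + 1) by omega] at h
    refine Runs.trans (Runs.one ?_) h
    rw [hM]
    simp only [TM2.stepAux, contents_tally, update_contents_tally, Function.update_self]
    simp only [if_true, List.replicate_succ, List.head?_cons, Option.map_some, Option.isSome_some,
      cond_true, List.tail_cons, conf, Function.update_idem]
    congr 3
    funext b
    cases b <;> rfl

/-- Structural induction, for arbitrary `emb` and `exit` because the code of a subprogram sits
inside a larger machine. Only tallies of index below `d` have to be full: `Nested` ensures that the
body of a loop never touches the tally that counts the loop. -/
theorem runs_compile (p : Prog R) : ∀ (d : ℕ) (_ : Nested p d) (emb : Lab p → Λ) (exit : Λ)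
    (_ : ∀ l, M (emb l) = code p emb exit l) (s : Mem R W) (T : Fin 2 → Bool → List Unit)
    (_ : ∀ j : Fin 2, j.val < d → T j = fun b => List.replicate (if b then 0 else W) ()),
    Runs M ((cost p).eval W) (conf (emb (entry p)) s T) (conf exit (eval p s) T) := by
  induction p with
  | skip =>
    intro d hd emb exit hM s T hT
    simp only [cost, Polynomial.eval_one]
    refine Runs.one ?_
    rw [hM]
    rfl
  | adder z x y neg c =>
    intro d hd emb exit hM s T hT
    refine (runs_adder z x y neg c emb exit hM s T).mono ?_
    simp [cost]
  | read =>
    intro d hd emb exit hM s T hT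
    simp only [cost, Polynomial.eval_one]
    refine Runs.one ?_
    rw [hM]
    simp [code, eval, Mem.read, conf]
  | seq p q ihp ihq =>
    intro d hd emb exit hM s T hT
    simp only [cost, Polynomial.eval_add]
    exact (ihp d hd.1 (fun l => emb (.seqLeft l)) _ (fun l => hM (.seqLeft l)) s T hT).trans
      (ihq d hd.2 (fun l => emb (.seqRight l)) _ (fun l => hM (.seqRight l)) _ T hT)
  | ite t p q ihp ihq =>
    intro d hd emb exit hM s T hT
    simp only [cost, Polynomial.eval_add, Polynomial.eval_one, eval]
    by_cases h : t s.flag s.sym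
    · have h0 : Runs M 1 (conf (emb .test) s T) (conf (emb (.iteLeft (entry p))) s T) := by
        refine Runs.one ?_
        rw [hM]
        simp [code, conf, h]
      rw [if_pos h]
      refine (h0.trans (ihp d hd.1 (fun l => emb (.iteLeft l)) _
        (fun l => hM (.iteLeft l)) s T hT)).mono (by omega)
    · have h0 : Runs M 1 (conf (emb .test) s T) (conf (emb (.iteRight (entry q))) s T) := by
        refine Runs.one ?_
        rw [hM]
        simp [code, conf, h]
      rw [if_neg h]
      refine (h0.trans (ihq d hd.2 (fun l => emb (.iteRight l)) _
        (fun l => hM (.iteRight l)) s T hT)).mono (by omega)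
  | loop e p ih =>
    intro d hd emb exit hM s T hT
    simp only [cost, Polynomial.eval_add, Polynomial.eval_mul, Polynomial.eval_X,
      Polynomial.eval_ofNat, eval]
    -- Here `n` rounds remain and `k` are done. Rewinding costs one more step per round, whence the
    -- `3` in `cost`.
    have key : ∀ n k : ℕ, ∀ s : Mem R W, Runs M (n * ((cost p).eval W + 2) + 1)
        (conf (emb (.head false)) s (Function.update T e
          (fun b => List.replicate (if b then k else n) ())))
        (conf (emb (.head true)) ((eval p)^[n] s) (Function.update T e
          (fun b => List.replicate (if b then k + n else 0) ()))) := by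
      intro n
      induction n with
      | zero =>
        intro k s
        rw [zero_mul, zero_add]
        refine Runs.one ?_
        rw [hM]
        simp only [code, TM2.stepAux, contents_tally, update_contents_tally, Function.update_self]
        simp only [Bool.false_eq_true, if_false, List.replicate_zero, List.head?_nil,
          Option.map_none, Option.isSome_none,
          cond_false, List.tail_nil, conf, add_zero, Function.update_idem]
        congr 3
        funext b
        cases b <;> rfl
      | succ n ih' =>
        intro k s
        have h0 : Runs M 1 (conf (emb (.head false)) s (Function.update T e
            (fun b => List.replicate (if b then k else n + 1) ())))
            (conf (emb (.body (entry p))) s (Function.update T e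
              (fun b => List.replicate (if b then k + 1 else n) ()))) := by
          refine Runs.one ?_
          rw [hM]
          simp only [code, TM2.stepAux, contents_tally, update_contents_tally, Function.update_self]
          simp only [Bool.false_eq_true, if_false, List.replicate_succ, List.head?_cons,
            Option.map_some, Option.isSome_some,
            cond_true, List.tail_cons, conf, Function.update_idem]
          congr 3
          funext b
          cases b <;> rfl
        have h1 := ih e.val hd.2 (fun l => emb (.body l)) (emb (.head false))
          (fun l => hM (.body l)) s (Function.update T e
              (fun b => List.replicate (if b then k + 1 else n) ())) (by
            intro j hj
            rw [Function.update_of_ne (by rintro rfl; omega)]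
            exact hT j (hj.trans hd.1))
        have h2 := ih' (k + 1) (eval p s)
        rw [show k + 1 + n = k + (n + 1) by omega] at h2
        refine ((h0.trans h1).trans h2).mono ?_
        rw [Nat.succ_mul]
        omega
    have h1 := key W 0 s
    have h2 := runs_rewind (M := M) (emb (.head true)) exit e (hM (.head true)) ((eval p)^[W] s) T W 0
    have hT' : Function.update T e (fun b => List.replicate (if b then 0 else W) ()) = T := by
      rw [← hT e hd.1, Function.update_eq_self]
    have h3 := h1.trans (by simpa using h2)
    simp only [hT'] at h3
    refine h3.mono ?_
    have : W * ((cost p).eval W + 3) = W * ((cost p).eval W + 2) + W := by ring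
    omega

end compile

end BitProg

open Turing StateTransition

namespace BitProg

/-! ### Programs that decide queries -/

theorem finite_queryKind : Finite QueryKind :=
  Finite.of_surjective
    (fun i : Fin 9 => match i with
      | 0 => QueryKind.const false
      | 1 => QueryKind.const true
      | 2 => QueryKind.input
      | 3 => QueryKind.neg
      | 4 => QueryKind.conjLeft
      | 5 => QueryKind.conjRight
      | 6 => QueryKind.disjLeft
      | 7 => QueryKind.disjRight
      | 8 => QueryKind.output : Fin 9 → QueryKind) fun
    | .const false => ⟨0, rfl⟩
    | .const true => ⟨1, rfl⟩
    | .input => ⟨2, rfl⟩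
    | .neg => ⟨3, rfl⟩
    | .conjLeft => ⟨4, rfl⟩
    | .conjRight => ⟨5, rfl⟩
    | .disjLeft => ⟨6, rfl⟩
    | .disjRight => ⟨7, rfl⟩
    | .output => ⟨8, rfl⟩

theorem finite_querySymbol : Finite QuerySymbol :=
  have := finite_queryKind
  Finite.of_surjective
    (Sum.elim QuerySymbol.kind (Sum.elim QuerySymbol.bit fun _ : Unit => QuerySymbol.comma))
    fun
    | .kind t => ⟨.inl t, rfl⟩
    | .bit v => ⟨.inr (.inl v), rfl⟩
    | .comma => ⟨.inr (.inr ()), rfl⟩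

theorem finite_ctl (R : Type) [Finite R] : Finite (Ctl R) :=
  have := finite_querySymbol
  Finite.of_injective (fun v : Ctl R => (v.flag, v.sym, v.cur)) fun v w h => by
    cases v; cases w; simp_all

/-! ### Loading the query and printing the answer -/

open TM2.Stmt

variable {R : Type}

/-- Push a symbol several times. -/
def pushes {Λ : Type} (k : Stack) (f : Ctl R → Alph R k) : ℕ → Code R Λ → Code R Λ
  | 0, q => q
  | n + 1, q => push k f (pushes k f n q)

theorem stepAux_pushes {Λ : Type} (k : Stack) (f : Ctl R → Alph R k) (n : ℕ) (q : Code R Λ)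
    (v : Ctl R) (S : ∀ k, List (Alph R k)) :
    TM2.stepAux (pushes k f n q) v S =
      TM2.stepAux q v (Function.update S k (List.replicate n (f v) ++ S k)) := by
  induction n generalizing S with
  | zero => simp [pushes]
  | succ n ih =>
    simp only [pushes, TM2.stepAux]
    rw [ih]
    simp [List.replicate_succ', Function.update_idem]

variable [DecidableEq R]

/-- The program of the Turing machine that prepares the memory for `p`, executes `p`, clears
the stacks, and outputs the flag. -/
def machine (c : ℕ) (p : Prog R) : Bool ⊕ Lab p → Code R (Bool ⊕ Lab p)
  | .inl false => pop .input (fun v o => { v with sym := o }) <|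
      branch (fun v => v.sym.isSome)
        -- Every symbol of the input adds `c` zero columns and `c` marks to each tally, which makes
        -- `W` equal to `c` times the length of the input. The input gets reversed on its way to
        -- `aux`.
        (push .aux (fun v => v.sym.getD .comma) <|
          pushes .main (fun _ _ => false) c <|
          pushes (.tally 0 false) (fun _ => ()) c <|
          pushes (.tally 1 false) (fun _ => ()) c <|
          goto fun _ => .inl false)
        (goto fun _ => .inr (entry p))
  | .inl true => pop .main (fun v o => { v with cur := o }) <|
      branch (fun v => v.cur.isSome)
        (pop (.tally 0 false) (fun v _ => v) <| pop (.tally 1 false) (fun v _ => v) <|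
          goto fun _ => .inl true)
        -- `haltList` demands the initial internal state and empty stacks apart from the output,
        -- hence the cleaning.
        (push .output (fun v => v.flag) <| load (fun _ => ⟨false, none, none⟩) <| halt)
  | .inr l => code p .inr (.inl true) l

/-- The tallies of a machine at rest. -/
def fullTally (W : ℕ) : Fin 2 → Bool → List Unit :=
  fun _ b => List.replicate (if b then 0 else W) ()

theorem update_fullTally (n m : ℕ) : Function.update (Function.update (fullTally n) 0
      (Function.update (fullTally n 0) false (List.replicate m ()))) 1
      (Function.update (fullTally n 1) false (List.replicate m ())) = fullTally m := by
  funext d b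
  fin_cases d <;> cases b <;> simp [fullTally]

theorem runs_prepare (c : ℕ) (p : Prog R) (l : List QuerySymbol) :
    ∀ (n : ℕ) (aux : List QuerySymbol) (sym : Option QuerySymbol),
      Runs (machine c p) (l.length + 1)
        ⟨some (.inl false), ⟨false, sym, none⟩,
          contents l [] (List.replicate n fun _ => false) [] aux (fullTally n)⟩
        ⟨some (.inr (entry p)), ⟨false, none, none⟩,
          contents [] [] (List.replicate (n + c * l.length) fun _ => false) []
            (l.reverse ++ aux) (fullTally (n + c * l.length))⟩ := by
  induction l with
  | nil =>
    intro n aux sym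
    refine Runs.one ?_
    simp [machine]
  | cons a l ih =>
    intro n aux sym
    rw [List.length_cons, add_comm (l.length + 1) 1]
    have h := ih (n + c) (a :: aux) (some a)
    rw [show n + c + c * l.length = n + c * (l.length + 1) by ring] at h
    refine Runs.trans (Runs.one ?_) (by simpa using h)
    simp only [machine, TM2.stepAux, stepAux_pushes, contents_input, update_contents_input,
      List.head?_cons, Option.isSome_some, cond_true, contents_aux, update_contents_aux,
      contents_main, update_contents_main, contents_tally, update_contents_tally,
      List.replicate_append_replicate, Option.getD_some, List.tail_cons]
    congr 2
    · rw [add_comm]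
    · rw [← update_fullTally n (n + c), add_comm n c, ← List.replicate_append_replicate]
      rfl

theorem runs_clear (c : ℕ) (p : Prog R) (l : List (R → Bool)) :
    ∀ (f : Bool) (sym : Option QuerySymbol) (cur : Option (R → Bool)),
      Runs (machine c p) (l.length + 1)
        ⟨some (.inl true), ⟨f, sym, cur⟩, contents [] [] l [] [] (fullTally l.length)⟩
        ⟨none, ⟨false, none, none⟩, contents [] [f] [] [] [] fun _ _ => []⟩ := by
  induction l with
  | nil =>
    intro f sym cur
    refine Runs.one ?_
    simp only [machine, TM2.stepAux, contents_main, update_contents_main,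
      List.head?_nil, Option.isSome_none, cond_false, contents_output, update_contents_output,
      List.tail_nil]
    congr 2
    funext d b
    cases b <;> rfl
  | cons a l ih =>
    intro f sym cur
    rw [List.length_cons, add_comm (l.length + 1) 1]
    refine Runs.trans (Runs.one ?_) (ih f sym (some a))
    simp only [machine, TM2.stepAux, contents_main, update_contents_main,
      List.head?_cons, Option.isSome_some, cond_true, contents_tally, update_contents_tally,
      List.tail_cons]
    rw [← update_fullTally (l.length + 1) l.length]
    rfl

/-- The memory at the start of a program. -/
def start (W : ℕ) (l : List QuerySymbol) : Mem R W :=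
  { regs := fun _ => 0, flag := false, sym := none, aux := l.reverse }

theorem runs_machine (c : ℕ) (p : Prog R) (hp : Nested p 2) (l : List QuerySymbol)
    (h : (eval p (start (c * l.length) l)).aux = []) :
    Runs (machine c p) ((l.length + 1) + (cost p).eval (c * l.length) + (c * l.length + 1))
      ⟨some (.inl false), ⟨false, none, none⟩, contents l [] [] [] [] fun _ _ => []⟩
      ⟨none, ⟨false, none, none⟩,
        contents [] [(eval p (start (c * l.length) l)).flag] [] [] [] fun _ _ => []⟩ := by
  have h0 := runs_prepare c p l 0 [] none
  have h1 := runs_compile (M := machine c p) p 2 hp .inr (.inl true) (fun l => rfl)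
    (start (c * l.length) l) (fullTally (c * l.length)) (fun _ _ => rfl)
  have h2 := runs_clear c p (tape (eval p (start (c * l.length) l)).regs)
    (eval p (start (c * l.length) l)).flag (eval p (start (c * l.length) l)).sym none
  have e1 : tape (start (R := R) (c * l.length) l).regs =
      List.replicate (c * l.length) fun _ => false := by
    refine List.eq_replicate_iff.2 ⟨by simp [tape], ?_⟩
    intro b hb
    obtain ⟨i, -, rfl⟩ := List.mem_map.1 hb
    funext r
    simp [column, start]
  have e2 : fullTally 0 = fun _ _ => [] := by
    funext d b
    cases b <;> rfl
  rw [e2] at h0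
  simp only [conf, e1] at h1
  rw [h] at h1
  simp only [List.append_nil, zero_add, List.replicate_zero] at h0
  have e3 : (tape (eval p (start (c * l.length) l)).regs).length = c * l.length := by
    simp [tape]
  rw [e3] at h2
  exact (h0.trans h1).trans h2

/-- A function that is computed by a program is computable in polynomial time. -/
theorem computable_of_prog [Finite R] (c : ℕ) (p : Prog R) (hp : Nested p 2) {α : Type}
    (enc : α → List QuerySymbol) (f : α → Bool)
    (haux : ∀ a, (eval p (start (c * (enc a).length) (enc a))).aux = [])
    (hf : ∀ a, (eval p (start (c * (enc a).length) (enc a))).flag = f a) :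
    Nonempty (TM2ComputableInPolyTime enc Computability.encodeBool f) := by
  have i1 := finite_lab p
  have i2 := finite_ctl R
  have i3 := finite_querySymbol
  let tm : FinTM2 :=
    { K := Stack
      k₀ := .input
      k₁ := .output
      Γ := Alph R
      Λ := Bool ⊕ Lab p
      main := .inl false
      ΛFin := Fintype.ofFinite _
      σ := Ctl R
      initialState := ⟨false, none, none⟩
      σFin := Fintype.ofFinite _
      Γk₀Fin := Fintype.ofFinite QuerySymbol
      m := machine c p }
  refine ⟨⟨⟨tm, Equiv.refl _, Equiv.refl _⟩,
    -- The three summands pay for loading, for the program with registers of `c` times the input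
    -- length, and for cleaning.
    (Polynomial.X + 1) + (cost p).comp (Polynomial.C c * Polynomial.X) + (Polynomial.C c * Polynomial.X + 1), fun a => ?_⟩⟩
  have hi : ∀ l, initList tm l = ⟨some (.inl false), ⟨false, none, none⟩,
      contents l [] [] [] [] fun _ _ => []⟩ := by
    intro l
    unfold initList
    congr 1
    funext k
    cases k <;> rfl
  have ho : ∀ l, haltList tm l = ⟨none, ⟨false, none, none⟩,
      contents [] l [] [] [] fun _ _ => []⟩ := by
    intro l
    unfold haltList
    congr 1
    funext k
    cases k <;> rfl
  have h := runs_machine c p hp (enc a) (haux a)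
  rw [hf a] at h
  have e : (List.map (Equiv.refl (tm.Γ tm.k₀)).invFun (enc a)) = enc a := List.map_id _
  unfold TM2OutputsInTime
  simp only [Option.map_some]
  rw [hi, ho]
  have ht : (enc a).length + 1 + (cost p).eval (c * (enc a).length) + (c * (enc a).length + 1) ≤
      ((Polynomial.X + 1) + (cost p).comp (Polynomial.C c * Polynomial.X) +
        (Polynomial.C c * Polynomial.X + 1)).eval (enc a).length := by
    simp
  rw [e]
  exact Classical.choice (h.mono ht)

end BitProg

namespace BitProg

/-! ### Arithmetic programs -/

/-- The registers. -/
inductive Reg : Type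
  | n | a | b | cons | value | out
  | num | den | quo | rem | shf | tmp
  | fac | fac' | prd
  | pow | lg | sq | blk | wid | base
  | ex | idx | pos | off | dig | cnt | chk | exs
  deriving DecidableEq

theorem finite_reg : Finite Reg :=
  Set.finite_univ_iff.1 <| (List.finite_toSet [.n, .a, .b, .cons, .value, .out, .num, .den, .quo,
    .rem, .shf, .tmp, .fac, .fac', .prd, .pow, .lg, .sq, .blk, .wid, .base, .ex, .idx, .pos, .off,
    .dig, .cnt, .chk, .exs]).subset fun r _ => by cases r <;> simp

variable {W : ℕ}

/-- The number in a register. -/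
def val (s : Mem Reg W) (r : Reg) : ℕ := (s.regs r).toNat

theorem val_lt (s : Mem Reg W) (r : Reg) : val s r < 2 ^ W := (s.regs r).isLt

/-- The registers a program may change. -/
def writes : Prog Reg → Reg → Bool
  | .skip, _ => false
  | .adder z _ _ _ _, r => decide (r = z)
  | .read, _ => false
  | .seq p q, r => writes p r || writes q r
  | .ite _ p q, r => writes p r || writes q r
  | .loop _ p, r => writes p r

/-- Whether a program reads no input symbols. -/
def readFree : Prog Reg → Bool
  | .skip => true
  | .adder .. => true
  | .read => false
  | .seq p q => readFree p && readFree q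
  | .ite _ p q => readFree p && readFree q
  | .loop _ p => readFree p

/-- The rule by which all loops are verified; the invariant may depend on the number of rounds done.
-/
theorem iterate_invariant {α : Type*} {f : α → α} (I : ℕ → α → Prop) {s : α} (n : ℕ) (h0 : I 0 s)
    (hs : ∀ t < n, ∀ s, I t s → I (t + 1) (f s)) : I n (f^[n] s) := by
  have h : ∀ t ≤ n, I t (f^[t] s) := by
    intro t
    induction t with
    | zero => exact fun _ => h0
    | succ t ih =>
      intro ht
      rw [Function.iterate_succ_apply']
      exact hs t ht _ (ih (by omega))
  exact h n le_rfl

/-- The frame rule. Since `writes` computes, its hypothesis is settled by `rfl` for concrete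
programs. -/
theorem val_of_not_writes {p : Prog Reg} {r : Reg} (h : writes p r = false) (s : Mem Reg W) :
    val (eval p s) r = val s r := by
  induction p generalizing s with
  | skip => rfl
  | adder z x y neg c =>
    have : r ≠ z := by simpa [writes] using h
    simp [val, eval, Mem.adder, Function.update_of_ne this]
  | read => rfl
  | seq p q ihp ihq =>
    simp only [writes, Bool.or_eq_false_iff] at h
    rw [eval, ihq h.2, ihp h.1]
  | ite t p q ihp ihq =>
    simp only [writes, Bool.or_eq_false_iff] at h
    rw [eval]
    split_ifs
    exacts [ihp h.1 s, ihq h.2 s]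
  | loop d p ih =>
    rw [eval]
    exact iterate_invariant (fun _ s' => val s' r = val s r) W rfl
      fun t _ s' hs' => (ih h s').trans hs'

theorem aux_of_readFree {p : Prog Reg} (h : readFree p = true) (s : Mem Reg W) :
    (eval p s).aux = s.aux := by
  induction p generalizing s with
  | skip => rfl
  | adder z x y neg c => rfl
  | read => simp [readFree] at h
  | seq p q ihp ihq =>
    simp only [readFree, Bool.and_eq_true] at h
    rw [eval, ihq h.2, ihp h.1]
  | ite t p q ihp ihq =>
    simp only [readFree, Bool.and_eq_true] at h
    rw [eval]
    split_ifs
    exacts [ihp h.1 s, ihq h.2 s]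
  | loop d p ih =>
    rw [eval]
    exact iterate_invariant (fun _ s' => s'.aux = s.aux) W rfl
      fun t _ s' hs' => (ih h s').trans hs'

/-- `z := x + y + c` -/
def addc (z x y : Reg) (c : Bool) : Prog Reg := .adder z x (some y) false c

/-- `z := x - y`; the flag says whether `y ≤ x`. -/
def sub (z x y : Reg) : Prog Reg := .adder z x (some y) true true

/-- `z := x` -/
def copy (z x : Reg) : Prog Reg := .adder z x none false false

/-- `z := z + 1` -/
def inc (z : Reg) : Prog Reg := .adder z z none false true

/-- `z := x - 1`; the flag says whether `x` is positive. -/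
def dec (z x : Reg) : Prog Reg := .adder z x none true false

/-- `z := 0` -/
def clear (z : Reg) : Prog Reg := .adder z z (some z) true true

/-- Branching on the flag. -/
def iff (p q : Prog Reg) : Prog Reg := .ite (fun f _ => f) p q

infixr:60 " ;; " => Prog.seq

theorem eval_seq (p q : Prog Reg) (s : Mem Reg W) : eval (p ;; q) s = eval q (eval p s) := rfl

theorem eval_iff (p q : Prog Reg) (s : Mem Reg W) :
    eval (iff p q) s = if s.flag then eval p s else eval q s := rfl

theorem eval_skip (s : Mem Reg W) : eval .skip s = s := rfl

theorem val_adder (s : Mem Reg W) (z x : Reg) (y : Option Reg) (neg c : Bool) :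
    val (s.adder z x y neg c) = Function.update (val s) z
      ((val s x + (addend neg (s.get y)).toNat + c.toNat) % 2 ^ W) := by
  funext r
  by_cases h : r = z
  · subst h
    have : c.toNat % 2 ^ W = (BitVec.setWidth W (BitVec.ofBool c)).toNat := by simp
    simp only [val, Mem.adder, Function.update_self, BitVec.toNat_add, Nat.mod_add_mod, ← this,
      Nat.add_mod_mod]
  · simp [val, Mem.adder, Function.update_of_ne h]

theorem flag_adder (s : Mem Reg W) (z x : Reg) (y : Option Reg) (neg c : Bool) :
    (s.adder z x y neg c).flag =
      decide (2 ^ W ≤ val s x + (addend neg (s.get y)).toNat + c.toNat) := by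
  simp only [Mem.adder, BitVec.carry, val]
  rw [Nat.mod_eq_of_lt (s.regs x).isLt, Nat.mod_eq_of_lt (BitVec.isLt _)]
  rfl

theorem val_addc (s : Mem Reg W) (z x y : Reg) (c : Bool) :
    val (eval (addc z x y c) s) =
      Function.update (val s) z ((val s x + val s y + c.toNat) % 2 ^ W) := by
  rw [addc, eval, val_adder]
  rfl

theorem flag_addc (s : Mem Reg W) (z x y : Reg) (c : Bool) :
    (eval (addc z x y c) s).flag = decide (2 ^ W ≤ val s x + val s y + c.toNat) := by
  rw [addc, eval, flag_adder]
  rfl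

/-- The complement of `y` plus the initial carry is `2 ^ W - y`; for the same reason the final carry
tells whether `y ≤ x`. -/
theorem val_sub (s : Mem Reg W) (z x y : Reg) :
    val (eval (sub z x y) s) =
      Function.update (val s) z ((2 ^ W + val s x - val s y) % 2 ^ W) := by
  have h := val_lt s y
  rw [sub, eval, val_adder]
  simp only [addend, if_true, Mem.get, Option.elim_some, BitVec.toNat_not, Bool.toNat_true]
  congr 2
  unfold val at *
  omega

theorem flag_sub (s : Mem Reg W) (z x y : Reg) :
    (eval (sub z x y) s).flag = decide (val s y ≤ val s x) := by
  have h := val_lt s y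
  rw [sub, eval, flag_adder]
  simp only [addend, if_true, Mem.get, Option.elim_some, BitVec.toNat_not, Bool.toNat_true]
  congr 1
  unfold val at *
  simp only [eq_iff_iff]
  omega

theorem val_copy (s : Mem Reg W) (z x : Reg) :
    val (eval (copy z x) s) = Function.update (val s) z (val s x) := by
  rw [copy, eval, val_adder]
  simp [addend, Mem.get, Nat.mod_eq_of_lt (val_lt s x)]

theorem val_inc (s : Mem Reg W) (z : Reg) :
    val (eval (inc z) s) = Function.update (val s) z ((val s z + 1) % 2 ^ W) := by
  rw [inc, eval, val_adder]
  simp [addend, Mem.get]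

theorem val_dec (s : Mem Reg W) (z x : Reg) :
    val (eval (dec z x) s) = Function.update (val s) z ((2 ^ W + val s x - 1) % 2 ^ W) := by
  have h := Nat.two_pow_pos W
  rw [dec, eval, val_adder]
  simp only [addend, if_true, Mem.get, Option.elim_none, BitVec.toNat_not, Bool.toNat_false]
  congr 2
  simp
  omega

theorem flag_dec (s : Mem Reg W) (z x : Reg) :
    (eval (dec z x) s).flag = decide (0 < val s x) := by
  have h := Nat.two_pow_pos W
  rw [dec, eval, flag_adder]
  simp only [addend, if_true, Mem.get, Option.elim_none, BitVec.toNat_not, Bool.toNat_false]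
  congr 1
  simp
  omega

theorem val_clear (s : Mem Reg W) (z : Reg) :
    val (eval (clear z) s) = Function.update (val s) z 0 := by
  have := val_sub s z z z
  simpa [sub, clear] using this

/-! ### Shifting out the bits of a number -/

/-- After `t` shifts to the left of the `W`-bit number `x`, the number `h` has been shifted out
and the number `y` is left. -/
def Shifted (W t x h y : ℕ) : Prop :=
  t ≤ W ∧ ∃ l, x = h * 2 ^ (W - t) + l ∧ l < 2 ^ (W - t) ∧ y = l * 2 ^ t

theorem Shifted.zero {x : ℕ} (hx : x < 2 ^ W) : Shifted W 0 x 0 x :=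
  ⟨Nat.zero_le _, x, by simp, by simpa using hx, by simp⟩

/-- The bit that leaves the register is the carry of `y + y`. It is the leading bit of the part `l`
of `x` that has not yet been shifted out. -/
theorem Shifted.step {t x h y : ℕ} (ht : t < W) (hs : Shifted W t x h y) :
    Shifted W (t + 1) x (2 * h + (decide (2 ^ W ≤ y + y)).toNat) ((y + y) % 2 ^ W) := by
  obtain ⟨-, l, hx, hl, hy⟩ := hs
  obtain ⟨k, rfl⟩ : ∃ k, W = t + 1 + k := ⟨W - (t + 1), by omega⟩
  have e1 : t + 1 + k - t = k + 1 := by omega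
  have e2 : t + 1 + k - (t + 1) = k := by omega
  rw [e1, pow_succ] at hx hl
  refine ⟨by omega, ?_⟩
  rw [e2]
  have e3 : 2 ^ (t + 1 + k) = 2 ^ k * 2 ^ (t + 1) := by rw [← pow_add]; congr 1; omega
  have e4 : y + y = l * 2 ^ (t + 1) := by rw [hy, pow_succ]; ring
  have hp : 0 < 2 ^ (t + 1) := by positivity
  rw [e3, e4]
  by_cases hlk : 2 ^ k ≤ l
  · refine ⟨l - 2 ^ k, ?_, by omega, ?_⟩
    · rw [decide_eq_true (Nat.mul_le_mul_right _ hlk), hx]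
      zify [hlk]
      simp
      ring
    · rw [Nat.mod_eq_sub_mod (Nat.mul_le_mul_right _ hlk), ← Nat.sub_mul, Nat.mod_eq_of_lt]
      exact Nat.mul_lt_mul_of_pos_right (by omega) hp
  · have : l * 2 ^ (t + 1) < 2 ^ k * 2 ^ (t + 1) := Nat.mul_lt_mul_of_pos_right (by omega) hp
    refine ⟨l, ?_, by omega, Nat.mod_eq_of_lt this⟩
    rw [decide_eq_false (not_le.2 this), hx]
    simp
    ring

theorem Shifted.final {x h y : ℕ} (hs : Shifted W W x h y) : h = x := by
  obtain ⟨-, l, hx, hl, -⟩ := hs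
  simp at hx hl
  omega

theorem Shifted.le {t x h y : ℕ} (hs : Shifted W t x h y) : h ≤ x := by
  obtain ⟨-, l, hx, -, -⟩ := hs
  have : h * 1 ≤ h * 2 ^ (W - t) := Nat.mul_le_mul_left _ (Nat.one_le_two_pow)
  omega

open Reg

/-- Division with remainder of `num` by `den`. -/
def divmod : Prog Reg :=
  clear quo ;; clear rem ;; copy shf num ;;
  .loop 0 (addc shf shf shf false ;; iff (addc rem rem rem true) (addc rem rem rem false) ;;
    addc quo quo quo false ;; sub tmp rem den ;; iff (copy rem tmp ;; inc quo) .skip)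

/-- Long division in base two: `quo` and `rem` are quotient and remainder of the prefix `h` of `num`
shifted out so far. Since `rem < den`, the number `2 * rem + 1` stays below `2 * den` and fits by
`hW`. -/
theorem divmod_spec (s : Mem Reg W) (h0 : 0 < val s den) (hW : 2 * val s den ≤ 2 ^ W) :
    val (eval divmod s) quo = val s num / val s den ∧
      val (eval divmod s) rem = val s num % val s den := by
  have key := iterate_invariant (f := eval (W := W) (addc shf shf shf false ;; iff (addc rem rem rem true) (addc rem rem rem false) ;;
    addc quo quo quo false ;; sub tmp rem den ;; iff (copy rem tmp ;; inc quo) .skip))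
    (s := eval (copy shf num) (eval (clear rem) (eval (clear quo) s)))
    (fun t s' => val s' den = val s den ∧ ∃ h, Shifted W t (val s num) h (val s' shf) ∧
      val s' quo = h / val s den ∧ val s' rem = h % val s den) W
    (by
      refine ⟨?_, 0, ?_, ?_⟩
      · simp [val_copy, val_clear]
      · simpa [val_copy, val_clear] using Shifted.zero (val_lt s num)
      · simp [val_copy, val_clear])
    (by
      rintro t ht s' ⟨hd, h, hs, hq, hr⟩
      have hs2 := hs.step ht
      set bit := (decide (2 ^ W ≤ val s' shf + val s' shf)).toNat with hbit
      have hlt : val s' rem < val s den := hr ▸ Nat.mod_lt _ h0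
      have hb : bit ≤ 1 := Bool.toNat_le _
      have hx := hs2.le
      have hxn := val_lt s num
      generalize hD : val s den = D at *
      have hdm := Nat.div_add_mod h D
      generalize hB : h / D = Q at *
      generalize hM : h % D = M at *
      have hqq : 2 * Q + bit ≤ val s num := by nlinarith [hB ▸ Nat.div_le_self h D]
      set s1 := eval (addc shf shf shf false) s' with hs1
      set s2 := eval (iff (addc rem rem rem true) (addc rem rem rem false)) s1 with hs2'
      have v1 : val s1 = Function.update (val s') shf ((val s' shf + val s' shf) % 2 ^ W) := by
        rw [hs1, val_addc]; simp
      have f1 : s1.flag = decide (2 ^ W ≤ val s' shf + val s' shf) := by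
        rw [hs1, flag_addc]; simp
      have v2 : val s2 = Function.update (val s1) rem (M + M + bit) := by
        rw [hs2', eval_iff, f1]
        split_ifs with hc
        · rw [val_addc, v1]
          simp only [hbit, hc]
          simp [hr]
          rw [Nat.mod_eq_of_lt (show M + M + 1 < 2 ^ W by omega)]
        · rw [val_addc, v1]
          simp only [hbit, hc]
          simp [hr]
          rw [Nat.mod_eq_of_lt (show M + M < 2 ^ W by omega)]
      set s3 := eval (addc quo quo quo false) s2 with hs3
      have v3 : val s3 = Function.update (val s2) quo (Q + Q) := by
        rw [hs3, val_addc, v2, v1]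
        simp [hq]
        rw [Nat.mod_eq_of_lt (show Q + Q < 2 ^ W by omega)]
      set s4 := eval (sub tmp rem den) s3 with hs4
      have v4 : val s4 = Function.update (val s3) tmp ((2 ^ W + (M + M + bit) - D) % 2 ^ W) := by
        rw [hs4, val_sub, v3, v2, v1]
        simp [hd]
      have f4 : s4.flag = decide (D ≤ M + M + bit) := by
        rw [hs4, flag_sub, v3, v2, v1]
        simp [hd]
      rw [eval_seq, ← hs1, eval_seq, ← hs2', eval_seq, ← hs3, eval_seq, ← hs4, eval_iff, f4]
      have e : 2 * h + bit = D * (2 * Q) + (M + M + bit) := by rw [← hdm]; ring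
      split_ifs with hc
      · have hc : D ≤ M + M + bit := by simpa using hc
        have e5 : (2 ^ W + (M + M + bit) - D) % 2 ^ W = M + M + bit - D := by
          rw [show 2 ^ W + (M + M + bit) - D = (M + M + bit - D) + 2 ^ W by omega,
            Nat.add_mod_right, Nat.mod_eq_of_lt (by omega)]
        have e6 : 2 * h + bit = (M + M + bit - D) + D * (2 * Q + 1) := by
          rw [e, Nat.mul_succ]; omega
        have e7 := Nat.le_mul_of_pos_left (2 * Q + 1) h0
        rw [eval_seq]
        refine ⟨?_, 2 * h + bit, ?_, ?_⟩
        · simp [val_inc, val_copy, v4, v3, v2, v1, hd]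
        · simpa [val_inc, val_copy, v4, v3, v2, v1] using hs2
        · rw [e6, Nat.add_mul_div_left _ _ h0, Nat.add_mul_mod_self_left,
            Nat.div_eq_of_lt (by omega), Nat.mod_eq_of_lt (by omega)]
          simp [val_inc, val_copy, v4, v3, v2, v1, e5]
          rw [Nat.mod_eq_of_lt (show Q + Q + 1 < 2 ^ W by omega)]
          omega
      · have hc : M + M + bit < D := by simpa using hc
        have e6 : 2 * h + bit = (M + M + bit) + D * (2 * Q) := by omega
        rw [eval_skip]
        refine ⟨?_, 2 * h + bit, ?_, ?_⟩
        · simp [v4, v3, v2, v1, hd]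
        · simpa [v4, v3, v2, v1] using hs2
        · rw [e6, Nat.add_mul_div_left _ _ h0, Nat.add_mul_mod_self_left,
            Nat.div_eq_of_lt (by omega), Nat.mod_eq_of_lt (by omega)]
          simp [v4, v3, v2, v1]
          omega)
  obtain ⟨-, h, hs, hq, hr⟩ := key
  rw [hs.final] at hq hr
  exact ⟨hq, hr⟩

/-- Multiplication of `fac` and `fac'`. -/
def mul : Prog Reg :=
  clear prd ;; copy shf fac ;;
  .loop 0 (addc shf shf shf false ;;
    iff (addc prd prd prd false ;; addc prd prd fac' false) (addc prd prd prd false))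

/-- Horner's scheme: `prd` is the prefix of `fac` read so far times `fac'`, and so it never exceeds
the final product. -/
theorem mul_spec (s : Mem Reg W) (hW : val s fac * val s fac' < 2 ^ W) :
    val (eval mul s) prd = val s fac * val s fac' := by
  have key := iterate_invariant (f := eval (W := W) (addc shf shf shf false ;;
      iff (addc prd prd prd false ;; addc prd prd fac' false) (addc prd prd prd false)))
    (s := eval (copy shf fac) (eval (clear prd) s))
    (fun t s' => val s' fac' = val s fac' ∧ ∃ h, Shifted W t (val s fac) h (val s' shf) ∧
      val s' prd = h * val s fac') W
    (by
      refine ⟨?_, 0, ?_, ?_⟩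
      · simp [val_copy, val_clear]
      · simpa [val_copy, val_clear] using Shifted.zero (val_lt s fac)
      · simp [val_copy, val_clear])
    (by
      rintro t ht s' ⟨hd, h, hs, hq⟩
      have hs2 := hs.step ht
      have hle := Nat.mul_le_mul_right (val s fac') hs2.le
      set s1 := eval (addc shf shf shf false) s' with hs1
      have v1 : val s1 = Function.update (val s') shf ((val s' shf + val s' shf) % 2 ^ W) := by
        rw [hs1, val_addc]; simp
      have f1 : s1.flag = decide (2 ^ W ≤ val s' shf + val s' shf) := by
        rw [hs1, flag_addc]; simp
      rw [eval_seq, ← hs1, eval_iff, f1]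
      split_ifs with hc
      · rw [hc] at hs2 hle
        simp only [Bool.toNat_true, add_mul, two_mul, one_mul] at hle
        rw [eval_seq]
        refine ⟨?_, _, by simpa [val_addc, v1] using hs2, ?_⟩
        · simp [val_addc, v1, hd]
        · simp [val_addc, v1, hd, hq]
          rw [Nat.mod_eq_of_lt (by omega)]
          ring
      · rw [Bool.not_eq_true] at hc
        rw [hc] at hs2 hle
        simp only [Bool.toNat_false, two_mul, add_mul, add_zero] at hle
        refine ⟨?_, _, by simpa [val_addc, v1] using hs2, ?_⟩
        · simp [val_addc, v1, hd]
        · simp [val_addc, v1, hq]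
          rw [Nat.mod_eq_of_lt (by omega)]
          ring)
  obtain ⟨-, h, hs, hq⟩ := key
  rw [hs.final] at hq
  exact hq

/-- Division of `quo` by the power of `den` with exponent `cnt`. -/
def divPow : Prog Reg :=
  .loop 1 (dec tmp cnt ;; iff (copy cnt tmp ;; copy num quo ;; divmod) .skip)

/-- Iterated floor division is floor division by the power. The loop always makes `W` rounds, so
`cnt` must not exceed `W`; the rounds after `cnt` reaches zero are idle. -/
theorem divPow_spec (s : Mem Reg W) (h0 : 0 < val s den) (hW : 2 * val s den ≤ 2 ^ W)
    (hc : val s cnt ≤ W) :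
    val (eval divPow s) quo = val s quo / val s den ^ val s cnt := by
  have key := iterate_invariant
    (f := eval (W := W) (dec tmp cnt ;; iff (copy cnt tmp ;; copy num quo ;; divmod) .skip)) (s := s)
    (fun t s' => val s' den = val s den ∧ val s' cnt = val s cnt - t ∧
      val s' quo = val s quo / val s den ^ min t (val s cnt)) W
    (by simp)
    (by
      rintro t ht s' ⟨hd, hn, hq⟩
      set s1 := eval (dec tmp cnt) s' with hs1
      have v1 : val s1 = Function.update (val s') tmp ((2 ^ W + (val s' cnt) - 1) % 2 ^ W) := by
        rw [hs1, val_dec]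
      have f1 : s1.flag = decide (0 < val s' cnt) := by rw [hs1, flag_dec]
      have hlt := val_lt s' cnt
      rw [eval_seq, ← hs1, eval_iff, f1]
      split_ifs with h
      · have h : 0 < val s' cnt := by simpa using h
        have e : (2 ^ W + (val s' cnt) - 1) % 2 ^ W = val s' cnt - 1 := by
          rw [show 2 ^ W + (val s' cnt) - 1 = (val s' cnt - 1) + 2 ^ W by omega,
            Nat.add_mod_right, Nat.mod_eq_of_lt (by omega)]
        rw [e] at v1
        rw [eval_seq, eval_seq]
        set s2 := eval (copy num quo) (eval (copy cnt tmp) s1) with hs2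
        have v2 : val s2 = Function.update (Function.update (val s1) cnt (val s' cnt - 1)) num
            (val s' quo) := by
          rw [hs2, val_copy, val_copy, v1]; simp
        have d2 : val s2 den = val s den := by simp [v2, v1, hd]
        have hdm := divmod_spec s2 (d2 ▸ h0) (d2 ▸ hW)
        refine ⟨?_, ?_, ?_⟩
        · rw [val_of_not_writes rfl, d2]
        · rw [val_of_not_writes rfl, v2]
          simp
          omega
        · rw [hdm.1, d2, v2]
          simp only [Function.update_self]
          rw [hq, Nat.div_div_eq_div_mul, ← pow_succ]
          congr 2
          omega
      · have h : val s' cnt = 0 := by simpa using h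
        rw [eval_skip]
        refine ⟨by simp [v1, hd], by simp [v1]; omega, ?_⟩
        have : min (t + 1) (val s cnt) = min t (val s cnt) := by omega
        rw [this]
        simp [v1, hq])
  obtain ⟨-, -, hq⟩ := key
  rw [min_eq_right hc] at hq
  exact hq

/-- The power of two with exponent `ex`, modulo `den`. -/
def powMod : Prog Reg :=
  copy exs ex ;; clear rem ;; inc rem ;;
  .loop 1 (copy fac rem ;; copy fac' rem ;; mul ;; copy num prd ;; addc exs exs exs false ;;
    iff (addc num num num false) .skip ;; divmod)

/-- Square and multiply, from the leading bit of the exponent: `rem` is congruent to `2 ^ h` for the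
prefix `h` read so far. A round forms at most `2 * rem ^ 2` before reducing, which `hW` keeps in
range. -/
theorem powMod_spec (s : Mem Reg W) (h0 : 0 < val s den) (hW : 2 * val s den ^ 2 < 2 ^ W) :
    val (eval powMod s) rem = 2 ^ val s ex % val s den := by
  have hW0 : 1 ≤ W := by
    by_contra! h
    obtain rfl : W = 0 := by omega
    have : 0 < val s den ^ 2 := by positivity
    omega
  have hW1 : 1 < 2 ^ W := Nat.one_lt_two_pow (by omega)
  -- The initial value `1` of `rem` is not reduced if `den = 1`; thus `rem < den` is claimed only
  -- after the first round.
  have key := iterate_invariant (f := eval (W := W) (copy fac rem ;; copy fac' rem ;; mul ;; copy num prd ;; addc exs exs exs false ;;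
    iff (addc num num num false) .skip ;; divmod))
    (s := eval (inc rem) (eval (clear rem) (eval (copy exs ex) s)))
    (fun t s' => val s' den = val s den ∧ ∃ h, Shifted W t (val s ex) h (val s' exs) ∧
      val s' rem ≤ val s den ∧ val s' rem % val s den = 2 ^ h % val s den ∧
      (0 < t → val s' rem < val s den)) W
    (by
      refine ⟨?_, 0, ?_, ?_, ?_, ?_⟩
      · simp [val_copy, val_clear, val_inc]
      · simpa [val_copy, val_clear, val_inc] using Shifted.zero (val_lt s ex)
      · simp [val_copy, val_clear, val_inc]
        rw [Nat.mod_eq_of_lt hW1]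
        exact h0
      · simp [val_copy, val_clear, val_inc]
        rw [Nat.mod_eq_of_lt hW1]
      · simp)
    (by
      rintro t ht s' ⟨hd, h, hs, hle, hr, -⟩
      have hs2 := hs.step ht
      simp only [eval_seq]
      set s1 := eval (copy fac' rem) (eval (copy fac rem) s') with hs1
      have v1 : val s1 = Function.update (Function.update (val s') fac (val s' rem)) fac'
          (val s' rem) := by
        rw [hs1, val_copy, val_copy]; simp
      have hsq : val s' rem * val s' rem ≤ val s den ^ 2 := by
        rw [pow_two]; exact Nat.mul_le_mul hle hle
      have hmul := mul_spec s1 (by simp [v1]; omega)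
      rw [show val s1 fac = val s' rem by simp [v1], show val s1 fac' = val s' rem by simp [v1]]
        at hmul
      have hden : val (eval mul s1) den = val s den := by
        rw [val_of_not_writes rfl, v1]; simp [hd]
      have hexs : val (eval mul s1) exs = val s' exs := by
        rw [val_of_not_writes rfl, v1]; simp
      set s2 := eval mul s1
      set s3 := eval (addc exs exs exs false) (eval (copy num prd) s2) with hs3
      have v3 : val s3 = Function.update (Function.update (val s2) num (val s' rem * val s' rem))
          exs ((val s' exs + val s' exs) % 2 ^ W) := by
        rw [hs3, val_addc, val_copy]; simp [hmul, hexs]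
      have f3 : s3.flag = decide (2 ^ W ≤ val s' exs + val s' exs) := by
        rw [hs3, flag_addc, val_copy]; simp [hexs]
      set bit := decide (2 ^ W ≤ val s' exs + val s' exs) with hbit
      set s4 := eval (iff (addc num num num false) .skip) s3 with hs4
      have v4 : val s4 = Function.update (val s3) num
          (val s' rem * val s' rem * 2 ^ bit.toNat) := by
        rw [hs4, eval_iff, f3]
        cases bit
        · simp [eval_skip, v3]
        · simp [val_addc, v3]
          rw [Nat.mod_eq_of_lt (show val s' rem * val s' rem + val s' rem * val s' rem < 2 ^ W by
            omega), ← mul_two (val s' rem * val s' rem)]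
      have d4 : val s4 den = val s den := by simp [v4, v3, hden]
      have hdm := divmod_spec s4 (d4 ▸ h0) (d4 ▸ by nlinarith)
      rw [d4, show val s4 num = val s' rem * val s' rem * 2 ^ bit.toNat by simp [v4]] at hdm
      refine ⟨?_, 2 * h + bit.toNat, ?_, ?_, ?_, ?_⟩
      · rw [val_of_not_writes rfl, d4]
      · rw [val_of_not_writes rfl, v4, v3]
        simpa using hs2
      · rw [hdm.2]; exact (Nat.mod_lt _ h0).le
      · rw [hdm.2, Nat.mod_mod, pow_add, two_mul, pow_add]
        exact Nat.ModEq.mul (Nat.ModEq.mul hr hr) rfl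
      · intro _; rw [hdm.2]; exact Nat.mod_lt _ h0)
  obtain ⟨-, h, hs, -, hr, hlt⟩ := key
  rw [Nat.mod_eq_of_lt (hlt hW0), hs.final] at hr
  exact hr

end BitProg

namespace BitProg

open Reg

variable {W : ℕ}

/-! ### The program that computes the bits of the weights -/

/-- The binary logarithm of `n` and the corresponding power of two. -/
def logarithm : Prog Reg :=
  clear pow ;; inc pow ;; clear lg ;;
  .loop 0 (addc tmp pow pow false ;; sub fac n tmp ;; iff (copy pow tmp ;; inc lg) .skip)

/-- The power is doubled as long as its double is at most `n`. The last, unsuccessful test forms `2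
^ (log n + 1)`, which must still fit. -/
theorem logarithm_spec (s : Mem Reg W) (hW : Nat.log 2 (val s n) + 2 ≤ W) :
    val (eval logarithm s) lg = Nat.log 2 (val s n) ∧
      val (eval logarithm s) pow = 2 ^ Nat.log 2 (val s n) := by
  have hW1 : 1 < 2 ^ W := Nat.one_lt_two_pow (by omega)
  have key := iterate_invariant (f := eval (W := W) (addc tmp pow pow false ;; sub fac n tmp ;; iff (copy pow tmp ;; inc lg) .skip))
    (s := eval (clear lg) (eval (inc pow) (eval (clear pow) s)))
    (fun t s' => val s' n = val s n ∧ val s' lg = min t (Nat.log 2 (val s n)) ∧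
      val s' pow = 2 ^ min t (Nat.log 2 (val s n))) W
    (by simp [val_clear, val_inc, Nat.mod_eq_of_lt hW1])
    (by
      rintro t ht s' ⟨hn, hl, hp⟩
      set L := Nat.log 2 (val s n) with hL
      have hlt : 2 ^ (min t L + 1) < 2 ^ W := Nat.pow_lt_pow_right (by norm_num) (by omega)
      set s1 := eval (addc tmp pow pow false) s' with hs1
      have v1 : val s1 = Function.update (val s') tmp (2 ^ (min t L + 1)) := by
        rw [hs1, val_addc, hp]
        simp only [Bool.toNat_false, add_zero, ← two_mul, ← pow_succ']
        rw [Nat.mod_eq_of_lt hlt]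
      have f1 : (eval (sub fac n tmp) s1).flag = decide (2 ^ (min t L + 1) ≤ val s n) := by
        rw [flag_sub, v1]; simp [hn]
      rw [eval_seq, ← hs1, eval_seq, eval_iff, f1]
      by_cases htL : t < L
      · have e : min t L = t := by omega
        have e' : min (t + 1) L = t + 1 := by omega
        have hpow : 2 ^ (t + 1) ≤ val s n := Nat.pow_le_of_le_log (fun h => by simp [h] at hL; omega) (by omega)
        have hlt1 : t + 1 < 2 ^ W := lt_of_lt_of_le Nat.lt_two_pow_self (by rw [e] at hlt; exact hlt.le)
        rw [if_pos (by simpa [e] using hpow), e', eval_seq]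
        simp [val_inc, val_copy, val_sub, v1, hn, hl, e, Nat.mod_eq_of_lt hlt1]
      · have e : min t L = L := by omega
        have e' : min (t + 1) L = L := by omega
        have hpow : val s n < 2 ^ (L + 1) := Nat.lt_pow_succ_log_self (by norm_num) _
        rw [if_neg (by simpa [e] using hpow), e', eval_skip]
        simp [val_sub, v1, hn, hl, hp, e])
  obtain ⟨-, hl, hp⟩ := key
  rw [min_eq_right (by omega)] at hl hp
  exact ⟨hl, hp⟩

theorem val_copy_self (s : Mem Reg W) (z x : Reg) : val (eval (copy z x) s) z = val s x := by
  rw [val_copy, Function.update_self]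

/-- `z := x * y` -/
def prod (z x y : Reg) : Prog Reg := copy fac x ;; copy fac' y ;; mul ;; copy z prd

theorem prod_spec (s : Mem Reg W) (z x y : Reg) (hy : y ≠ fac) (h : val s x * val s y < 2 ^ W) :
    val (eval (prod z x y) s) z = val s x * val s y := by
  have e1 : val (eval (copy fac' y) (eval (copy fac x) s)) fac = val s x := by simp [val_copy]
  have e2 : val (eval (copy fac' y) (eval (copy fac x) s)) fac' = val s y := by
    simp [val_copy, hy]
  rw [prod, eval_seq, eval_seq, eval_seq, val_copy_self, mul_spec _ (by rw [e1, e2]; exact h),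
    e1, e2]

/-- `z := 7 * x` -/
def sevenfold (z x : Reg) : Prog Reg :=
  addc z x x false ;; addc z z x false ;; addc z z z false ;; addc z z x false

theorem sevenfold_spec (s : Mem Reg W) (z x : Reg) (hx : x ≠ z) (h : 7 * val s x < 2 ^ W) :
    val (eval (sevenfold z x) s) z = 7 * val s x := by
  simp only [sevenfold, eval_seq, val_addc, Function.update_self, Function.update_of_ne hx,
    Bool.toNat_false, add_zero]
  rw [Nat.mod_eq_of_lt (a := val s x + val s x) (by omega),
    Nat.mod_eq_of_lt (a := val s x + val s x + val s x) (by omega),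
    Nat.mod_eq_of_lt (a := val s x + val s x + val s x + _) (by omega),
    Nat.mod_eq_of_lt (by omega)]
  ring

/-- Division with remainder of `x` by `y`. -/
def divide (x y : Reg) : Prog Reg := copy num x ;; copy den y ;; divmod

theorem divide_spec (s : Mem Reg W) (x y : Reg) (hy : y ≠ num) (h0 : 0 < val s y)
    (h : 2 * val s y ≤ 2 ^ W) :
    val (eval (divide x y) s) quo = val s x / val s y ∧
      val (eval (divide x y) s) rem = val s x % val s y := by
  have e1 : val (eval (copy den y) (eval (copy num x) s)) num = val s x := by simp [val_copy]
  have e2 : val (eval (copy den y) (eval (copy num x) s)) den = val s y := by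
    simp [val_copy, hy]
  have := divmod_spec (eval (copy den y) (eval (copy num x) s)) (by rwa [e2]) (by rwa [e2])
  rw [divide, eval_seq, eval_seq]
  rwa [e1, e2] at this

/-- `z := 2` -/
def two (z : Reg) : Prog Reg := clear z ;; inc z ;; inc z

theorem two_spec (s : Mem Reg W) (z : Reg) (hW : 2 ≤ W) : val (eval (two z) s) z = 2 := by
  have h : 2 < 2 ^ W := lt_of_lt_of_le (by norm_num) (Nat.pow_le_pow_right (by norm_num) hW)
  simp [two, eval_seq, val_inc, val_clear, Nat.mod_eq_of_lt h,
    Nat.mod_eq_of_lt (show 1 < 2 ^ W by omega)]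

/-- The parameters that depend on `n`. -/
def params : Prog Reg :=
  logarithm ;; two base ;; divide n base ;; prod sq quo quo ;; prod chk lg lg ;;
  sevenfold blk chk ;; sevenfold wid lg ;; prod base pow pow ;; prod chk base base ;;
  prod base chk base

/-- The width `12 * L + 36` is what 12 bits per symbol of the query guarantee. It leaves room for
twice the square of a modulus of size `2 ^ (6 * L)`, the largest number in `powMod`. -/
theorem params_spec (s : Mem Reg W) (L : ℕ) (hL : Nat.log 2 (val s n) = L)
    (hW : 12 * L + 36 ≤ W) :
    val (eval params s) lg = L ∧ val (eval params s) sq = (val s n / 2) ^ 2 ∧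
      val (eval params s) blk = 7 * L ^ 2 ∧ val (eval params s) wid = 7 * L ∧
      val (eval params s) base = 2 ^ (6 * L) := by
  have hn : val s n < 2 ^ (L + 1) := hL ▸ Nat.lt_pow_succ_log_self (by norm_num) _
  have hLL : L < 2 ^ L := Nat.lt_two_pow_self
  have hbig : ∀ k, k + 1 ≤ W → 2 * 2 ^ k ≤ 2 ^ W := fun k hk => by
    rw [← pow_succ']; exact Nat.pow_le_pow_right (by norm_num) hk
  have h2 := hbig (2 * L + 4) (by omega)
  have h3 := hbig (6 * L) (by omega)
  have hL2 : L * L < 2 ^ (2 * L) := by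
    rw [two_mul, pow_add]; exact Nat.mul_lt_mul'' hLL hLL
  have h4 : 2 ^ (2 * L + 4) = 16 * 2 ^ (2 * L) := by rw [pow_add]; ring
  have h5 : 2 ^ L ≤ 2 ^ (2 * L) := Nat.pow_le_pow_right (by norm_num) (by omega)
  have hm : val s n / 2 < 2 ^ L := by rw [pow_succ] at hn; omega
  have hm2 : (val s n / 2) * (val s n / 2) < 2 ^ (2 * L) := by
    rw [two_mul, pow_add]; exact Nat.mul_lt_mul'' hm hm
  obtain ⟨l1, p1⟩ := logarithm_spec s (by omega)
  rw [hL] at l1 p1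
  simp only [params, eval_seq]
  set s1 := eval logarithm s with hs1
  have n1 : val s1 n = val s n := val_of_not_writes rfl s
  set s2 := eval (two base) s1 with hs2
  have b2 : val s2 base = 2 := two_spec s1 base (by omega)
  have n2 : val s2 n = val s n := (val_of_not_writes rfl s1).trans n1
  have h23 := (divide_spec s2 n base (by decide) (by omega) (by rw [b2]; omega)).1
  set s3 := eval (divide n base) s2 with hs3
  rw [n2, b2] at h23
  set s4 := eval (prod sq quo quo) s3 with hs4
  have e4 : val s4 sq = (val s n / 2) ^ 2 := by
    rw [hs4, prod_spec _ _ _ _ (by decide) (by rw [h23]; omega), h23, pow_two]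
  have l4 : val s4 lg = L := by
    rw [hs4, val_of_not_writes rfl, hs3, val_of_not_writes rfl, hs2, val_of_not_writes rfl, l1]
  have p4 : val s4 pow = 2 ^ L := by
    rw [hs4, val_of_not_writes rfl, hs3, val_of_not_writes rfl, hs2, val_of_not_writes rfl, p1]
  set s5 := eval (prod chk lg lg) s4 with hs5
  have c5 : val s5 chk = L * L := by
    rw [hs5, prod_spec _ _ _ _ (by decide) (by rw [l4]; omega), l4]
  have l5 : val s5 lg = L := (val_of_not_writes rfl s4).trans l4
  set s6 := eval (sevenfold blk chk) s5 with hs6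
  have b6 : val s6 blk = 7 * L ^ 2 := by
    rw [hs6, sevenfold_spec _ _ _ (by decide) (by rw [c5]; omega), c5, pow_two]
  have l6 : val s6 lg = L := (val_of_not_writes rfl s5).trans l5
  set s7 := eval (sevenfold wid lg) s6 with hs7
  have w7 : val s7 wid = 7 * L := by
    rw [hs7, sevenfold_spec _ _ _ (by decide) (by rw [l6]; omega), l6]
  have p7 : val s7 pow = 2 ^ L := by
    rw [hs7, val_of_not_writes rfl, hs6, val_of_not_writes rfl, hs5, val_of_not_writes rfl, p4]
  set s8 := eval (prod base pow pow) s7 with hs8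
  have e8 : val s8 base = 2 ^ (2 * L) := by
    rw [hs8, prod_spec _ _ _ _ (by decide), p7, ← pow_add, two_mul]
    rw [p7, ← pow_add]; exact Nat.pow_lt_pow_right (by norm_num) (by omega)
  set s9 := eval (prod chk base base) s8 with hs9
  have e9 : val s9 chk = 2 ^ (4 * L) := by
    rw [hs9, prod_spec _ _ _ _ (by decide), e8, ← pow_add]
    · congr 1; ring
    rw [e8, ← pow_add]; exact Nat.pow_lt_pow_right (by norm_num) (by omega)
  have b9 : val s9 base = 2 ^ (2 * L) := (val_of_not_writes rfl s8).trans e8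
  refine ⟨?_, ?_, ?_, ?_, ?_⟩
  · rw [val_of_not_writes rfl, hs9, val_of_not_writes rfl, hs8, val_of_not_writes rfl, hs7,
      val_of_not_writes rfl, l6]
  · rw [val_of_not_writes rfl, hs9, val_of_not_writes rfl, hs8, val_of_not_writes rfl, hs7,
      val_of_not_writes rfl, hs6, val_of_not_writes rfl, hs5, val_of_not_writes rfl, e4]
  · rw [val_of_not_writes rfl, hs9, val_of_not_writes rfl, hs8, val_of_not_writes rfl, hs7,
      val_of_not_writes rfl, b6]
  · rw [val_of_not_writes rfl, hs9, val_of_not_writes rfl, hs8, val_of_not_writes rfl, w7]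
  · rw [prod_spec _ _ _ _ (by decide), e9, b9, ← pow_add]
    · congr 1; ring
    rw [e9, b9, ← pow_add]; exact Nat.pow_lt_pow_right (by norm_num) (by omega)

/-- The position of the output bit `a`. -/
def locate : Prog Reg :=
  divide a blk ;; copy pos rem ;; divide quo sq ;; copy ex rem ;; copy idx quo ;;
  divide pos wid ;; copy dig quo ;; copy off rem

/-- Mixed-radix decomposition of a position: `idx` is the index of the weight function, `ex` the
number of the edge, `dig` the block of `7 * L` bits inside the weight and `off` the bit inside the
block. -/
theorem locate_spec (s : Mem Reg W) (hb : 0 < val s blk) (hb' : 2 * val s blk ≤ 2 ^ W)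
    (hs : 0 < val s sq) (hs' : 2 * val s sq ≤ 2 ^ W) (hw : 0 < val s wid)
    (hw' : 2 * val s wid ≤ 2 ^ W) :
    val (eval locate s) ex = val s a / val s blk % val s sq ∧
      val (eval locate s) idx = val s a / val s blk / val s sq ∧
      val (eval locate s) dig = val s a % val s blk / val s wid ∧
      val (eval locate s) off = val s a % val s blk % val s wid := by
  simp only [locate, eval_seq]
  obtain ⟨q1, r1⟩ := divide_spec s a blk (by decide) hb hb'
  set s1 := eval (divide a blk) s with hs1
  set s2 := eval (copy pos rem) s1 with hs2
  have p2 : val s2 pos = val s a % val s blk := by rw [hs2, val_copy_self, r1]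
  have q2 : val s2 quo = val s a / val s blk := (val_of_not_writes rfl s1).trans q1
  have sq2 : val s2 sq = val s sq := (val_of_not_writes rfl s1).trans (val_of_not_writes rfl s)
  have w2 : val s2 wid = val s wid := (val_of_not_writes rfl s1).trans (val_of_not_writes rfl s)
  obtain ⟨q3, r3⟩ := divide_spec s2 quo sq (by decide) (by rwa [sq2]) (by rwa [sq2])
  rw [q2, sq2] at q3 r3
  set s3 := eval (divide quo sq) s2 with hs3
  set s5 := eval (copy idx quo) (eval (copy ex rem) s3) with hs5
  have e5 : val s5 ex = val s a / val s blk % val s sq := by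
    rw [hs5, val_of_not_writes rfl, val_copy_self, r3]
  have i5 : val s5 idx = val s a / val s blk / val s sq := by
    rw [hs5, val_copy_self, val_of_not_writes rfl, q3]
  have p5 : val s5 pos = val s a % val s blk := by
    rw [hs5, val_of_not_writes rfl, val_of_not_writes rfl, hs3, val_of_not_writes rfl, p2]
  have w5 : val s5 wid = val s wid := by
    rw [hs5, val_of_not_writes rfl, val_of_not_writes rfl, hs3, val_of_not_writes rfl, w2]
  obtain ⟨q6, r6⟩ := divide_spec s5 pos wid (by decide) (by rwa [w5]) (by rwa [w5])
  rw [p5, w5] at q6 r6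
  refine ⟨?_, ?_, ?_, ?_⟩
  · rw [val_of_not_writes rfl, val_of_not_writes rfl, val_of_not_writes rfl, e5]
  · rw [val_of_not_writes rfl, val_of_not_writes rfl, val_of_not_writes rfl, i5]
  · rw [val_of_not_writes rfl, val_copy_self, q6]
  · rw [val_copy_self, val_of_not_writes rfl, r6]

/-- `quo := x / y ^ z` -/
def quotPow (x y z : Reg) : Prog Reg := copy quo x ;; copy den y ;; copy cnt z ;; divPow

theorem quotPow_spec (s : Mem Reg W) (x y z : Reg) (hy : y ≠ quo) (hz : z ≠ quo) (hz' : z ≠ den)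
    (h0 : 0 < val s y) (h : 2 * val s y ≤ 2 ^ W) (hc : val s z ≤ W) :
    val (eval (quotPow x y z) s) quo = val s x / val s y ^ val s z := by
  simp only [quotPow, eval_seq]
  set s3 := eval (copy cnt z) (eval (copy den y) (eval (copy quo x) s)) with hs3
  have v3 : val s3 = Function.update (Function.update (Function.update (val s) quo (val s x)) den
      (val s y)) cnt (val s z) := by
    rw [hs3, val_copy, val_copy, val_copy]
    simp [hy, hz, hz']
  have := divPow_spec s3 (by simpa [v3] using h0) (by simpa [v3] using h) (by simpa [v3] using hc)
  rw [this]
  simp [v3]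

/-- Checks that the index is in range and computes the output bit. -/
def bitAt : Prog Reg :=
  quotPow idx base lg ;; copy chk quo ;;
  quotPow idx base dig ;; divide quo base ;; inc rem ;; copy den rem ;; powMod ;;
  two base ;; quotPow rem base off ;; divide quo base

/-- `chk` vanishes exactly if `idx` has at most `L` digits in base `2 ^ (6 * L)`, that is, if the
index is in range. The modulus is one more than the selected digit and therefore never zero. -/
theorem bitAt_spec (s : Mem Reg W) (L : ℕ) (hW : 12 * L + 36 ≤ W) (hb : val s base = 2 ^ (6 * L))
    (hl : val s lg = L) (hd : val s dig ≤ W) (ho : val s off ≤ W) :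
    val (eval bitAt s) chk = val s idx / (2 ^ (6 * L)) ^ L ∧
      val (eval bitAt s) rem =
        2 ^ val s ex % (val s idx / (2 ^ (6 * L)) ^ val s dig % 2 ^ (6 * L) + 1) /
          2 ^ val s off % 2 := by
  have hbig : 2 * 2 ^ (6 * L) ≤ 2 ^ W := by
    rw [← pow_succ']; exact Nat.pow_le_pow_right (by norm_num) (by omega)
  have hpos : 0 < 2 ^ (6 * L) := by positivity
  have hbig2 : 2 * (2 ^ (6 * L)) ^ 2 < 2 ^ W := by
    rw [← pow_mul, ← pow_succ']; exact Nat.pow_lt_pow_right (by norm_num) (by omega)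
  have h4 : 4 ≤ 2 ^ W := by
    calc 4 = 2 ^ 2 := by norm_num
      _ ≤ 2 ^ W := Nat.pow_le_pow_right (by norm_num) (by omega)
  simp only [bitAt, eval_seq]
  have q1 := quotPow_spec s idx base lg (by decide) (by decide) (by decide) (by rwa [hb])
    (by rwa [hb]) (by omega)
  rw [hb, hl] at q1
  set s2 := eval (copy chk quo) (eval (quotPow idx base lg) s) with hs2
  have c2 : val s2 chk = val s idx / (2 ^ (6 * L)) ^ L := by rw [hs2, val_copy_self, q1]
  have f2 : ∀ r, writes (quotPow idx base lg ;; copy chk quo) r = false → val s2 r = val s r :=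
    fun r hr => val_of_not_writes hr s
  have b2 : val s2 base = 2 ^ (6 * L) := (f2 base rfl).trans hb
  have q3 := quotPow_spec s2 idx base dig (by decide) (by decide) (by decide) (by rwa [b2])
    (by rwa [b2]) (by rwa [f2 dig rfl])
  rw [b2, f2 dig rfl, f2 idx rfl] at q3
  set s3 := eval (quotPow idx base dig) s2 with hs3
  have b3 : val s3 base = 2 ^ (6 * L) := (val_of_not_writes rfl s2).trans b2
  have r4 := (divide_spec s3 quo base (by decide) (by rwa [b3]) (by rwa [b3])).2
  rw [q3, b3] at r4
  set s4 := eval (divide quo base) s3 with hs4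
  set M := val s idx / (2 ^ (6 * L)) ^ val s dig % 2 ^ (6 * L) with hM
  have hMlt : M < 2 ^ (6 * L) := Nat.mod_lt _ hpos
  set s5 := eval (copy den rem) (eval (inc rem) s4) with hs5
  have d5 : val s5 den = M + 1 := by
    rw [hs5, val_copy_self, val_inc, Function.update_self, r4, Nat.mod_eq_of_lt (by omega)]
  have e5 : val s5 ex = val s ex := by
    rw [hs5, val_of_not_writes rfl, val_of_not_writes rfl, hs4, val_of_not_writes rfl, hs3,
      val_of_not_writes rfl, f2 ex rfl]
  have o5 : val s5 off = val s off := by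
    rw [hs5, val_of_not_writes rfl, val_of_not_writes rfl, hs4, val_of_not_writes rfl, hs3,
      val_of_not_writes rfl, f2 off rfl]
  have c5 : val s5 chk = val s2 chk := by
    rw [hs5, val_of_not_writes rfl, val_of_not_writes rfl, hs4, val_of_not_writes rfl, hs3,
      val_of_not_writes rfl]
  have p6 := powMod_spec s5 (by omega) (by
    rw [d5]
    have : (M + 1) ^ 2 ≤ (2 ^ (6 * L)) ^ 2 := Nat.pow_le_pow_left hMlt 2
    omega)
  rw [d5, e5] at p6
  set s7 := eval (two base) (eval powMod s5) with hs7
  have r7 : val s7 rem = 2 ^ val s ex % (M + 1) := by rw [hs7, val_of_not_writes rfl, p6]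
  have b7 : val s7 base = 2 := two_spec _ base (by omega)
  have o7 : val s7 off = val s off := by
    rw [hs7, val_of_not_writes rfl, val_of_not_writes rfl, o5]
  have q8 := quotPow_spec s7 rem base off (by decide) (by decide) (by decide) (by omega)
    (by rw [b7]; exact h4) (by rwa [o7])
  rw [r7, b7, o7] at q8
  set s8 := eval (quotPow rem base off) s7 with hs8
  have b8 : val s8 base = 2 := (val_of_not_writes rfl s7).trans b7
  have r9 := (divide_spec s8 quo base (by decide) (by omega) (by rw [b8]; exact h4)).2
  rw [q8, b8] at r9
  refine ⟨?_, r9⟩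
  rw [val_of_not_writes rfl, hs8, val_of_not_writes rfl, hs7, val_of_not_writes rfl,
    val_of_not_writes rfl, c5, c2]

/-- Sets the flag if `x = y`. -/
def equal (x y : Reg) : Prog Reg := sub tmp x y ;; iff (sub tmp y x) .skip

theorem flag_equal (s : Mem Reg W) (x y : Reg) (hx : x ≠ tmp) (hy : y ≠ tmp) :
    (eval (equal x y) s).flag = decide (val s x = val s y) := by
  rw [equal, eval_seq, eval_iff, flag_sub]
  split_ifs with h
  · rw [flag_sub, val_sub, Function.update_of_ne hx, Function.update_of_ne hy]
    simp only [decide_eq_true_eq] at h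
    congr 1
    simp only [eq_iff_iff]
    omega
  · rw [eval_skip, flag_sub]
    simp only [decide_eq_true_eq] at h
    rw [decide_eq_false h, eq_comm, decide_eq_false (by omega)]

/-- Clears the flag. -/
def fail : Prog Reg := copy tmp tmp

theorem flag_fail (s : Mem Reg W) : (eval fail s).flag = false := by
  rw [fail, copy, eval, flag_adder]
  simp [addend, Mem.get, val_lt]

/-- The answer to the query. -/
def answer : Prog Reg :=
  dec tmp out ;;
  iff (dec tmp chk ;; iff fail (dec tmp lg ;; iff (equal b rem) .skip))
    (dec tmp cons ;; iff (equal a value) .skip)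

/-- A constant gate carries its value as its name, so a query about it compares `a` with `value`.
Queries of the remaining kinds leave `out` and `cons` zero and are denied. -/
theorem flag_answer (s : Mem Reg W) : (eval answer s).flag =
    if 0 < val s out then
      (decide (val s chk = 0) && decide (0 < val s lg) && decide (val s b = val s rem))
    else (decide (0 < val s cons) && decide (val s a = val s value)) := by
  simp only [answer, eval_seq, eval_iff, flag_dec, decide_eq_true_eq]
  have f : ∀ (x r : Reg) (s : Mem Reg W), r ≠ tmp → val (eval (dec tmp x) s) r = val s r :=
    fun x r s hr => by rw [val_dec, Function.update_of_ne hr]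
  split_ifs with h1 h2 h3 h4 <;> simp only [f _ _ _ (show chk ≠ tmp by decide),
    f _ _ _ (show lg ≠ tmp by decide), f _ _ _ (show cons ≠ tmp by decide)] at *
  · rw [flag_fail, decide_eq_false (by omega)]; rfl
  · have hc : val s chk = 0 := by omega
    rw [flag_equal _ _ _ (by decide) (by decide), decide_eq_true hc, decide_eq_true h3]
    simp only [f _ _ _ (show b ≠ tmp by decide), f _ _ _ (show rem ≠ tmp by decide),
      Bool.true_and]
  · simp [eval_skip, flag_dec, f _ _ _ (show lg ≠ tmp by decide), h3]
  · rw [flag_equal _ _ _ (by decide) (by decide), decide_eq_true h4]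
    simp only [f _ _ _ (show a ≠ tmp by decide), f _ _ _ (show value ≠ tmp by decide),
      Bool.true_and]
  · simp [eval_skip, flag_dec, f _ _ _ (show cons ≠ tmp by decide), h4]

/-! ### Reading the query -/

/-- Tests whether the symbol that was read satisfies a predicate. -/
def onSym (f : QuerySymbol → Bool) (p q : Prog Reg) : Prog Reg :=
  .ite (fun _ o => o.any f) p q

theorem eval_onSym (f : QuerySymbol → Bool) (p q : Prog Reg) (s : Mem Reg W) :
    eval (onSym f p q) s = if s.sym.any f then eval p s else eval q s := rfl

/-- Processes one symbol of a query, which is read from its end. -/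
def parseStep : Prog Reg :=
  -- Read from the end, a binary number shows its leading bit first, so doubling builds it up. The
  -- numbers arrive in the order `b`, `a`, `n`; each is collected in the register `n`, and a comma
  -- passes the registers on.
  .read ;; (onSym (fun | .bit v => v | _ => false) (addc n n n true) <|
  onSym (fun | .bit v => !v | _ => false) (addc n n n false) <|
  onSym (fun | .comma => true | _ => false) (copy b a ;; copy a n ;; clear n) <|
  onSym (fun | .kind (.const v) => v | _ => false) (inc cons ;; inc value) <|
  onSym (fun | .kind (.const v) => !v | _ => false) (inc cons) <|
  onSym (fun | .kind .output => true | _ => false) (inc out) .skip)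

theorem aux_parseStep (s : Mem Reg W) : (eval parseStep s).aux = s.aux.tail := by
  rw [parseStep, eval_seq, aux_of_readFree rfl]
  rfl

theorem parseStep_nil (s : Mem Reg W) (h : s.aux = []) :
    val (eval parseStep s) = val s := by
  have : (eval .read s).sym = none := by simp [eval, Mem.read, h]
  rw [parseStep, eval_seq]
  simp only [eval_onSym, this, Option.any_none]
  rfl

theorem parseStep_bit (s : Mem Reg W) (v : Bool) (l : List QuerySymbol)
    (h : s.aux = .bit v :: l) :
    val (eval parseStep s) =
      Function.update (val s) n ((val s n + val s n + v.toNat) % 2 ^ W) := by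
  have : (eval .read s).sym = some (.bit v) := by simp [eval, Mem.read, h]
  rw [parseStep, eval_seq]
  simp only [eval_onSym, this, Option.any_some]
  cases v
  · exact val_addc (eval .read s) n n n false
  · exact val_addc (eval .read s) n n n true

theorem parseStep_comma (s : Mem Reg W) (l : List QuerySymbol) (h : s.aux = .comma :: l) :
    val (eval parseStep s) = Function.update (Function.update (Function.update (val s) b (val s a))
      a (val s n)) n 0 := by
  have : (eval .read s).sym = some .comma := by simp [eval, Mem.read, h]
  rw [parseStep, eval_seq]
  simp only [eval_onSym, this, Option.any_some]
  simp only [Bool.false_eq_true, if_false, if_true, eval_seq, val_clear, val_copy]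
  rfl

/-- The registers `cons`, `value`, `out` describe the kind of the query. -/
def HasKind (t : QueryKind) (s : Mem Reg W) : Prop :=
  match t with
  | .const v => val s cons = 1 ∧ val s value = v.toNat ∧ val s out = 0
  | .output => val s cons = 0 ∧ val s out = 1
  | _ => val s cons = 0 ∧ val s out = 0

theorem parseStep_kind (s : Mem Reg W) (t : QueryKind) (l : List QuerySymbol)
    (h : s.aux = .kind t :: l) (hW : 1 ≤ W) (hc : val s cons = 0) (hv : val s value = 0)
    (ho : val s out = 0) :
    let s' := eval parseStep s
    (∀ r, r ≠ cons → r ≠ value → r ≠ out → val s' r = val s r) ∧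
      HasKind t s' := by
  intro s'
  have hW1 : 1 < 2 ^ W := Nat.one_lt_two_pow (by omega)
  have e : (eval .read s).sym = some (.kind t) := by simp [eval, Mem.read, h]
  have ev : val (eval .read s) = val s := rfl
  have hs' : s' = eval parseStep s := rfl
  rw [parseStep, eval_seq] at hs'
  simp only [eval_onSym, e, Option.any_some] at hs'
  cases t with
  | const v =>
    cases v <;> simp only [Bool.false_eq_true, if_false, if_true, Bool.not_false] at hs' <;>
      simp [HasKind, hs', eval_seq, val_inc, ev, hc, hv, ho, Nat.mod_eq_of_lt hW1] <;>
      intro r h1 h2 h3 <;> simp [Function.update_of_ne, h1, h2]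
  | output =>
    simp only [Bool.false_eq_true, if_false, if_true] at hs'
    simp [HasKind, hs', val_inc, ev, hc, ho, Nat.mod_eq_of_lt hW1]
    intro r h1 h2 h3
    simp [Function.update_of_ne, h3]
  | _ =>
    simp only [Bool.false_eq_true, if_false, eval_skip] at hs'
    simp [HasKind, hs', ev, hc, ho]

/-- The bound on `(val s n + 1) * 2 ^ bs.length` is preserved by every doubling and excludes
overflow. -/
theorem parse_bits (rest : List QuerySymbol) (bs : List Bool) : ∀ s : Mem Reg W,
    s.aux = bs.map .bit ++ rest →
    (val s n + 1) * 2 ^ bs.length ≤ 2 ^ W →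
    let s' := (eval parseStep)^[bs.length] s
    s'.aux = rest ∧
      val s' = Function.update (val s) n (bs.foldl (fun x v => 2 * x + v.toNat) (val s n)) := by
  induction bs with
  | nil => intro s h _; simpa using h
  | cons v bs ih =>
    intro s h hb s'
    have hs' : s' = (eval parseStep)^[bs.length] (eval parseStep s) := by
      simp only [s', List.length_cons, Function.iterate_succ_apply]
    have hv : v.toNat ≤ 1 := Bool.toNat_le v
    rw [List.length_cons, pow_succ'] at hb
    have h1 : 2 * val s n + v.toNat < 2 ^ W := by
      have : 1 ≤ 2 ^ bs.length := Nat.one_le_two_pow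
      nlinarith
    have vs := parseStep_bit s v _ h
    rw [← two_mul, Nat.mod_eq_of_lt h1] at vs
    obtain ⟨i1, i2⟩ := ih (eval parseStep s) (by rw [aux_parseStep, h]; rfl) (by
      rw [vs, Function.update_self]
      refine le_trans ?_ hb
      rw [← mul_assoc]
      exact Nat.mul_le_mul_right _ (by omega))
    rw [← hs'] at i1 i2
    refine ⟨i1, ?_⟩
    rw [i2, vs, Function.update_idem, Function.update_self]
    rfl

theorem foldl_bits (k : ℕ) :
    (Nat.bits k).reverse.foldl (fun x v => 2 * x + v.toNat) 0 = k := by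
  rw [List.foldl_reverse]
  induction k using Nat.binaryRec' with
  | zero => simp
  | bit v k h ih =>
    rw [Nat.bits_append_bit _ _ h, List.foldr_cons, ih]
    simp [Nat.bit_val]

/-- Reads the query. -/
def parse : Prog Reg := .loop 0 parseStep

theorem parse_spec (q : Query) (hW : q.encode.length ≤ W) :
    let s' := eval parse (start W q.encode)
    s'.aux = [] ∧ val s' n = q.n ∧ val s' a = q.a ∧ val s' b = q.b ∧
      HasKind q.kind s' := by
  intro s'
  have hlen : q.encode.length = (((Nat.bits q.n).length + (Nat.bits q.a).length) +
      (Nat.bits q.b).length) + 3 := by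
    simp [Query.encode]; omega
  -- Of the `W` rounds, `k` are spent on the exhausted input, where `parseStep` changes no register.
  -- The three single rounds read the kind and the two commas.
  obtain ⟨k, hk⟩ : ∃ k, W = k + 1 + (Nat.bits q.n).length + 1 + (Nat.bits q.a).length + 1 +
      (Nat.bits q.b).length := ⟨W - q.encode.length, by omega⟩
  set s0 : Mem Reg W := start W q.encode with hs0
  have a0 : s0.aux = (Nat.bits q.b).reverse.map .bit ++ (.comma ::
      ((Nat.bits q.a).reverse.map .bit ++ (.comma :: ((Nat.bits q.n).reverse.map .bit ++
        [.kind q.kind])))) := by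
    simp [hs0, start, Query.encode]
  have v0 : ∀ r, val s0 r = 0 := fun r => by simp [hs0, start, val]
  have hpow : ∀ l : List Bool, l.length ≤ W → (0 + 1) * 2 ^ l.length ≤ 2 ^ W := fun l hl => by
    rw [zero_add, one_mul]; exact Nat.pow_le_pow_right (by norm_num) hl
  have e : s' = (eval parseStep)^[k] (eval parseStep ((eval parseStep)^[(Nat.bits q.n).reverse.length]
      (eval parseStep ((eval parseStep)^[(Nat.bits q.a).reverse.length] (eval parseStep
        ((eval parseStep)^[(Nat.bits q.b).reverse.length] s0)))))) := by
    have : s' = (eval parseStep)^[W] s0 := rfl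
    rw [this, ← Function.iterate_succ_apply, ← Function.iterate_add_apply,
      ← Function.iterate_succ_apply, ← Function.iterate_add_apply,
      ← Function.iterate_succ_apply, ← Function.iterate_add_apply]
    simp only [List.length_reverse, Nat.succ_eq_add_one]
    congr 2
  obtain ⟨a1, v1⟩ := parse_bits _ _ s0 a0 (by
    rw [v0]; exact hpow _ (by rw [List.length_reverse]; omega))
  rw [v0, foldl_bits] at v1
  set s1 := (eval parseStep)^[(Nat.bits q.b).reverse.length] s0
  have v2 := parseStep_comma s1 _ a1
  have a2 := (aux_parseStep s1).trans (congrArg List.tail a1)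
  set s2 := eval parseStep s1
  obtain ⟨a3, v3⟩ := parse_bits _ _ s2 a2 (by
    rw [v2, Function.update_self]; exact hpow _ (by rw [List.length_reverse]; omega))
  rw [v2, Function.update_self, foldl_bits] at v3
  set s3 := (eval parseStep)^[(Nat.bits q.a).reverse.length] s2
  have v4 := parseStep_comma s3 _ a3
  have a4 := (aux_parseStep s3).trans (congrArg List.tail a3)
  set s4 := eval parseStep s3
  obtain ⟨a5, v5⟩ := parse_bits _ _ s4 a4 (by
    rw [v4, Function.update_self]; exact hpow _ (by rw [List.length_reverse]; omega))
  rw [v4, Function.update_self, foldl_bits] at v5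
  set s5 := (eval parseStep)^[(Nat.bits q.n).reverse.length] s4
  have n5 : val s5 n = q.n := by simp [v5]
  have x5 : val s5 a = q.a := by simp [v5, v3]
  have b5 : val s5 b = q.b := by simp [v5, v3, v1]
  have c5 : ∀ r, r ≠ n → r ≠ a → r ≠ b → val s5 r = 0 := by
    intro r h1 h2 h3
    simp [v5, v3, v1, h1, h2, h3, v0]
  obtain ⟨v6, w6⟩ := parseStep_kind s5 q.kind [] a5 (by omega) (c5 _ (by decide) (by decide)
    (by decide)) (c5 _ (by decide) (by decide) (by decide)) (c5 _ (by decide) (by decide)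
    (by decide))
  have a6 : (eval parseStep s5).aux = [] := by rw [aux_parseStep, a5]; rfl
  set s6 := eval parseStep s5
  have h7 : s'.aux = [] ∧ val s' = val s6 := by
    rw [e]
    exact iterate_invariant (fun _ s' => s'.aux = [] ∧ val s' = val s6) k ⟨a6, rfl⟩
      fun t _ s' hs' => ⟨by rw [aux_parseStep, hs'.1]; rfl, (parseStep_nil s' hs'.1).trans hs'.2⟩
  refine ⟨h7.1, ?_⟩
  simp only [HasKind, h7.2]
  refine ⟨?_, ?_, ?_, w6⟩
  · rw [v6 _ (by decide) (by decide) (by decide), n5]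
  · rw [v6 _ (by decide) (by decide) (by decide), x5]
  · rw [v6 _ (by decide) (by decide) (by decide), b5]

end BitProg

/-! ### The circuits -/

/-- The bit at position `a` of the list of weight functions for `n` nodes. -/
def weightBit (n a : ℕ) : Bool :=
  -- The quotient of `a` by the length of a weight splits into an edge number, the exponent of two,
  -- and an index; the remainder splits into the digit of the index that gives the modulus and a bit
  -- of the residue.
  (2 ^ (a / (7 * Nat.log 2 n ^ 2) % (n / 2) ^ 2) %
    (a / (7 * Nat.log 2 n ^ 2) / (n / 2) ^ 2 /
      (2 ^ (6 * Nat.log 2 n)) ^ (a % (7 * Nat.log 2 n ^ 2) / (7 * Nat.log 2 n)) %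
        2 ^ (6 * Nat.log 2 n) + 1)).testBit (a % (7 * Nat.log 2 n ^ 2) % (7 * Nat.log 2 n))

/-- The number of bits of the list of weight functions for `n` nodes. -/
def weightLength (n : ℕ) : ℕ :=
  (2 ^ (6 * Nat.log 2 n)) ^ Nat.log 2 n * (n / 2) ^ 2 * (7 * Nat.log 2 n ^ 2)

/-- The circuit that outputs the list of weight functions. -/
def weightCircuit (n : ℕ) : Circuit n (weightLength n) where
  size := 2
  gate g := .const (g == 1)
  output p := if weightBit n p then 1 else 0
  acyclic := ⟨fun _ => ⟨_, fun _ h => h.elim⟩⟩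

/-! ### The circuits are uniform -/

namespace BitProg

open Reg

/-- The program that answers queries about the circuits. -/
def query : Prog Reg := parse ;; params ;; locate ;; bitAt ;; answer

/-- Two loop indices suffice: loops are nested only in `divPow` and `powMod`, and there to depth
two. -/
theorem nested_query : Nested query 2 := by
  simp [Nested, query, parse, parseStep, onSym, params, locate, bitAt, answer, logarithm, two,
    divide, divmod, prod, mul, sevenfold, quotPow, divPow, powMod, equal, fail, iff, addc, sub, copy,
    inc, dec, clear]

theorem weightCircuit_connection (q : Query) :
    (weightCircuit q.n).Connection q.kind q.a q.b ↔
      match q.kind with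
      | .const v => q.a = v.toNat
      | .output => q.a < weightLength q.n ∧ q.b = (weightBit q.n q.a).toNat
      | _ => False := by
  obtain ⟨t, n, a, b⟩ := q
  cases t with
  | const v =>
    simp only [Circuit.Connection, weightCircuit]
    constructor
    · rintro ⟨g, rfl, hg⟩
      injection hg with hg
      subst hg
      revert g
      change ∀ g : Fin 2, g.val = (g == 1).toNat
      decide
    · rintro rfl
      cases v
      · exact ⟨(0 : Fin 2), rfl, rfl⟩
      · exact ⟨(1 : Fin 2), rfl, rfl⟩
  | output =>
    simp only [Circuit.Connection, weightCircuit]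
    constructor
    · rintro ⟨p, rfl, hp⟩
      refine ⟨p.2, ?_⟩
      rw [← hp]
      cases weightBit n p <;> rfl
    · rintro ⟨ha, rfl⟩
      refine ⟨⟨a, ha⟩, rfl, ?_⟩
      cases weightBit n a <;> rfl
  | _ => simp [Circuit.Connection, weightCircuit]

theorem log_length_bits (n : ℕ) : Nat.log 2 n ≤ (Nat.bits n).length := by
  rw [Nat.size_eq_bits_len]
  by_contra! h
  have h1 := Nat.lt_size_self n
  have h2 : 2 ^ Nat.log 2 n ≤ n := Nat.pow_log_le_self 2 (by rintro rfl; simp at h)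
  have h3 : 2 ^ n.size ≤ 2 ^ Nat.log 2 n := Nat.pow_le_pow_right (by norm_num) h.le
  omega

theorem lt_weightLength_iff {n a : ℕ} (h : 0 < Nat.log 2 n) : a < weightLength n ↔
    a / (7 * Nat.log 2 n ^ 2) / (n / 2) ^ 2 /
      (2 ^ (6 * Nat.log 2 n)) ^ Nat.log 2 n = 0 := by
  have hn : 2 ≤ n := by
    by_contra! h'
    rw [Nat.log_of_lt h'] at h
    omega
  have h2 : 0 < n / 2 := by omega
  rw [weightLength, Nat.div_eq_zero_iff_lt (by positivity), Nat.div_lt_iff_lt_mul (by positivity),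
    Nat.div_lt_iff_lt_mul (by positivity)]

open Classical in
theorem query_spec (q : Query) (W : ℕ) (hW : W = 12 * q.encode.length) :
    (eval query (start W q.encode)).aux = [] ∧
      (eval query (start W q.encode)).flag =
        decide ((weightCircuit q.n).Connection q.kind q.a q.b) := by
  -- The `3` counts the kind and the two commas.
  have hlen : Nat.log 2 q.n + 3 ≤ q.encode.length := by
    have := log_length_bits q.n
    simp [Query.encode]; omega
  obtain ⟨x1, n1, a1, b1, k1⟩ := parse_spec q (W := W) (by omega)
  simp only [query, eval_seq]
  set s1 := eval parse (start W q.encode) with hs1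
  set L := Nat.log 2 q.n with hL
  obtain ⟨l2, sq2, bk2, w2, ba2⟩ := params_spec s1 L (by rw [n1]) (by omega)
  set s2 := eval params s1 with hs2
  have f2 : ∀ r, writes params r = false → val s2 r = val s1 r :=
    fun r hr => val_of_not_writes hr s1
  set s3 := eval locate s2 with hs3
  have f3 : ∀ r, writes locate r = false → val s3 r = val s2 r :=
    fun r hr => val_of_not_writes hr s2
  set s4 := eval bitAt s3 with hs4
  have f4 : ∀ r, writes bitAt r = false → val s4 r = val s3 r :=
    fun r hr => val_of_not_writes hr s3
  refine ⟨by rw [aux_of_readFree rfl, hs4, aux_of_readFree rfl, hs3, aux_of_readFree rfl, hs2,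
    aux_of_readFree rfl, x1], ?_⟩
  rw [flag_answer, f4 out rfl, f3 out rfl, f2 out rfl, f4 lg rfl, f3 lg rfl, l2, f4 b rfl,
    f3 b rfl, f2 b rfl, b1, f4 cons rfl, f3 cons rfl, f2 cons rfl, f4 a rfl, f3 a rfl, f2 a rfl,
    a1, f4 value rfl, f3 value rfl, f2 value rfl]
  simp only [weightCircuit_connection]
  -- For `L = 0` the divisors `blk` and `wid` vanish and the registers mean nothing. Then
  -- `weightLength` is zero, and `answer` rejects output queries by its test of `lg`.
  have key : 0 < L → (val s4 chk = 0 ↔ q.a < weightLength q.n) ∧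
      val s4 rem = (weightBit q.n q.a).toNat := by
    intro hpos
    have hn2 : 2 ≤ q.n := by
      by_contra! h'
      rw [hL, Nat.log_of_lt h'] at hpos
      omega
    have hn : q.n < 2 ^ (L + 1) := Nat.lt_pow_succ_log_self (by norm_num) _
    have hLL : L < 2 ^ L := Nat.lt_two_pow_self
    have hm : q.n / 2 < 2 ^ L := by rw [pow_succ] at hn; omega
    have hm2 : (q.n / 2) * (q.n / 2) < 2 ^ (2 * L) := by
      rw [two_mul, pow_add]; exact Nat.mul_lt_mul'' hm hm
    have hL2 : L * L < 2 ^ (2 * L) := by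
      rw [two_mul, pow_add]; exact Nat.mul_lt_mul'' hLL hLL
    have h2 : 16 * 2 ^ (2 * L) ≤ 2 ^ W := by
      rw [show 16 = 2 ^ 4 by norm_num, ← pow_add]
      exact Nat.pow_le_pow_right (by norm_num) (by omega)
    have hLL' : L ≤ L * L := Nat.le_mul_self L
    have hmpos : 0 < q.n / 2 := by omega
    rw [n1] at sq2
    obtain ⟨e3, i3, d3, o3⟩ := locate_spec s2 (by rw [bk2]; positivity)
      (by rw [bk2, pow_two]; omega) (by rw [sq2]; positivity) (by rw [sq2, pow_two]; omega)
      (by rw [w2]; omega) (by rw [w2]; omega)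
    rw [← hs3] at e3 i3 d3 o3
    rw [f2 a rfl, a1, bk2] at e3 i3 d3 o3
    rw [sq2] at e3 i3
    rw [w2] at d3 o3
    have hd : val s3 dig ≤ W := by
      have : q.a % (7 * L ^ 2) / (7 * L) < L := by
        rw [Nat.div_lt_iff_lt_mul (by omega)]
        have := Nat.mod_lt q.a (show 0 < 7 * L ^ 2 by positivity)
        nlinarith
      omega
    have ho : val s3 off ≤ W := by
      have := Nat.mod_lt (q.a % (7 * L ^ 2)) (show 0 < 7 * L by omega)
      omega
    obtain ⟨c4, r4⟩ := bitAt_spec s3 L (by omega) ((f3 base rfl).trans ba2)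
      ((f3 lg rfl).trans l2) hd ho
    rw [← hs4, i3] at c4 r4
    rw [e3, d3, o3] at r4
    refine ⟨?_, ?_⟩
    · rw [c4, lt_weightLength_iff hpos]
    · rw [r4, weightBit, Nat.toNat_testBit]
  cases hk : q.kind with
  | const v =>
    rw [hk] at k1
    obtain ⟨h1, h2, h3⟩ := k1
    simp [h1, h2, h3]
  | output =>
    rw [hk] at k1
    obtain ⟨h1, h2⟩ := k1
    simp only [h2, if_true, Nat.one_pos]
    rcases Nat.eq_zero_or_pos L with h0 | h0
    · simp [h0, weightLength, ← hL]
    · obtain ⟨k2, k3⟩ := key h0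
      simp [h0, k2, k3]
  | _ =>
    rw [hk] at k1
    obtain ⟨h1, h2⟩ := k1
    simp [h1, h2]

end BitProg

theorem uniformCircuits_weightCircuit : UniformCircuits weightCircuit :=
  have := BitProg.finite_reg
  BitProg.computable_of_prog 12 BitProg.query BitProg.nested_query _ _
    (fun q => (BitProg.query_spec q _ rfl).1) (fun q => (BitProg.query_spec q _ rfl).2)

/-- One constant has to serve as factor and as exponent. The left side is at most `2 ^ (6 * L ^ 2 +
4 * L + 4)` and `L ≤ L ^ 2 ≤ L ^ 16`, so `16` is ample. -/
theorem weightLength_le {n : ℕ} (hn : 2 ≤ n) :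
    2 + weightLength n ≤ 2 ^ (16 * Nat.log 2 n ^ 16) := by
  have hL : 1 ≤ Nat.log 2 n := Nat.log_pos (by norm_num) hn
  have hn : n < 2 ^ (Nat.log 2 n + 1) := Nat.lt_pow_succ_log_self (by norm_num) _
  rw [weightLength]
  generalize Nat.log 2 n = L at *
  have hm : (n / 2) ^ 2 ≤ (2 ^ L) ^ 2 := Nat.pow_le_pow_left (by rw [pow_succ] at hn; omega) 2
  have hLL : L ^ 2 ≤ (2 ^ L) ^ 2 := Nat.pow_le_pow_left Nat.lt_two_pow_self.le 2
  have h16 : L ^ 2 ≤ L ^ 16 := Nat.pow_le_pow_right hL (by norm_num)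
  have h1 : L ≤ L ^ 2 := Nat.le_self_pow (by norm_num) L
  calc 2 + (2 ^ (6 * L)) ^ L * (n / 2) ^ 2 * (7 * L ^ 2)
      ≤ 2 + (2 ^ (6 * L)) ^ L * (2 ^ L) ^ 2 * (2 ^ 3 * (2 ^ L) ^ 2) := by gcongr; norm_num
    _ = 2 ^ 1 + 2 ^ (6 * L ^ 2 + 4 * L + 3) := by ring
    _ ≤ 2 ^ (6 * L ^ 2 + 4 * L + 3) + 2 ^ (6 * L ^ 2 + 4 * L + 3) := by
        gcongr
        · norm_num
        · omega
    _ = 2 ^ (6 * L ^ 2 + 4 * L + 3 + 1) := by ring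
    _ ≤ 2 ^ (16 * L ^ 16) := Nat.pow_le_pow_right (by norm_num) (by omega)

/-- The list of weight functions, as a function of the length of the input. -/
def weightList (x : List Bool) : List Bool :=
  List.ofFn fun p : Fin (weightLength x.length) => weightBit x.length p

theorem inQuasiNC_weightList : InQuasiNC 1 weightList := by
  refine ⟨weightLength, weightCircuit, uniformCircuits_weightCircuit,
    ⟨16, fun n hn => weightLength_le hn⟩, ⟨0, fun n _ => ⟨fun _ => 0, ?_, fun _ => Nat.zero_le _⟩⟩,
    fun n x => ⟨fun p => weightBit n p, ?_, ?_⟩⟩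
  · rintro g h ⟨⟩
  · intro p
    refine .const _ _ ?_
    simp only [weightCircuit]
    cases weightBit n p <;> rfl
  · simp [weightList]

/-! ### Isolation -/

namespace Isolation

variable {m : ℕ}

/-- The permutations all of whose edges belong to `E`. -/
def Perfect (E : Fin m → Fin m → Prop) (σ : Equiv.Perm (Fin m)) : Prop := ∀ i, E i (σ i)

/-- The weight of a permutation. -/
def weight (w : Fin m → Fin m → ℤ) (σ : Equiv.Perm (Fin m)) : ℤ := ∑ i, w i (σ i)

/-- The permutations of minimal weight. -/
def Minimal (E : Fin m → Fin m → Prop) (w : Fin m → Fin m → ℤ) (σ : Equiv.Perm (Fin m)) : Prop :=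
  Perfect E σ ∧ ∀ τ, Perfect E τ → weight w σ ≤ weight w τ

/-- The union of the permutations of minimal weight. -/
def minEdges (E : Fin m → Fin m → Prop) (w : Fin m → Fin m → ℤ) (i j : Fin m) : Prop :=
  ∃ σ, Minimal E w σ ∧ σ i = j

theorem minEdges_le {E : Fin m → Fin m → Prop} {w : Fin m → Fin m → ℤ} {i j : Fin m}
    (h : minEdges E w i j) : E i j := by
  obtain ⟨σ, hσ, rfl⟩ := h
  exact hσ.1 i

theorem Minimal.perfect {E : Fin m → Fin m → Prop} {w : Fin m → Fin m → ℤ}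
    {σ : Equiv.Perm (Fin m)} (h : Minimal E w σ) : Perfect (minEdges E w) σ :=
  fun _ => ⟨σ, h, rfl⟩

theorem exists_minimal {E : Fin m → Fin m → Prop} (w : Fin m → Fin m → ℤ)
    (h : ∃ σ, Perfect E σ) : ∃ σ, Minimal E w σ := by
  classical
  obtain ⟨σ, hσ⟩ := h
  obtain ⟨τ, hτ, hmin⟩ := Finset.exists_min_image (Finset.univ.filter fun σ => Perfect E σ)
    (weight w) ⟨σ, by simpa using hσ⟩
  exact ⟨τ, by simpa using hτ, fun ρ hρ => hmin ρ (by simpa using hρ)⟩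

theorem sum_column (τ : Equiv.Perm (Fin m)) (j : Fin m) :
    (∑ i, if τ i = j then (1 : ℤ) else 0) = 1 := by
  simp [← Equiv.eq_symm_apply]

/-- A nonnegative matrix with constant line sums weighs at least as much as a multiple of a
permutation of minimal weight. -/
theorem le_weight_of_lineSum {E : Fin m → Fin m → Prop} {w : Fin m → Fin m → ℤ}
    {σ : Equiv.Perm (Fin m)} (hσ : Minimal E w σ) (y : Fin m → Fin m → ℤ) (t : ℤ)
    (h0 : ∀ i j, 0 ≤ y i j) (hE : ∀ i j, y i j ≠ 0 → E i j) (hr : ∀ i, ∑ j, y i j = t)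
    (hc : ∀ j, ∑ i, y i j = t) : t * weight w σ ≤ ∑ i, ∑ j, y i j * w i j := by
  rcases Nat.eq_zero_or_pos m with rfl | hm
  · simp [weight]
  have ht : 0 ≤ t := hr ⟨0, hm⟩ ▸ Finset.sum_nonneg fun j _ => h0 _ j
  rcases ht.eq_or_lt with rfl | ht
  · have hy : ∀ i j, y i j = 0 := fun i j =>
      (Finset.sum_eq_zero_iff_of_nonneg fun j _ => h0 i j).1 (hr i) j (Finset.mem_univ j)
    simp [hy]
  have htq : (0 : ℚ) < t := by exact_mod_cast ht
  -- Divided by `t`, the matrix is doubly stochastic, so by Birkhoff's theorem it is a convex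
  -- combination of permutation matrices.
  have hD : (Matrix.of fun i j => (y i j : ℚ) / t) ∈ doublyStochastic ℚ (Fin m) := by
    rw [mem_doublyStochastic_iff_sum]
    refine ⟨fun i j => ?_, fun i => ?_, fun j => ?_⟩
    · have := h0 i j
      simp only [Matrix.of_apply]
      positivity
    · simp only [Matrix.of_apply]
      rw [← Finset.sum_div, ← Int.cast_sum, hr, div_self htq.ne']
    · simp only [Matrix.of_apply]
      rw [← Finset.sum_div, ← Int.cast_sum, hc, div_self htq.ne']
  obtain ⟨l, hl, hl1, hsum⟩ := exists_eq_sum_perm_of_mem_doublyStochastic hD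
  have hent : ∀ i j, (y i j : ℚ) = t * ∑ τ : Equiv.Perm (Fin m), l τ * if τ i = j then 1 else 0 := by
    intro i j
    have := congrFun (congrFun hsum i) j
    rw [Matrix.sum_apply] at this
    simp only [Matrix.smul_apply, Matrix.of_apply, smul_eq_mul, PEquiv.toMatrix_apply,
      Equiv.toPEquiv_apply, Option.mem_def, Option.some.injEq] at this
    rw [this]
    field_simp
  -- As the coefficients are nonnegative, nothing cancels: a permutation that occurs lies in the
  -- support of `y`, hence in `E`.
  have hperf : ∀ τ, l τ ≠ 0 → Perfect E τ := by
    intro τ hτ i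
    refine hE _ _ fun h => ?_
    have h1 := hent i (τ i)
    rw [h, Int.cast_zero, eq_comm, mul_eq_zero] at h1
    have h2 := (Finset.sum_eq_zero_iff_of_nonneg (fun ρ _ => by
      have := hl ρ
      positivity)).1 (h1.resolve_left htq.ne') τ (Finset.mem_univ τ)
    simp at h2
    exact hτ h2
  have htot : ((∑ i, ∑ j, y i j * w i j : ℤ) : ℚ) = t * ∑ τ, l τ * weight w τ := by
    push_cast
    simp only [hent, weight, Int.cast_sum, Finset.mul_sum, Finset.sum_mul]
    simp_rw [Finset.sum_comm (s := (Finset.univ : Finset (Fin m)))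
      (t := (Finset.univ : Finset (Equiv.Perm (Fin m))))]
    refine Finset.sum_congr rfl fun τ _ => Finset.sum_congr rfl fun i _ => ?_
    simp [mul_assoc]
  have hge : (weight w σ : ℚ) ≤ ∑ τ, l τ * weight w τ := by
    rw [← one_mul (weight w σ : ℚ), ← hl1, Finset.sum_mul]
    refine Finset.sum_le_sum fun τ _ => ?_
    by_cases hτ : l τ = 0
    · simp [hτ]
    · exact mul_le_mul_of_nonneg_left (by exact_mod_cast hσ.2 τ (hperf τ hτ)) (hl τ)
  have : ((t * weight w σ : ℤ) : ℚ) ≤ ((∑ i, ∑ j, y i j * w i j : ℤ) : ℚ) := by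
    rw [htot]
    push_cast
    exact mul_le_mul_of_nonneg_left hge htq.le
  exact_mod_cast this

/-- Circulations on the union of the permutations of minimal weight have weight zero. -/
theorem circulation_eq_zero {E : Fin m → Fin m → Prop} {w : Fin m → Fin m → ℤ}
    (hne : ∃ σ, Perfect E σ) (z : Fin m → Fin m → ℤ) (hz : ∀ i j, z i j ≠ 0 → minEdges E w i j)
    (hr : ∀ i, ∑ j, z i j = 0) (hc : ∀ j, ∑ i, z i j = 0) : ∑ i, ∑ j, z i j * w i j = 0 := by
  classical
  obtain ⟨σ, hσ⟩ := exists_minimal w hne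
  -- Adding `N` times the sum of all minimal permutations makes `z` nonnegative without changing its
  -- line sums beyond a constant. The sum weighs at least `N * S.card` times the minimum, which is
  -- exactly what the added part weighs; so `z` has weight at least zero. Applied to `-z` as well,
  -- this gives equality.
  have key : ∀ z : Fin m → Fin m → ℤ, (∀ i j, z i j ≠ 0 → minEdges E w i j) →
      (∀ i, ∑ j, z i j = 0) → (∀ j, ∑ i, z i j = 0) → 0 ≤ ∑ i, ∑ j, z i j * w i j := by
    intro z hz hr hc
    set S : Finset (Equiv.Perm (Fin m)) := Finset.univ.filter fun τ => Minimal E w τ with hS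
    have hSmem : ∀ τ ∈ S, Minimal E w τ := fun τ hτ => by simpa [hS] using hτ
    set N : ℤ := ∑ i, ∑ j, |z i j| with hN
    have hzN : ∀ i j, |z i j| ≤ N := fun i j =>
      (Finset.single_le_sum (f := fun j => |z i j|) (fun j _ => abs_nonneg _)
        (Finset.mem_univ j)).trans (Finset.single_le_sum (f := fun i => ∑ j, |z i j|)
        (fun i _ => Finset.sum_nonneg fun j _ => abs_nonneg _) (Finset.mem_univ i))
    have hN0 : 0 ≤ N := Finset.sum_nonneg fun i _ => Finset.sum_nonneg fun j _ => abs_nonneg _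
    have h := le_weight_of_lineSum hσ
      (fun i j => N * (∑ τ ∈ S, if τ i = j then 1 else 0) + z i j) (N * S.card) ?_ ?_ ?_ ?_
    · have e : ∑ i, ∑ j, (N * (∑ τ ∈ S, if τ i = j then 1 else 0) + z i j) * w i j =
          N * S.card * weight w σ + ∑ i, ∑ j, z i j * w i j := by
        simp only [add_mul, Finset.sum_add_distrib]
        congr 1
        have : ∀ τ ∈ S, weight w τ = weight w σ := fun τ hτ =>
          le_antisymm ((hSmem τ hτ).2 σ hσ.1) (hσ.2 τ (hSmem τ hτ).1)
        rw [mul_assoc, ← nsmul_eq_mul, ← Finset.sum_const, ← Finset.sum_congr rfl this]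
        simp only [Finset.mul_sum, Finset.sum_mul, weight]
        simp_rw [Finset.sum_comm (s := (Finset.univ : Finset (Fin m))) (t := S)]
        refine Finset.sum_congr rfl fun τ _ => Finset.sum_congr rfl fun i _ => ?_
        simp
      rw [e] at h
      linarith
    · intro i j
      by_cases h : z i j = 0
      · rw [h, add_zero]
        exact mul_nonneg hN0 (Finset.sum_nonneg fun τ _ => by split_ifs <;> norm_num)
      · obtain ⟨τ, hτ, hij⟩ := hz i j h
        have h1 : (1 : ℤ) ≤ ∑ τ ∈ S, if τ i = j then 1 else 0 := by
          refine le_trans (by simp [hij]) (Finset.single_le_sum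
            (f := fun τ : Equiv.Perm (Fin m) => if τ i = j then (1 : ℤ) else 0)
            (fun τ _ => by split_ifs <;> norm_num) (show τ ∈ S by simpa [hS] using hτ))
        have h2 := neg_abs_le (z i j)
        have h3 := hzN i j
        nlinarith
    · intro i j h
      by_cases h' : z i j = 0
      · rw [h', add_zero] at h
        obtain ⟨τ, hτ, hτ'⟩ := Finset.exists_ne_zero_of_sum_ne_zero (right_ne_zero_of_mul h)
        have : τ i = j := by by_contra h''; simp [h''] at hτ'
        exact this ▸ (hSmem τ hτ).1 i
      · exact minEdges_le (hz i j h')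
    · intro i
      rw [Finset.sum_add_distrib, hr, ← Finset.mul_sum, Finset.sum_comm]
      simp
    · intro j
      rw [Finset.sum_add_distrib, hc, ← Finset.mul_sum, Finset.sum_comm]
      simp_rw [sum_column]
      simp
  refine le_antisymm ?_ (key z hz hr hc)
  have := key (fun i j => -z i j) (fun i j h => hz i j (by simpa using h)) (by simp [hr])
    (by simp [hc])
  simp only [neg_mul, Finset.sum_neg_distrib] at this
  linarith

/-- The difference of `σ` and a minimal permutation is a circulation on the union of the minimal
ones, so both have the same weight. This lets a round replace minimality by membership in a smaller
graph. -/
theorem Minimal.of_perfect_minEdges {E : Fin m → Fin m → Prop} {w : Fin m → Fin m → ℤ}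
    {σ : Equiv.Perm (Fin m)} (h : Perfect (minEdges E w) σ) : Minimal E w σ := by
  classical
  have hE : Perfect E σ := fun i => minEdges_le (h i)
  obtain ⟨τ, hτ⟩ := exists_minimal w ⟨σ, hE⟩
  have key := circulation_eq_zero ⟨σ, hE⟩
    (fun i j => (if σ i = j then 1 else 0) - if τ i = j then 1 else 0) (w := w) ?_ ?_ ?_
  · have e : weight w σ = weight w τ := by
      simp only [sub_mul, Finset.sum_sub_distrib, ite_mul, one_mul, zero_mul,
        Finset.sum_ite_eq, Finset.mem_univ, if_true] at key
      exact sub_eq_zero.1 key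
    exact ⟨hE, fun ρ hρ => e ▸ hτ.2 ρ hρ⟩
  · intro i j hij
    by_cases h1 : σ i = j
    · exact h1 ▸ h i
    · by_cases h2 : τ i = j
      · exact h2 ▸ hτ.perfect i
      · simp [h1, h2] at hij
  · intro i
    simp
  · intro j
    rw [Finset.sum_sub_distrib]
    rw [sum_column, sum_column, sub_self]

end Isolation

namespace Isolation

variable {m : ℕ}

/-! ### Alternating walks -/

/-- The characteristic vector of an edge. -/
def edge (u v : Fin m) : Fin m → Fin m → ℤ := fun i j => if u = i ∧ v = j then 1 else 0

/-- `AltWalk E k u u' z`: there is a walk with `k` steps from `u` to `u'`, where each step consists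
of an edge `(u, v)` to the right followed by an edge `(u', v)` back to the left, and `z` is the
alternating sum of the characteristic vectors of the edges. -/
inductive AltWalk (E : Fin m → Fin m → Prop) :
    ℕ → Fin m → Fin m → (Fin m → Fin m → ℤ) → Prop
  | nil (u : Fin m) : AltWalk E 0 u u 0
  | cons {u v u' u'' : Fin m} {k : ℕ} {z : Fin m → Fin m → ℤ} : E u v → E u' v →
      AltWalk E k u' u'' z → AltWalk E (k + 1) u u'' (edge u v - edge u' v + z)

namespace AltWalk

variable {E : Fin m → Fin m → Prop} {k l : ℕ} {u u' u'' : Fin m} {z z' : Fin m → Fin m → ℤ}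

theorem append (h : AltWalk E k u u' z) (h' : AltWalk E l u' u'' z') :
    AltWalk E (k + l) u u'' (z + z') := by
  induction h with
  | nil u => simpa using h'
  | cons h1 h2 _ ih =>
    have := cons h1 h2 (ih h')
    rwa [← add_assoc, Nat.add_right_comm] at this

theorem reverse (h : AltWalk E k u u' z) : AltWalk E k u' u (-z) := by
  induction h with
  | nil u => simpa using nil u
  | @cons u v u' u'' k z h1 h2 _ ih =>
    have := ih.append (cons h2 h1 (nil u))
    convert this using 1
    abel

theorem split (a b : ℕ) (h : AltWalk E (a + b) u u'' z) : ∃ u' z₁ z₂,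
    AltWalk E a u u' z₁ ∧ AltWalk E b u' u'' z₂ ∧ z = z₁ + z₂ := by
  induction a generalizing u z with
  | zero => exact ⟨u, 0, z, nil u, by simpa using h, by simp⟩
  | succ a ih =>
    rw [Nat.add_right_comm] at h
    cases h with
    | cons h1 h2 h3 =>
      obtain ⟨u', z₁, z₂, h4, h5, rfl⟩ := ih h3
      exact ⟨u', _, z₂, cons h1 h2 h4, h5, by rw [add_assoc]⟩

theorem mono {E' : Fin m → Fin m → Prop} (hE : ∀ i j, E i j → E' i j) (h : AltWalk E k u u' z) :
    AltWalk E' k u u' z := by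
  induction h with
  | nil u => exact nil u
  | cons h1 h2 _ ih => exact cons (hE _ _ h1) (hE _ _ h2) ih

theorem edge_of_ne_zero (h : AltWalk E k u u' z) {i j : Fin m} (hz : z i j ≠ 0) : E i j := by
  induction h with
  | nil u => simp at hz
  | @cons u v u' u'' k z h1 h2 _ ih =>
    by_contra hE
    have e : ∀ u v, E u v → edge u v i j = 0 := fun u v h => by
      rw [edge, if_neg]
      rintro ⟨rfl, rfl⟩
      exact hE h
    refine hE (ih ?_)
    simpa [e _ _ h1, e _ _ h2] using hz

theorem sum_col (h : AltWalk E k u u' z) (j : Fin m) : ∑ i, z i j = 0 := by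
  induction h with
  | nil u => simp
  | @cons u v u' u'' k z h1 h2 _ ih =>
    simp [Finset.sum_add_distrib, Finset.sum_sub_distrib, ih, edge, ite_and]

theorem sum_row (h : AltWalk E k u u' z) (i : Fin m) :
    ∑ j, z i j = (if u = i then 1 else 0) - if u' = i then 1 else 0 := by
  induction h with
  | nil u => simp
  | @cons u v u' u'' k z h1 h2 _ ih =>
    simp [Finset.sum_add_distrib, Finset.sum_sub_distrib, ih, edge, ite_and]

/-- Going along an edge and straight back contributes the zero vector. Thus walks of exactly `2 ^ k`
steps also cover the shorter ones. -/
theorem pad (hE : ∀ i, ∃ j, E i j) (h : AltWalk E k u u' z) (l : ℕ) :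
    AltWalk E (k + l) u u' z := by
  induction l with
  | zero => exact h
  | succ l ih =>
    obtain ⟨v, hv⟩ := hE u
    have := cons hv hv ih
    rwa [sub_self, zero_add] at this

theorem exists_vertices (h : AltWalk E k u u' z) : ∃ p q : ℕ → Fin m, p 0 = u ∧ p k = u' ∧
    (∀ t < k, E (p t) (q t) ∧ E (p (t + 1)) (q t)) ∧
      z = ∑ t ∈ Finset.range k, (edge (p t) (q t) - edge (p (t + 1)) (q t)) := by
  induction h with
  | nil u => exact ⟨fun _ => u, fun _ => u, rfl, rfl, by simp, by simp⟩
  | @cons u v u' u'' k z h1 h2 _ ih =>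
    obtain ⟨p, q, h3, h4, h5, h6⟩ := ih
    refine ⟨fun t => Nat.casesOn t u p, fun t => Nat.casesOn t v q, rfl, h4, ?_, ?_⟩
    · rintro (_ | t) ht
      · exact ⟨h1, by simpa [h3] using h2⟩
      · exact h5 t (by omega)
    · rw [Finset.sum_range_succ', h6, add_comm]
      simp [h3]

theorem of_vertices {p q : ℕ → Fin m} (h : ∀ t < k, E (p t) (q t) ∧ E (p (t + 1)) (q t))
    (a b : ℕ) (hab : a + b ≤ k) : AltWalk E b (p a) (p (a + b))
      (∑ t ∈ Finset.Ico a (a + b), (edge (p t) (q t) - edge (p (t + 1)) (q t))) := by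
  induction b with
  | zero => simpa using nil (p a)
  | succ b ih =>
    obtain ⟨h1, h2⟩ := h (a + b) (by omega)
    have := (ih (by omega)).append (cons h1 h2 (nil _))
    rw [← add_assoc, Finset.sum_Ico_succ_top (by omega)]
    simpa [add_assoc] using this

/-- A shortest closed walk with nonzero vector has entries `-1`, `0`, `1`. -/
theorem exists_simple (h : AltWalk E k u u z) (hz : z ≠ 0) : ∃ l ≤ k, ∃ u' z',
    AltWalk E l u' u' z' ∧ z' ≠ 0 ∧ ∀ i j, |z' i j| ≤ 1 := by
  induction k using Nat.strong_induction_on generalizing u z with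
  | _ k ih =>
  obtain ⟨p, q, hp0, hpk, hE, hzs⟩ := h.exists_vertices
  -- If no left vertex repeats, every edge is used at most once in each direction, so each entry is
  -- a difference of two numbers from `0` and `1`.
  by_cases hinj : Set.InjOn p (Set.Iio k)
  · refine ⟨k, le_rfl, u, z, h, hz, fun i j => ?_⟩
    have hinj' : Set.InjOn (fun t => p (t + 1)) (Set.Iio k) := by
      have aux : ∀ s t, s < t → t < k → p (s + 1) ≠ p (t + 1) := by
        intro s t hst htk he
        rcases (show t + 1 ≤ k from htk).eq_or_lt with h1 | h1
        · rw [h1, hpk, ← hp0] at he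
          have := hinj (show s + 1 < k by omega) (show 0 < k by omega) he
          omega
        · have := hinj (show s + 1 < k by omega) h1 he
          omega
      intro s hs t ht he
      rcases lt_trichotomy s t with h1 | h1 | h1
      · exact (aux s t h1 ht he).elim
      · exact h1
      · exact (aux t s h1 hs he.symm).elim
    have card_le : ∀ f : ℕ → Fin m, Set.InjOn f (Set.Iio k) →
        0 ≤ ∑ t ∈ Finset.range k, edge (f t) (q t) i j ∧
          ∑ t ∈ Finset.range k, edge (f t) (q t) i j ≤ 1 := by
      intro f hf
      simp only [edge, Finset.sum_boole]
      refine ⟨by positivity, ?_⟩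
      have : (Finset.filter (fun t => f t = i ∧ q t = j) (Finset.range k)).card ≤ 1 := by
        refine Finset.card_le_one.2 fun s hs t ht => ?_
        simp only [Finset.mem_filter, Finset.mem_range] at hs ht
        exact hf hs.1 ht.1 (hs.2.1.trans ht.2.1.symm)
      exact_mod_cast this
    have h1 := card_le p hinj
    have h2 := card_le (fun t => p (t + 1)) hinj'
    have h3 : z i j = ∑ t ∈ Finset.range k, edge (p t) (q t) i j -
        ∑ t ∈ Finset.range k, edge (p (t + 1)) (q t) i j := by
      rw [hzs]
      simp [Finset.sum_apply]
    rw [abs_le]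
    constructor <;> linarith [h1.1, h1.2, h2.1, h2.2]
  -- A repeated vertex cuts the walk into two shorter closed walks whose vectors add up to `z`; one
  -- of them is nonzero and induction applies to it.
  · have hst : ∃ s t, s < t ∧ t < k ∧ p s = p t := by
      simp only [Set.InjOn, not_forall] at hinj
      obtain ⟨s, hs, t, ht, he, hne⟩ := hinj
      rcases lt_or_gt_of_ne hne with h1 | h1
      · exact ⟨s, t, h1, ht, he⟩
      · exact ⟨t, s, h1, hs, he.symm⟩
    obtain ⟨s, t, hst, htk, he⟩ := hst
    obtain ⟨b, rfl⟩ : ∃ b, t = s + b := ⟨t - s, by omega⟩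
    obtain ⟨c, rfl⟩ : ∃ c, k = s + b + c := ⟨k - (s + b), by omega⟩
    have w1 := of_vertices hE 0 s (by omega)
    have w2 := of_vertices hE s b (by omega)
    have w3 := of_vertices hE (s + b) c (by omega)
    rw [zero_add, hp0] at w1
    rw [← he] at w2 w3
    rw [hpk] at w3
    set z1 := ∑ t ∈ Finset.Ico 0 s, (edge (p t) (q t) - edge (p (t + 1)) (q t))
    set z2 := ∑ t ∈ Finset.Ico s (s + b), (edge (p t) (q t) - edge (p (t + 1)) (q t))
    set z3 := ∑ t ∈ Finset.Ico (s + b) (s + b + c), (edge (p t) (q t) - edge (p (t + 1)) (q t))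
    have hsum : z = (z1 + z2) + z3 := by
      rw [hzs, Finset.range_eq_Ico, ← Finset.sum_Ico_consecutive _ (Nat.zero_le (s + b)) (by omega),
        ← Finset.sum_Ico_consecutive _ (Nat.zero_le s) (by omega)]
    by_cases h2 : z2 = 0
    · obtain ⟨l, hl, r⟩ := ih (s + c) (by omega) (w1.append w3) (by
        intro h13
        apply hz
        rw [hsum, h2, add_zero, h13])
      exact ⟨l, by omega, r⟩
    · obtain ⟨l, hl, r⟩ := ih b (by omega) w2 h2
      exact ⟨l, by omega, r⟩

end AltWalk

/-- All closed walks with `2 ^ k` steps have zero vector. -/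
def NoShort (E : Fin m → Fin m → Prop) (k : ℕ) : Prop :=
  ∀ u z, AltWalk E (2 ^ k) u u z → z = 0

theorem noShort_zero (E : Fin m → Fin m → Prop) : NoShort E 0 := by
  intro u z h
  rw [pow_zero] at h
  cases h with
  | cons h1 h2 h3 =>
    cases h3 with
    | nil => simp

/-- A relation assigning at most one vector to each index has a finite range. -/
theorem exists_finset_of_relation {α Z : Type*} [Fintype α] (C : α → Z → Prop)
    (hC : ∀ a z z', C a z → C a z' → z = z') :
    ∃ S : Finset Z, S.card ≤ Fintype.card α ∧ ∀ a z, C a z → z ∈ S := by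
  classical
  rcases isEmpty_or_nonempty Z with h | ⟨⟨z0⟩⟩
  · exact ⟨∅, by simp, fun a z => h.elim z⟩
  refine ⟨Finset.univ.image fun a => if h : ∃ z, C a z then h.choose else z0,
    Finset.card_image_le, fun a z hz => ?_⟩
  refine Finset.mem_image.2 ⟨a, Finset.mem_univ a, ?_⟩
  have h : ∃ z, C a z := ⟨z, hz⟩
  rw [dif_pos h]
  exact hC a _ _ h.choose_spec hz

/-- If all closed walks with `2 ^ k` steps have zero vector, there are at most `m ^ 4` vectors of
closed walks with `2 ^ (k + 1)` steps. -/
theorem NoShort.exists_finset {E : Fin m → Fin m → Prop} {k : ℕ} (h : NoShort E k) :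
    ∃ S : Finset (Fin m → Fin m → ℤ), S.card ≤ m ^ 4 ∧
      ∀ u z, AltWalk E (2 ^ (k + 1)) u u z → z ∈ S := by
  have hcard : Fintype.card (Fin m × Fin m × Fin m × Fin m) = m ^ 4 := by
    simp only [Fintype.card_prod, Fintype.card_fin]; ring
  rw [← hcard]
  cases k with
  -- Two steps have no quarters; the four vertices of the walk, two on each side, determine the
  -- vector.
  | zero =>
    obtain ⟨S, hS, hS'⟩ := exists_finset_of_relation
      (fun (a : Fin m × Fin m × Fin m × Fin m) (z : Fin m → Fin m → ℤ) =>
        z = edge a.1 a.2.1 - edge a.2.2.1 a.2.1 + (edge a.2.2.1 a.2.2.2 - edge a.1 a.2.2.2))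
      (fun a z z' hz hz' => hz.trans hz'.symm)
    refine ⟨S, hS, fun u z hz => ?_⟩
    rw [zero_add, pow_one] at hz
    cases hz with
    | @cons _ v u' _ _ z h1 h2 h3 =>
      cases h3 with
      | @cons _ v' u'' _ _ z h4 h5 h6 =>
        cases h6 with
        | nil => exact hS' (u, v, u', v') _ (by simp)
  | succ k =>
    obtain ⟨S, hS, hS'⟩ := exists_finset_of_relation
      (fun (a : Fin m × Fin m × Fin m × Fin m) (z : Fin m → Fin m → ℤ) =>
        ∃ z₁ z₂ z₃ z₄, AltWalk E (2 ^ k) a.1 a.2.1 z₁ ∧ AltWalk E (2 ^ k) a.2.1 a.2.2.1 z₂ ∧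
          AltWalk E (2 ^ k) a.2.2.1 a.2.2.2 z₃ ∧ AltWalk E (2 ^ k) a.2.2.2 a.1 z₄ ∧
          z = z₁ + (z₂ + (z₃ + z₄)))
      (by
        -- Two walks with the same ends form a closed walk with `2 ^ (k + 1)` steps, whose vector is
        -- zero. So the ends of a quarter determine its vector, and the four cut points determine
        -- everything.
        have hu : ∀ a b z z', AltWalk E (2 ^ k) a b z → AltWalk E (2 ^ k) a b z' → z = z' := by
          intro a b z z' hz hz'
          have := h a (z + -z') (by rw [pow_succ, mul_two]; exact hz.append hz'.reverse)
          rwa [← sub_eq_add_neg, sub_eq_zero] at this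
        rintro a z z' ⟨z₁, z₂, z₃, z₄, h1, h2, h3, h4, rfl⟩ ⟨y₁, y₂, y₃, y₄, g1, g2, g3, g4, rfl⟩
        rw [hu _ _ _ _ h1 g1, hu _ _ _ _ h2 g2, hu _ _ _ _ h3 g3, hu _ _ _ _ h4 g4])
    refine ⟨S, hS, fun u z hz => ?_⟩
    rw [show 2 ^ (k + 1 + 1) = 2 ^ k + (2 ^ k + (2 ^ k + 2 ^ k)) by ring] at hz
    obtain ⟨b, z₁, y₁, h1, hz₁, rfl⟩ := hz.split (2 ^ k) (2 ^ k + (2 ^ k + 2 ^ k))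
    obtain ⟨c, z₂, y₂, h2, hz₂, rfl⟩ := hz₁.split (2 ^ k) (2 ^ k + 2 ^ k)
    obtain ⟨d, z₃, z₄, h3, h4, rfl⟩ := hz₂.split (2 ^ k) (2 ^ k)
    exact hS' (u, b, c, d) _ ⟨z₁, z₂, z₃, z₄, h1, h2, h3, h4, rfl⟩

theorem Perfect.exists_edge {E : Fin m → Fin m → Prop} {σ : Equiv.Perm (Fin m)}
    (h : Perfect E σ) (i : Fin m) : ∃ j, E i j := ⟨σ i, h i⟩

/-- A weight function that is nonzero on the vectors of short closed walks destroys them. -/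
theorem NoShort.minEdges {E : Fin m → Fin m → Prop} {k : ℕ} {w : Fin m → Fin m → ℤ}
    (hne : ∃ σ, Perfect E σ)
    (hw : ∀ u z, AltWalk E (2 ^ (k + 1)) u u z → z ≠ 0 → (∀ i j, |z i j| ≤ 1) →
      ∑ i, ∑ j, z i j * w i j ≠ 0) : NoShort (minEdges E w) (k + 1) := by
  intro u z h
  by_contra hz
  -- The simple walk, padded to `2 ^ (k + 1)` steps, has nonzero weight by `hw`, yet it is a
  -- circulation on the minimal edges.
  obtain ⟨l, hl, u', z', h', hz', hb⟩ := h.exists_simple hz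
  obtain ⟨σ, hσ⟩ := exists_minimal w hne
  have h2 := h'.pad hσ.perfect.exists_edge (2 ^ (k + 1) - l)
  rw [Nat.add_sub_cancel' hl] at h2
  refine hw u' z' (h2.mono fun _ _ => minEdges_le) hz' hb ?_
  exact circulation_eq_zero hne z' (fun i j hij => h'.edge_of_ne_zero hij)
    (fun i => by rw [h'.sum_row, sub_self]) h'.sum_col

/-- Without short closed walks, there is at most one perfect matching. -/
theorem NoShort.unique {E : Fin m → Fin m → Prop} {k : ℕ} (h : NoShort E k) (hk : m ≤ 2 ^ k)
    {σ τ : Equiv.Perm (Fin m)} (hσ : Perfect E σ) (hτ : Perfect E τ) : σ = τ := by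
  by_contra hne
  obtain ⟨u, hu⟩ : ∃ u, σ u ≠ τ u := by
    by_contra! h'
    exact hne (Equiv.ext h')
  -- The walk alternates between edges of `σ` (positive) and of `τ` (negative) along the cycle of
  -- `u` in the union. The entry at `(u, σ u)` receives no negative term because `u` is not fixed by
  -- `π`, so it stays positive.
  set π := fun x => τ.symm (σ x) with hπ
  have hπu : π u ≠ u := fun h' => hu (by
    rw [hπ] at h'
    exact (τ.symm_apply_eq).1 h')
  have walk : ∀ l x, ∃ z, AltWalk E l x (π^[l] x) z ∧ 0 ≤ z u (σ u) ∧
      (x = u → 0 < l → 0 < z u (σ u)) := by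
    intro l
    induction l with
    | zero => exact fun x => ⟨0, .nil x, by simp, by simp⟩
    | succ l ih =>
      intro x
      obtain ⟨z, hz, h0, -⟩ := ih (π x)
      have h1 : edge (π x) (σ x) u (σ u) = 0 := by
        rw [edge, if_neg]
        rintro ⟨h1, h2⟩
        rw [σ.injective h2] at h1
        exact hπu h1
      refine ⟨_, .cons (hσ x) (show E (π x) (σ x) by simpa [hπ] using hτ (π x)) hz, ?_, ?_⟩
      · simp only [Pi.add_apply, Pi.sub_apply, h1]
        have : 0 ≤ edge x (σ x) u (σ u) := by rw [edge]; split_ifs <;> norm_num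
        linarith
      · rintro rfl -
        simp only [Pi.add_apply, Pi.sub_apply, h1]
        have : edge x (σ x) x (σ x) = 1 := by simp [edge]
        linarith
  have hinj : Function.Injective π := τ.symm.injective.comp σ.injective
  have hper : u ∈ Function.periodicPts π := by
    have := hinj.mem_periodicPts u
    exact this
  obtain ⟨z, hz, -, hpos⟩ := walk (Function.minimalPeriod π u) u
  have hle : Function.minimalPeriod π u ≤ m := by
    simpa using Function.minimalPeriod_le_card (f := π) (x := u)
  rw [Function.iterate_minimalPeriod] at hz
  have h2 := hz.pad hσ.exists_edge (2 ^ k - Function.minimalPeriod π u)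
  rw [Nat.add_sub_cancel' (hle.trans hk)] at h2
  have := hpos rfl (Function.minimalPeriod_pos_of_mem_periodicPts hper)
  rw [h u z h2] at this
  simp at this

end Isolation

namespace Isolation

/-! ### Weights modulo small numbers -/

/-- A number with digits `-1`, `0`, `1` in base two. -/
theorem abs_sum_two_pow_lt {n : ℕ} (a : Fin n → ℤ) (ha : ∀ i, |a i| ≤ 1) :
    |∑ i, a i * 2 ^ (i : ℕ)| < 2 ^ n := by
  induction n with
  | zero => simp
  | succ n ih =>
    rw [Fin.sum_univ_castSucc, pow_succ]
    have h1 := ih (fun i => a i.castSucc) fun i => ha _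
    have h2 : |a (Fin.last n) * 2 ^ n| ≤ 2 ^ n := by
      rw [abs_mul, abs_of_nonneg (by positivity : (0 : ℤ) ≤ 2 ^ n)]
      exact mul_le_of_le_one_left (by positivity) (ha _)
    simp only [Fin.val_castSucc, Fin.val_last]
    have := abs_add_le (∑ i : Fin n, a i.castSucc * 2 ^ (i : ℕ)) (a (Fin.last n) * 2 ^ n)
    linarith

/-- The highest nonzero digit outweighs all lower ones. -/
theorem sum_two_pow_ne_zero {n : ℕ} (a : Fin n → ℤ) (ha : ∀ i, |a i| ≤ 1) (h : a ≠ 0) :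
    ∑ i, a i * 2 ^ (i : ℕ) ≠ 0 := by
  induction n with
  | zero => exact (h (Subsingleton.elim _ _)).elim
  | succ n ih =>
    rw [Fin.sum_univ_castSucc]
    simp only [Fin.val_castSucc, Fin.val_last]
    by_cases h0 : a (Fin.last n) = 0
    · rw [h0, zero_mul, add_zero]
      refine ih (fun i => a i.castSucc) (fun i => ha _) fun h1 => h (funext fun i => ?_)
      induction i using Fin.lastCases with
      | last => exact h0
      | cast i => exact congrFun h1 i
    · intro h1
      have h2 := abs_sum_two_pow_lt (fun i => a i.castSucc) fun i => ha _
      rw [eq_neg_of_add_eq_zero_left h1, abs_neg, abs_mul,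
        abs_of_nonneg (by positivity : (0 : ℤ) ≤ 2 ^ n)] at h2
      have h3 : 1 ≤ |a (Fin.last n)| := Int.one_le_abs h0
      have : (1 : ℤ) * 2 ^ n ≤ |a (Fin.last n)| * 2 ^ n := by gcongr
      linarith

/-- The value of the vector `z` for the weight function with weights `2 ^ (i * m + j)`. -/
theorem sum_two_pow_reindex {m : ℕ} (z : Fin m → Fin m → ℤ) :
    ∑ i, ∑ j, z i j * 2 ^ ((i : ℕ) * m + j) =
      ∑ x : Fin (m * m), z (finProdFinEquiv.symm x).1 (finProdFinEquiv.symm x).2 * 2 ^ (x : ℕ) := by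
  rw [← Equiv.sum_comp finProdFinEquiv, Fintype.sum_prod_type]
  refine Finset.sum_congr rfl fun i _ => Finset.sum_congr rfl fun j _ => ?_
  rw [Equiv.symm_apply_apply, finProdFinEquiv_apply_val, add_comm, mul_comm m]

/-- If every number up to `T` divides `P`, then `2 ^ T` is at most `T * P`. -/
theorem two_pow_le_mul_of_forall_dvd {t P : ℕ} (ht : 1 ≤ t) (hP : P ≠ 0)
    (h : ∀ M, 1 ≤ M → M ≤ 2 * t → M ∣ P) : 2 ^ (2 * t) ≤ 2 * t * P := by
  -- Every prime power dividing the central binomial coefficient is at most `2 * t`, hence divides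
  -- `P`; and `4 ^ t` is at most `2 * t` times that coefficient.
  have hdvd : Nat.centralBinom t ∣ P := by
    rw [← Nat.factorization_le_iff_dvd (Nat.centralBinom_ne_zero t) hP]
    intro p
    by_cases hp : p.Prime
    · rw [← hp.pow_dvd_iff_le_factorization hP]
      refine h _ (Nat.pos_of_ne_zero (pow_ne_zero _ hp.ne_zero)) ?_
      exact Nat.pow_factorization_choose_le (by omega)
    · rw [Nat.factorization_eq_zero_of_not_prime _ hp]
      exact Nat.zero_le _
  have h1 := Nat.four_pow_le_two_mul_self_mul_centralBinom t ht
  rw [show (4 : ℕ) = 2 ^ 2 by rfl, ← pow_mul] at h1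
  exact h1.trans (Nat.mul_le_mul_left _ (Nat.le_of_dvd (Nat.pos_of_ne_zero hP) hdvd))

/-- The inequality that refutes divisibility by all moduli. With `x = 2 ^ L - 1` both `m` and `L`
are at most `x`, and `(x + 1) ^ 6` exceeds `x ^ 6` by more than `6 * x`. -/
theorem add_pow_six_lt {L m : ℕ} (hL : 1 ≤ L) (h : m < 2 ^ L) : 6 * L + m ^ 6 < 2 ^ (6 * L) := by
  have h1 : L < 2 ^ L := Nat.lt_two_pow_self
  obtain ⟨x, hx⟩ : ∃ x, 2 ^ L = x + 1 := ⟨2 ^ L - 1, by have := Nat.two_pow_pos L; omega⟩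
  have hx1 : 1 ≤ x := by omega
  rw [show 2 ^ (6 * L) = (2 ^ L) ^ 6 by rw [← pow_mul, mul_comm], hx]
  have h2 : m ^ 6 ≤ x ^ 6 := Nat.pow_le_pow_left (by omega) 6
  have h3 : 6 * L ≤ 6 * x := by omega
  have h4 : x ≤ x ^ 5 := Nat.le_self_pow (by norm_num) x
  have h5 : (x + 1) ^ 6 = x ^ 6 + 6 * x ^ 5 + (15 * x ^ 4 + 20 * x ^ 3 + 15 * x ^ 2 + 6 * x + 1) := by
    ring
  omega

variable {m : ℕ}

/-- Some modulus keeps few short vectors of small entries nonzero. -/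
theorem exists_modulus {L : ℕ} (hL : 1 ≤ L) (hm : m < 2 ^ L)
    (S : Finset (Fin m → Fin m → ℤ)) (hS : S.card ≤ m ^ 4) :
    ∃ M < 2 ^ (6 * L), ∀ z ∈ S, z ≠ 0 → (∀ i j, |z i j| ≤ 1) →
      ∑ i, ∑ j, z i j * ((2 ^ ((i : ℕ) * m + j) % (M + 1) : ℕ) : ℤ) ≠ 0 := by
  classical
  by_contra! hcon
  -- If the residues modulo `M` give `z` weight zero, then `M` divides `X z`. Should every modulus
  -- fail, all numbers up to `2 ^ (6 * L)` divide the product `P`, which has at most `m ^ 4` factors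
  -- of size at most `2 ^ m ^ 2`.
  set X : (Fin m → Fin m → ℤ) → ℤ := fun z => ∑ i, ∑ j, z i j * 2 ^ ((i : ℕ) * m + j) with hX
  set B := S.filter fun z => z ≠ 0 ∧ ∀ i j, |z i j| ≤ 1 with hB
  set P := ∏ z ∈ B, (X z).natAbs with hP
  have hX0 : ∀ z ∈ B, X z ≠ 0 := by
    intro z hz
    obtain ⟨-, hz0, hz1⟩ := Finset.mem_filter.1 hz
    rw [hX]
    simp only
    rw [sum_two_pow_reindex]
    refine sum_two_pow_ne_zero _ (fun i => hz1 _ _) fun h => hz0 ?_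
    ext i j
    simpa using congrFun h (finProdFinEquiv (i, j))
  have hXlt : ∀ z ∈ B, (X z).natAbs ≤ 2 ^ (m * m) := by
    intro z hz
    obtain ⟨-, hz0, hz1⟩ := Finset.mem_filter.1 hz
    have := abs_sum_two_pow_lt (fun x : Fin (m * m) =>
      z (finProdFinEquiv.symm x).1 (finProdFinEquiv.symm x).2) fun i => hz1 _ _
    rw [← sum_two_pow_reindex, Int.abs_eq_natAbs] at this
    exact_mod_cast this.le
  have hP0 : P ≠ 0 := Finset.prod_ne_zero_iff.2 fun z hz => Int.natAbs_ne_zero.2 (hX0 z hz)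
  have hPle : P ≤ 2 ^ m ^ 6 := by
    refine (Finset.prod_le_pow_card B _ _ hXlt).trans ?_
    rw [← pow_mul]
    refine Nat.pow_le_pow_right (by norm_num) ?_
    calc m * m * B.card ≤ m * m * m ^ 4 :=
          Nat.mul_le_mul_left _ ((Finset.card_filter_le _ _).trans hS)
      _ = m ^ 6 := by ring
  have hT : 2 ^ (6 * L) = 2 * 2 ^ (6 * L - 1) := by rw [← pow_succ']; congr 1; omega
  have h := two_pow_le_mul_of_forall_dvd (t := 2 ^ (6 * L - 1)) Nat.one_le_two_pow hP0 (by
    intro M hM1 hM2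
    rw [← hT] at hM2
    obtain ⟨z, hz, hz0, hz1, hz2⟩ := hcon (M - 1) (by omega)
    rw [Nat.sub_add_cancel hM1] at hz2
    have hzB : z ∈ B := Finset.mem_filter.2 ⟨hz, hz0, hz1⟩
    refine dvd_trans ?_ (Finset.dvd_prod_of_mem (fun z => (X z).natAbs) hzB)
    rw [← Int.natCast_dvd]
    have : X z = ∑ i, ∑ j, z i j * (2 ^ ((i : ℕ) * m + j) -
        ((2 ^ ((i : ℕ) * m + j) % M : ℕ) : ℤ)) := by
      simp only [mul_sub, Finset.sum_sub_distrib, hz2, sub_zero, hX]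
    rw [this]
    refine Finset.dvd_sum fun i _ => Finset.dvd_sum fun j _ => Dvd.dvd.mul_left ?_ _
    push_cast
    exact Int.dvd_self_sub_emod)
  rw [← hT] at h
  have h2 : 2 ^ 2 ^ (6 * L) ≤ 2 ^ (6 * L + m ^ 6) := by
    rw [pow_add]
    exact h.trans (Nat.mul_le_mul_left _ hPle)
  have := (Nat.pow_le_pow_iff_right (by norm_num)).1 h2
  have := add_pow_six_lt hL hm
  omega

/-! ### The iterated weights -/

/-- The weight of the edge with number `e` after `k` rounds, for the moduli that are the digits of
`r` in base `2 ^ (6 * L)`. -/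
def roundWeight (L : ℕ) : ℕ → ℕ → ℕ → ℕ
  | 0, _, _ => 0
  | k + 1, r, e =>
    -- The newest round uses the lowest digit of `r` and fills the lowest bits of the weight, so it
    -- only breaks the ties left by the earlier rounds.
    2 ^ (7 * L) * roundWeight L k (r / 2 ^ (6 * L)) e + 2 ^ e % (r % 2 ^ (6 * L) + 1)

theorem residue_lt {L : ℕ} (hL : 1 ≤ L) (r e : ℕ) :
    2 ^ e % (r % 2 ^ (6 * L) + 1) < 2 ^ (7 * L) := by
  have h1 := Nat.mod_lt (2 ^ e) (show 0 < r % 2 ^ (6 * L) + 1 by omega)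
  have h2 := Nat.mod_lt r (Nat.two_pow_pos (6 * L))
  have h3 : 2 ^ (6 * L) ≤ 2 ^ (7 * L) := Nat.pow_le_pow_right (by norm_num) (by omega)
  omega

theorem roundWeight_lt {L : ℕ} (hL : 1 ≤ L) (k r e : ℕ) :
    roundWeight L k r e < 2 ^ (7 * L * k) := by
  induction k generalizing r with
  | zero => simp [roundWeight]
  | succ k ih =>
    rw [roundWeight, Nat.mul_succ, pow_add, mul_comm (2 ^ (7 * L * k))]
    have h1 := residue_lt hL r e
    have h2 : roundWeight L k (r / 2 ^ (6 * L)) e + 1 ≤ 2 ^ (7 * L * k) := ih _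
    calc _ < 2 ^ (7 * L) * (roundWeight L k (r / 2 ^ (6 * L)) e + 1) := by rw [Nat.mul_succ]; omega
      _ ≤ _ := Nat.mul_le_mul_left _ h2

/-- Blocks of `7 * L` bits do not overlap, and each is the residue for one digit of `r`. This
non-recursive form is what `query` computes. -/
theorem testBit_roundWeight {L : ℕ} (hL : 1 ≤ L) {k : ℕ} (r e : ℕ) {l : ℕ} (hl : l < 7 * L * k) :
    (roundWeight L k r e).testBit l =
      (2 ^ e % (r / (2 ^ (6 * L)) ^ (l / (7 * L)) % 2 ^ (6 * L) + 1)).testBit (l % (7 * L)) := by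
  induction k generalizing r l with
  | zero => simp at hl
  | succ k ih =>
    rw [roundWeight, Nat.testBit_two_pow_mul_add _ (residue_lt hL r e)]
    split_ifs with h
    · rw [Nat.div_eq_of_lt h, Nat.mod_eq_of_lt h, pow_zero, Nat.div_one]
    · obtain ⟨l, rfl⟩ := Nat.exists_eq_add_of_le (not_lt.1 h)
      rw [Nat.mul_succ] at hl
      rw [Nat.add_sub_cancel_left, ih _ (by omega), Nat.add_mod_left,
        Nat.add_div_left _ (by omega : 0 < 7 * L), pow_succ', Nat.div_div_eq_div_mul]

/-- The reason for blocks of `7 * L` bits: a matching adds fewer than `2 ^ L` residues of size at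
most `2 ^ (6 * L)`, so its total never reaches the unit of the earlier rounds. -/
theorem weight_residue {L : ℕ} (hm : m < 2 ^ L) (r : ℕ) (σ : Equiv.Perm (Fin m)) :
    0 ≤ weight (fun i j => ((2 ^ ((i : ℕ) * m + j) % (r % 2 ^ (6 * L) + 1) : ℕ) : ℤ)) σ ∧
      weight (fun i j => ((2 ^ ((i : ℕ) * m + j) % (r % 2 ^ (6 * L) + 1) : ℕ) : ℤ)) σ <
        2 ^ (7 * L) := by
  refine ⟨Finset.sum_nonneg fun i _ => by positivity, ?_⟩
  have h : ∀ i : Fin m, ((2 ^ ((i : ℕ) * m + σ i) % (r % 2 ^ (6 * L) + 1) : ℕ) : ℤ) ≤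
      2 ^ (6 * L) := by
    intro i
    have h1 := Nat.mod_lt (2 ^ ((i : ℕ) * m + σ i)) (show 0 < r % 2 ^ (6 * L) + 1 by omega)
    have h2 := Nat.mod_lt r (Nat.two_pow_pos (6 * L))
    have : 2 ^ ((i : ℕ) * m + σ i) % (r % 2 ^ (6 * L) + 1) ≤ 2 ^ (6 * L) := by omega
    exact_mod_cast this
  calc _ ≤ ∑ _i : Fin m, (2 ^ (6 * L) : ℤ) := Finset.sum_le_sum fun i _ => h i
    _ = m * 2 ^ (6 * L) := by simp
    _ < 2 ^ L * 2 ^ (6 * L) := by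
      have : (m : ℤ) < 2 ^ L := by exact_mod_cast hm
      gcongr
    _ = 2 ^ (7 * L) := by rw [← pow_add]; congr 1; omega

/-- After `k` rounds with suitable moduli, the perfect matchings of minimal weight are those of a
graph without short closed walks of nonzero vector. -/
theorem exists_rounds {L : ℕ} (hL : 1 ≤ L) (hm : m < 2 ^ L) {E : Fin m → Fin m → Prop}
    (hE : ∃ σ, Perfect E σ) (k : ℕ) :
    ∃ r < (2 ^ (6 * L)) ^ k, ∃ F : Fin m → Fin m → Prop, NoShort F k ∧ ∀ σ, Perfect F σ ↔
      Minimal E (fun i j => (roundWeight L k r ((i : ℕ) * m + j) : ℤ)) σ := by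
  induction k with
  | zero =>
    exact ⟨0, by simp, E, noShort_zero E, fun σ => by simp [Minimal, weight, roundWeight]⟩
  | succ k ih =>
    obtain ⟨r, hr, F, hF, hFE⟩ := ih
    obtain ⟨S, hS, hS'⟩ := hF.exists_finset
    obtain ⟨M, hM, hz⟩ := exists_modulus hL hm S hS
    have hdiv : (2 ^ (6 * L) * r + M) / 2 ^ (6 * L) = r := by
      rw [Nat.mul_add_div (Nat.two_pow_pos _), Nat.div_eq_of_lt hM, add_zero]
    have hmod : (2 ^ (6 * L) * r + M) % 2 ^ (6 * L) = M := by
      rw [Nat.mul_add_mod, Nat.mod_eq_of_lt hM]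
    set w : Fin m → Fin m → ℤ := fun i j => ((2 ^ ((i : ℕ) * m + j) % (M + 1) : ℕ) : ℤ) with hw
    set v : Fin m → Fin m → ℤ := fun i j => (roundWeight L k r ((i : ℕ) * m + j) : ℤ) with hv
    set W : Fin m → Fin m → ℤ :=
      fun i j => (roundWeight L (k + 1) (2 ^ (6 * L) * r + M) ((i : ℕ) * m + j) : ℤ) with hW
    have hsum : ∀ σ, weight W σ = 2 ^ (7 * L) * weight v σ + weight w σ := by
      intro σ
      simp only [weight, roundWeight, hdiv, hmod, Nat.cast_add, Nat.cast_mul, Nat.cast_pow,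
        Nat.cast_ofNat, Finset.sum_add_distrib, Finset.mul_sum, hw, hv, hW]
    -- The old weight decides first, so the minimal matchings for `W` are those of `F` that are
    -- minimal for `w`, which are the perfect matchings of `minEdges F w`.
    have hlex : ∀ σ τ, weight v σ < weight v τ → weight W σ < weight W τ := by
      intro σ τ hlt
      have h1 := (weight_residue hm M σ).2
      have h2 := (weight_residue hm M τ).1
      rw [Nat.mod_eq_of_lt hM] at h1 h2
      have : (2 : ℤ) ^ (7 * L) * (weight v σ + 1) ≤ 2 ^ (7 * L) * weight v τ :=
        mul_le_mul_of_nonneg_left hlt (by positivity)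
      rw [hsum, hsum]
      linarith
    have hFσ : ∃ σ, Perfect F σ := (exists_minimal v hE).imp fun σ => (hFE σ).2
    refine ⟨2 ^ (6 * L) * r + M, ?_, minEdges F w, ?_, fun σ =>
      ⟨fun h => ?_, fun h => Minimal.perfect ?_⟩⟩
    · rw [pow_succ']
      calc _ < 2 ^ (6 * L) * (r + 1) := by rw [Nat.mul_succ]; omega
        _ ≤ _ := Nat.mul_le_mul_left _ hr
    · exact NoShort.minEdges hFσ fun u z h h0 h1 => hz z (hS' u z h) h0 h1
    · have hσ := Minimal.of_perfect_minEdges h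
      have hσE := (hFE σ).1 hσ.1
      refine ⟨hσE.1, fun τ hτ => ?_⟩
      rcases (hσE.2 τ hτ).lt_or_eq with hlt | heq
      · exact (hlex σ τ hlt).le
      · rw [hsum, hsum, heq]
        exact add_le_add_right (hσ.2 τ ((hFE τ).2 ⟨hτ, fun ρ hρ => heq ▸ hσE.2 ρ hρ⟩)) _
    · obtain ⟨τ, hτ⟩ := exists_minimal w hFσ
      have hτE := (hFE τ).1 hτ.1
      have h1 : weight v σ = weight v τ :=
        le_antisymm (not_lt.1 fun hlt => (hlex τ σ hlt).not_ge (h.2 τ hτE.1)) (hτE.2 σ h.1)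
      have h2 := h.2 τ hτE.1
      rw [hsum, hsum, h1] at h2
      exact ⟨(hFE σ).2 ⟨h.1, fun ρ hρ => h1 ▸ hτE.2 ρ hρ⟩,
        fun ρ hρ => (le_of_add_le_add_left h2).trans (hτ.2 ρ hρ)⟩

/-- Some iterated weight function isolates a perfect matching. -/
theorem exists_unique_minimal {L : ℕ} (hL : 1 ≤ L) (hm : m < 2 ^ L) {E : Fin m → Fin m → Prop}
    (hE : ∃ σ, Perfect E σ) : ∃ r < (2 ^ (6 * L)) ^ L,
      ∃! σ, Minimal E (fun i j => (roundWeight L L r ((i : ℕ) * m + j) : ℤ)) σ := by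
  obtain ⟨r, hr, F, hF, hFE⟩ := exists_rounds hL hm hE L
  obtain ⟨σ, hσ⟩ := exists_minimal (fun i j => (roundWeight L L r ((i : ℕ) * m + j) : ℤ)) hE
  exact ⟨r, hr, σ, hσ, fun τ hτ => hF.unique hm.le ((hFE τ).2 hτ) ((hFE σ).2 hσ)⟩

end Isolation

/-! ### Perfect matchings and permutations -/

namespace Isolation

variable {m : ℕ} {G : SimpleGraph (Fin m ⊕ Fin m)}

/-- The edges of a bipartite graph, as pairs of indices. -/
def graphEdge (G : SimpleGraph (Fin m ⊕ Fin m)) (i j : Fin m) : Prop := G.Adj (.inl i) (.inr j)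

/-- The matching of a permutation. -/
def matchingOf {σ : Equiv.Perm (Fin m)} (hσ : Perfect (graphEdge G) σ) : G.Subgraph where
  verts := Set.univ
  Adj x y := (∃ i, x = .inl i ∧ y = .inr (σ i)) ∨ ∃ i, x = .inr (σ i) ∧ y = .inl i
  adj_sub := by
    rintro x y (⟨i, rfl, rfl⟩ | ⟨i, rfl, rfl⟩)
    · exact hσ i
    · exact (hσ i).symm
  edge_vert _ := Set.mem_univ _
  symm := ⟨by
    rintro x y (⟨i, rfl, rfl⟩ | ⟨i, rfl, rfl⟩)
    · exact .inr ⟨i, rfl, rfl⟩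
    · exact .inl ⟨i, rfl, rfl⟩⟩

theorem matchingOf_adj {σ : Equiv.Perm (Fin m)} (hσ : Perfect (graphEdge G) σ) (i j : Fin m) :
    (matchingOf hσ).Adj (.inl i) (.inr j) ↔ σ i = j := by
  simp [matchingOf, eq_comm]

theorem isPerfectMatching_matchingOf {σ : Equiv.Perm (Fin m)} (hσ : Perfect (graphEdge G) σ) :
    (matchingOf hσ).IsPerfectMatching := by
  rw [SimpleGraph.Subgraph.isPerfectMatching_iff]
  rintro (i | j)
  · exact ⟨.inr (σ i), .inl ⟨i, rfl, rfl⟩, by simp [matchingOf]⟩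
  · refine ⟨.inl (σ.symm j), .inr ⟨σ.symm j, by simp, rfl⟩, ?_⟩
    rintro y (⟨i, h, -⟩ | ⟨i, h, rfl⟩)
    · cases h
    · rw [Sum.inr.injEq] at h
      rw [h, Equiv.symm_apply_apply]

theorem matchingWeight_of_adj {M : G.Subgraph} {σ : Equiv.Perm (Fin m)}
    (h : ∀ i j, M.Adj (.inl i) (.inr j) ↔ σ i = j) (w : Fin m → Fin m → ℤ) :
    matchingWeight w M = weight w σ := by
  simp [matchingWeight, weight, h]

/-- A matching sends left vertices injectively to right vertices, and the two parts have equal size.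
-/
theorem exists_perm_of_isPerfectMatching
    (hG : G.IsBipartiteWith (Set.range Sum.inl) (Set.range Sum.inr)) {M : G.Subgraph}
    (hM : M.IsPerfectMatching) :
    ∃ σ : Equiv.Perm (Fin m), ∀ i j, M.Adj (.inl i) (.inr j) ↔ σ i = j := by
  rw [SimpleGraph.Subgraph.isPerfectMatching_iff] at hM
  have hl : ∀ i, ∃ j, M.Adj (.inl i) (.inr j) := by
    intro i
    obtain ⟨y, hy, -⟩ := hM (.inl i)
    obtain ⟨j, rfl⟩ := hG.mem_of_mem_adj ⟨i, rfl⟩ hy.adj_sub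
    exact ⟨j, hy⟩
  choose f hf using hl
  have hinj : Function.Injective f := by
    intro i i' h
    have h1 := hf i'
    rw [← h] at h1
    exact Sum.inl_injective ((hM (.inr (f i))).unique (hf i).symm h1.symm)
  refine ⟨Equiv.ofBijective f (Finite.injective_iff_bijective.1 hinj), fun i j => ⟨fun h => ?_, ?_⟩⟩
  · exact Sum.inr_injective ((hM (.inl i)).unique (hf i) h)
  · rintro rfl
    exact hf i

theorem eq_of_adj_iff (hG : G.IsBipartiteWith (Set.range Sum.inl) (Set.range Sum.inr))
    {M M' : G.Subgraph} (hM : M.IsPerfectMatching) (hM' : M'.IsPerfectMatching)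
    (h : ∀ i j, M.Adj (.inl i) (.inr j) ↔ M'.Adj (.inl i) (.inr j)) : M = M' := by
  refine SimpleGraph.Subgraph.ext ?_ ?_
  · rw [hM.2.verts_eq_univ, hM'.2.verts_eq_univ]
  · have aux : ∀ {A B : G.Subgraph},
        (∀ i j, A.Adj (.inl i) (.inr j) → B.Adj (.inl i) (.inr j)) →
          ∀ x y, A.Adj x y → B.Adj x y := by
      intro A B hAB x y hxy
      rcases hG.mem_of_adj hxy.adj_sub with ⟨⟨i, rfl⟩, j, rfl⟩ | ⟨⟨j, rfl⟩, i, rfl⟩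
      · exact hAB i j hxy
      · exact (hAB i j hxy.symm).symm
    funext x y
    exact propext ⟨aux (fun i j => (h i j).1) x y, aux (fun i j => (h i j).2) x y⟩

theorem isIsolating_of_existsUnique
    (hG : G.IsBipartiteWith (Set.range Sum.inl) (Set.range Sum.inr)) {w : Fin m → Fin m → ℤ}
    (h : ∃! σ, Minimal (graphEdge G) w σ) : IsIsolating G w := by
  rintro -
  obtain ⟨σ, hσ, huniq⟩ := h
  refine ⟨matchingOf hσ.1, ⟨isPerfectMatching_matchingOf hσ.1, fun M hM => ?_⟩, ?_⟩
  · obtain ⟨τ, hτ⟩ := exists_perm_of_isPerfectMatching hG hM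
    rw [matchingWeight_of_adj (matchingOf_adj hσ.1), matchingWeight_of_adj hτ]
    exact hσ.2 τ fun i => ((hτ i _).2 rfl).adj_sub
  · rintro M ⟨hM, hmin⟩
    obtain ⟨τ, hτ⟩ := exists_perm_of_isPerfectMatching hG hM
    have hτm : Minimal (graphEdge G) w τ := by
      refine ⟨fun i => ((hτ i _).2 rfl).adj_sub, fun ρ hρ => ?_⟩
      have := hmin _ (isPerfectMatching_matchingOf hρ)
      rwa [matchingWeight_of_adj (matchingOf_adj hρ), matchingWeight_of_adj hτ] at this
    obtain rfl := huniq τ hτm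
    exact eq_of_adj_iff hG hM (isPerfectMatching_matchingOf hσ.1) fun i j => by
      rw [hτ, matchingOf_adj]

theorem exists_perfect_of_isPerfectMatching
    (hG : G.IsBipartiteWith (Set.range Sum.inl) (Set.range Sum.inr)) {M : G.Subgraph}
    (hM : M.IsPerfectMatching) : ∃ σ, Perfect (graphEdge G) σ := by
  obtain ⟨σ, hσ⟩ := exists_perm_of_isPerfectMatching hG hM
  exact ⟨σ, fun i => ((hσ i _).2 rfl).adj_sub⟩

end Isolation

/-! ### The list of weight functions -/

theorem ofFn_eq_map_range {α : Type*} (n : ℕ) (g : ℕ → α) :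
    (List.ofFn fun i : Fin n => g i) = (List.range n).map g := by
  rw [List.ofFn_eq_map, ← List.map_coe_finRange_eq_range, List.map_map]
  rfl

/-- Merges two nested levels of a concatenation into one range; `encodeWeights_eq` applies it once
for each level. -/
theorem flatten_ofFn_map_range {α : Type*} (a b : ℕ) (g : ℕ → α) :
    (List.ofFn fun x : Fin a => (List.range b).map fun y => g (x * b + y)).flatten =
      (List.range (a * b)).map g := by
  rw [ofFn_eq_map_range a fun x => (List.range b).map fun y => g (x * b + y)]
  induction a with
  | zero => simp
  | succ a ih =>
    rw [List.range_succ, List.map_append, List.flatten_append, ih, Nat.succ_mul, List.range_add]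
    simp

theorem encodeWeights_eq {N m : ℕ} (b : ℕ) (W : ℕ → ℕ → ℕ → ℕ) (g : ℕ → Bool)
    (h : ∀ r < N, ∀ i < m, ∀ j < m, ∀ l < b,
      g (((r * m + i) * m + j) * b + l) = (W r i j).testBit l) :
    encodeWeights b (fun (r : Fin N) (i j : Fin m) => W r i j) =
      (List.range (N * m * m * b)).map g := by
  have e : encodeWeights b (fun (r : Fin N) (i j : Fin m) => W r i j) =
      (List.ofFn fun r : Fin N => (List.ofFn fun i : Fin m => (List.ofFn fun j : Fin m =>
        List.ofFn fun l : Fin b =>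
          g (((r * m + i) * m + j) * b + l)).flatten).flatten).flatten := by
    unfold encodeWeights
    simp only [h _ (Fin.isLt _) _ (Fin.isLt _) _ (Fin.isLt _) _ (Fin.isLt _)]
  rw [e]
  have e3 : ∀ x, (List.ofFn fun j : Fin m => List.ofFn fun l : Fin b =>
      g ((x * m + j) * b + l)).flatten = (List.range (m * b)).map fun y => g (x * (m * b) + y) := by
    intro x
    rw [← flatten_ofFn_map_range m b fun y => g (x * (m * b) + y)]
    congr 2
    funext j
    rw [ofFn_eq_map_range b fun l => g ((x * m + j) * b + l)]
    congr 1
    funext l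
    congr 1
    ring
  have e2 : ∀ x, (List.ofFn fun i : Fin m => (List.range (m * b)).map fun y =>
      g ((x * m + i) * (m * b) + y)).flatten =
        (List.range (m * (m * b))).map fun y => g (x * (m * (m * b)) + y) := by
    intro x
    rw [← flatten_ofFn_map_range m (m * b) fun y => g (x * (m * (m * b)) + y)]
    congr 2
    funext i
    congr 1
    funext y
    congr 1
    ring
  simp only [e3, e2]
  rw [flatten_ofFn_map_range N (m * (m * b)) g]
  congr 2
  ring

/-- Joins the two sides of the proof: the bit that the circuits output is the bit of the isolating
weight at that place. -/
theorem weightBit_index {m L : ℕ} (hL : Nat.log 2 (2 * m) = L) (hL1 : 1 ≤ L) {r i j l : ℕ}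
    (hi : i < m) (hj : j < m) (hl : l < 7 * L ^ 2) :
    weightBit (2 * m) (((r * m + i) * m + j) * (7 * L ^ 2) + l) =
      (Isolation.roundWeight L L r (i * m + j)).testBit l := by
  have hl' : l < 7 * L * L := by rwa [pow_two, ← mul_assoc] at hl
  have h1 : (((r * m + i) * m + j) * (7 * L ^ 2) + l) / (7 * L ^ 2) = r * m ^ 2 + (i * m + j) := by
    rw [mul_comm, Nat.mul_add_div (by positivity), Nat.div_eq_of_lt hl]
    ring
  have h2 : (((r * m + i) * m + j) * (7 * L ^ 2) + l) % (7 * L ^ 2) = l := by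
    rw [mul_comm, Nat.mul_add_mod, Nat.mod_eq_of_lt hl]
  have h3 : i * m + j < m ^ 2 := by
    calc i * m + j < (i + 1) * m := by rw [Nat.succ_mul]; omega
      _ ≤ m * m := Nat.mul_le_mul_right _ hi
      _ = m ^ 2 := (pow_two m).symm
  have h4 : (r * m ^ 2 + (i * m + j)) % m ^ 2 = i * m + j := by
    rw [mul_comm, Nat.mul_add_mod, Nat.mod_eq_of_lt h3]
  have h5 : (r * m ^ 2 + (i * m + j)) / m ^ 2 = r := by
    rw [mul_comm, Nat.mul_add_div (by omega), Nat.div_eq_of_lt h3, add_zero]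
  rw [Isolation.testBit_roundWeight hL1 _ _ hl']
  simp only [weightBit, hL, Nat.mul_div_cancel_left m two_pos, h1, h2, h4, h5]

/-- With `t` the real logarithm of `n`, the bound is `2 ^ (6 * t ^ 2)`, and `L ≤ t`. -/
theorem card_weights_le {m L : ℕ} (hm : 1 ≤ m) (hL : Nat.log 2 (2 * m) = L) :
    (((2 ^ (6 * L)) ^ L : ℕ) : ℝ) ≤
      ((2 * m : ℕ) : ℝ) ^ (6 * Real.logb 2 ((2 * m : ℕ) : ℝ)) := by
  have h0 : (0 : ℝ) < ((2 * m : ℕ) : ℝ) := by exact_mod_cast (by omega : 0 < 2 * m)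
  have h1 : (L : ℝ) ≤ Real.logb 2 ((2 * m : ℕ) : ℝ) := by
    rw [← hL]
    exact_mod_cast Real.natLog_le_logb (2 * m) 2
  set t := Real.logb 2 ((2 * m : ℕ) : ℝ) with ht
  have h2 : ((2 * m : ℕ) : ℝ) = 2 ^ t := (Real.rpow_logb two_pos (by norm_num) h0).symm
  rw [h2, ← Real.rpow_mul two_pos.le, ← pow_mul]
  push_cast
  rw [← Real.rpow_natCast]
  refine Real.rpow_le_rpow_of_exponent_le one_le_two ?_
  push_cast
  have h3 : (0 : ℝ) ≤ L := Nat.cast_nonneg L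
  nlinarith

/-- There is a function in quasi-NC^1 that on input `1ⁿ`, `n = 2 * m`, outputs a family of
`N = O(n ^ (6 * log n))` weight functions on `[n/2] × [n/2]` with weights of `c * ⌊log n⌋ ^ 2` bits,
such that for every bipartite graph on `n` nodes one of them is isolating. -/
theorem mainTheorem2 :
    ∃ F : List Bool → List Bool, InQuasiNC 1 F ∧
      ∃ (c : ℕ) (K : ℝ), ∀ m : ℕ, 1 ≤ m →
        ∃ (N : ℕ) (W : Fin N → Fin m → Fin m → ℕ),
          (N : ℝ) ≤ K * ((2 * m : ℕ) : ℝ) ^ (6 * Real.logb 2 ((2 * m : ℕ) : ℝ)) ∧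
          (∀ r i j, W r i j < 2 ^ (c * Nat.log 2 (2 * m) ^ 2)) ∧
          F (List.replicate (2 * m) true) = encodeWeights (c * Nat.log 2 (2 * m) ^ 2) W ∧
          ∀ G : SimpleGraph (Fin m ⊕ Fin m),
            G.IsBipartiteWith (Set.range Sum.inl) (Set.range Sum.inr) →
              ∃ r, IsIsolating G fun i j => (W r i j : ℤ) := by
  refine ⟨weightList, inQuasiNC_weightList, 7, 1, fun m hm => ?_⟩
  obtain ⟨L, hL⟩ : ∃ L, Nat.log 2 (2 * m) = L := ⟨_, rfl⟩
  have hL1 : 1 ≤ L := hL ▸ Nat.log_pos one_lt_two (by omega)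
  have hmL : m < 2 ^ L := by
    have := Nat.lt_pow_succ_log_self one_lt_two (2 * m)
    rw [hL, pow_succ] at this
    omega
  have hsq : 7 * L * L = 7 * L ^ 2 := by ring
  rw [hL]
  refine ⟨(2 ^ (6 * L)) ^ L, fun r i j => Isolation.roundWeight L L r (i * m + j), ?_, ?_, ?_, ?_⟩
  · rw [one_mul]
    exact card_weights_le hm hL
  · intro r i j
    rw [← hsq]
    exact Isolation.roundWeight_lt hL1 _ _ _
  · rw [encodeWeights_eq (7 * L ^ 2) (fun r i j => Isolation.roundWeight L L r (i * m + j))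
      (weightBit (2 * m)) fun r _ i hi j hj l hl => weightBit_index hL hL1 hi hj hl]
    rw [weightList, List.length_replicate, ofFn_eq_map_range _ (weightBit (2 * m))]
    congr 2
    rw [weightLength, hL, Nat.mul_div_cancel_left m two_pos]
    ring
  · intro G hG
    -- A graph without a perfect matching is isolated by every function; index `0` exists because
    -- the list is not empty.
    by_cases hM : ∃ M : G.Subgraph, M.IsPerfectMatching
    · obtain ⟨M, hM⟩ := hM
      obtain ⟨r, hr, h⟩ := Isolation.exists_unique_minimal hL1 hmL
        (Isolation.exists_perfect_of_isPerfectMatching hG hM)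
      exact ⟨⟨r, hr⟩, Isolation.isIsolating_of_existsUnique hG h⟩
    · exact ⟨⟨0, by positivity⟩, fun h => (hM h).elim⟩
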